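/- Let $\gamma\in(0,1)$ and $c>0$. For each integer $N\ge 1$ let $\beta=\beta_N>0$ and $M=M_N>N-1$ be real numbers such that, as $N\to\infty$, $N/M\to\gamma$ and $\beta N\to 2c$. Let $(\lambda_1,\dots,\lambda_N)$ be distributed according to the $\beta$-Laguerre ensemble, i.e. with joint density $$\frac{1}{Z_{N,M}^{(\beta)}}\prod_{i<j}|\lambda_j-\lambda_i|^\beta\prod_{i=1}^N\lambda_i^{\frac{\beta}{2}(M-N+1)-1}e^{-\frac{\beta M}{2}\lambda_i}\qquad(\lambda_i>0),$$ where $Z_{N,M}^{(\beta)}$ is the normalizing constant, and let $L_N=\frac1N\sum_{i=1}^N\delta_{\lambda_i}$ be the empirical distribution; write $\langle\mu,f\rangle=\int f\,d\mu$. Let $J_N=B_N(B_N)^t$, where $B_N$ is the $N\times N$ lower bidiagonal random matrix with independent entries distributed as $$B_N=\frac{1}{\sqrt{\beta M}}\begin{pmatrix}\chi_{\beta M}\\ \chi_{\beta(N-1)}&\chi_{\beta(M-1)}\\ &\ddots&\ddots\\ &&\chi_\beta&\chi_{\beta(M-N+1)}\end{pmatrix}$$ and $\chi_k$ denotes the chi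 distribution with $k$ degrees of freedom. Let $W$ be the infinite lower bidiagonal matrix with diagonal entries $\sqrt{c/\gamma+n-1}$ and subdiagonal entries $\sqrt{c+n}$, $n=1,2,\dots$. Then the Jacobi matrix $A=\frac{\gamma}{c}WW^t$ has a spectral measure $\nu_{\gamma,c}$, that is, there is a unique probability measure $\nu_{\gamma,c}$ on $\mathbb R$ with $\int x^k\,d\nu_{\gamma,c}(x)=A^k(1,1)$ (all these moments being finite) for all $k=0,1,2,\dots$. It depends only on $\gamma$ and $c$, and for every $r\in\{0,1,2,\dots\}$ the following expectations are finite and satisfy $$\mathbb E[\langle L_N,x^r\rangle]=\mathbb E\Big[\frac1N\operatorname{tr}[(J_N)^r]\Big]=\mathbb E[(J_N)^r(1,1)]\quad\text{for every }N\ge1,$$ and, as $N\to\infty$, $$\mathbb E[\langle L_N,x^r\rangle]\to\langle\nu_{\gamma,c},x^r\rangle .$$ -/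

import Mathlib

open MeasureTheory Filter Topology

noncomputable section

namespace BetaLaguerre

/-- The chi distribution with `k > 0` (real) degrees of freedom: the measure on `ℝ` with density
`x ^ (k - 1) * exp (-x² / 2) / (2 ^ (k / 2 - 1) * Γ (k / 2))` on `x > 0`. -/
def chiLaw (k : ℝ) : Measure ℝ :=
  volume.withDensity fun x => ENNReal.ofReal
    (if 0 < x then
      1 / ((2 : ℝ) ^ (k / 2 - 1) * Real.Gamma (k / 2)) * x ^ (k - 1) * Real.exp (-x ^ 2 / 2)
    else 0)

/-! ### The β-Laguerre ensemble and its empirical distribution -/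

/-- The unnormalized joint density of the β-Laguerre ensemble of `N` particles with parameters
`M > N - 1` and `β > 0`; it vanishes unless all coordinates are positive. -/
def laguerreWeight (N : ℕ) (M β : ℝ) (x : Fin N → ℝ) : ℝ :=
  open Classical in
  if ∀ i, 0 < x i then
    (∏ i, ∏ j ∈ Finset.Ioi i, |x j - x i| ^ β) *
      ∏ i, (x i ^ (β / 2 * (M - N + 1) - 1) * Real.exp (-(β * M / 2) * x i))
  else 0

/-- The normalizing constant (partition function) of the β-Laguerre ensemble. -/
def laguerreZ (N : ℕ) (M β : ℝ) : ENNReal :=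
  ∫⁻ x : Fin N → ℝ, ENNReal.ofReal (laguerreWeight N M β x)

/-- The β-Laguerre ensemble: the law on `ℝ^N` of the (unordered) particles. -/
def laguerreEnsemble (N : ℕ) (M β : ℝ) : Measure (Fin N → ℝ) :=
  (laguerreZ N M β)⁻¹ •
    (volume.withDensity fun x => ENNReal.ofReal (laguerreWeight N M β x))

/-- The empirical distribution `N⁻¹ ∑ i, δ_{x i}` of a configuration `x` of `N` points. -/
def empirical {N : ℕ} (x : Fin N → ℝ) : Measure ℝ :=
  (N : ENNReal)⁻¹ • ∑ i, Measure.dirac (x i)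

/-! ### The random tridiagonal matrix model -/

/-- The joint law of the independent chi variables in the bidiagonal matrix: with indices starting
from `0`, the diagonal variables `ω.1 i` are `χ_{β (M - i)}`, `0 ≤ i ≤ N - 1`, and the
subdiagonal variables `ω.2 i` are `χ_{β (N - 1 - i)}`, `0 ≤ i ≤ N - 2`. -/
def chiVariables (N : ℕ) (M β : ℝ) : Measure ((Fin N → ℝ) × (Fin (N - 1) → ℝ)) :=
  (Measure.pi fun i : Fin N => chiLaw (β * (M - (i : ℕ)))).prod
    (Measure.pi fun i : Fin (N - 1) => chiLaw (β * ((N : ℝ) - 1 - (i : ℕ))))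

/-- The lower bidiagonal matrix `B_N = (β M)^(-1/2) * (bidiagonal matrix of the variables)`. -/
def B (N : ℕ) (M β : ℝ) (ω : (Fin N → ℝ) × (Fin (N - 1) → ℝ)) : Matrix (Fin N) (Fin N) ℝ :=
  (1 / Real.sqrt (β * M)) • Matrix.of fun i j : Fin N =>
    if i = j then ω.1 i
    else if h : (i : ℕ) = (j : ℕ) + 1 then ω.2 ⟨j, by have := i.isLt; omega⟩
    else 0

/-- The tridiagonal matrix `J_N = B_N B_Nᵗ`. -/
def J (N : ℕ) (M β : ℝ) (ω : (Fin N → ℝ) × (Fin (N - 1) → ℝ)) : Matrix (Fin N) (Fin N) ℝ :=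
  B N M β ω * (B N M β ω).transpose

/-- The upper left entry `A(1,1)` of a square matrix (`0` for the empty matrix). -/
def topLeft {N : ℕ} (A : Matrix (Fin N) (Fin N) ℝ) : ℝ :=
  if h : 0 < N then A ⟨0, h⟩ ⟨0, h⟩ else 0

/-! ### Infinite Jacobi matrices and their spectral measures -/

/-- The product of two infinite matrices; it is only used for matrices with finitely many nonzero
entries in each row, for which every sum is finite. -/
def infMul (A A' : Matrix ℕ ℕ ℝ) : Matrix ℕ ℕ ℝ :=
  Matrix.of fun i j => ∑ᶠ k, A i k * A' k j

/-- Powers of an infinite matrix. -/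
def infPow (A : Matrix ℕ ℕ ℝ) : ℕ → Matrix ℕ ℕ ℝ
  | 0 => 1
  | r + 1 => infMul (infPow A r) A

/-- `μ` is a probability measure with `∫ x^k dμ = A^k(1,1)` for all `k = 0, 1, 2, …`. -/
def HasMoments (A : Matrix ℕ ℕ ℝ) (μ : Measure ℝ) : Prop :=
  IsProbabilityMeasure μ ∧
    ∀ k : ℕ, Integrable (fun x : ℝ => x ^ k) μ ∧ ∫ x, x ^ k ∂μ = infPow A k 0 0

/-- `μ` is the spectral measure of the infinite Jacobi matrix `A`: the unique solution of the
moment problem `∫ x^k dμ = A^k(1,1)`, `k = 0, 1, 2, …`. -/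
def IsSpectralMeasure (A : Matrix ℕ ℕ ℝ) (μ : Measure ℝ) : Prop :=
  HasMoments A μ ∧ ∀ μ' : Measure ℝ, HasMoments A μ' → μ' = μ

/-- The infinite lower bidiagonal matrix with diagonal `√(c/γ), √(c/γ + 1), …` and subdiagonal
`√(c + 1), √(c + 2), …`. -/
def W (γ c : ℝ) : Matrix ℕ ℕ ℝ :=
  Matrix.of fun i j =>
    if i = j then Real.sqrt (c / γ + i)
    else if i = j + 1 then Real.sqrt (c + i)
    else 0

/-- The infinite Jacobi matrix `(γ / c) W Wᵗ`. -/
def limitJacobi (γ c : ℝ) : Matrix ℕ ℕ ℝ :=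
  (γ / c) • infMul (W γ c) (W γ c).transpose

end BetaLaguerre

end

/-! Finite N. Adjoin to the matrix variables one more independent variable s₀ with law χ_{βN}. Let
λ_i be the eigenvalues of J_N, and w_i be s₀² times the squared first component of the i-th
normalized eigenvector. The 2N chi variables and the 2N numbers (w, λ) are two coordinate systems
for the same 2N moments s₀² J_N^d(1,1) = ∑ w_i λ_i^d, 0 ≤ d < 2N (`chiMap` and `atomMap`). In the
chi variables the Jacobian matrix is triangular (`det_fderiv_chiMap`). In (w, λ) its determinant is
a confluent Vandermonde determinant times the product of the weights (`det_fderiv_atomMap`).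
Together with the trace and product formulas collected in `IsSpectralData`, this turns the product
of chi densities into a constant times independent gamma densities of shape β/2 in the w_i and the
Laguerre density in the λ_i (`chiPdf_mul_det_eq`). Every admissible (w, λ) is reached, by a
connectedness argument (`image_chiMap_eq`). Hence the eigenvalues have the Laguerre law, and the
normalized weights w_i / ∑ w_j are exchangeable, independent of the eigenvalues and of mean 1/N.
This gives both equalities of expectations (`lintegral_average_eq`).

Limit. The entry J_N^r(1,1) is a Stieltjes–Rogers polynomial in the squared entries of the
bidiagonal factor (`walk_return`, `jacobiFin_pow_zero_zero`), so it involves at most r independent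
variables. Since β → 0, the moments of the halved squared chi variables converge to those of
independent gamma variables with alternating parameters c/γ, c. The expected continued fraction with
gamma coefficients of alternating parameters a, b is Gauss's continued fraction of ₂F₀(a, b+1) /
₂F₀(a, b), whose deterministic coefficients are a, b+1, a+1, b+2, …
(`expect_stieltjes_alternating`). For a = c/γ and b = c these are exactly the squared entries of
`W`.

Spectral measure. Truncating the Jacobi matrix gives finitely supported measures with the right
first moments, and tightness yields a limit with all of them. Comparison with Euler's continued
fraction of ∑ r! x^r bounds the r-th moment by C^r r!, so exponential moments exist and the measure
is unique. -/

namespace BetaLaguerre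

/-! ### Stieltjes–Rogers polynomials and weighted paths. -/

section Stieltjes

variable {R : Type*} [CommRing R]


/-- The shift of a sequence. -/
def shift {A : Type*} (z : ℕ → A) : ℕ → A := fun i => z (i + 1)

@[simp] lemma shift_apply {A : Type*} (z : ℕ → A) (i : ℕ) : shift z i = z (i + 1) := rfl

/-- The Stieltjes–Rogers polynomials: the coefficients of the continued fraction
`1 / (1 - z₀ x / (1 - z₁ x / ⋯))`. -/
def stieltjes : ℕ → (ℕ → R) → R
  | 0, _ => 1
  | r + 1, z => z 0 * ∑ i : Fin (r + 1), stieltjes i z * stieltjes (r - i) (shift z)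

@[simp] lemma stieltjes_zero (z : ℕ → R) : stieltjes 0 z = 1 := by rw [stieltjes]

lemma stieltjes_succ (r : ℕ) (z : ℕ → R) :
    stieltjes (r + 1) z =
      z 0 * ∑ p ∈ Finset.HasAntidiagonal.antidiagonal r, stieltjes p.1 z * stieltjes p.2 (shift z) := by
  rw [stieltjes, Finset.Nat.sum_antidiagonal_eq_sum_range_succ_mk,
    Finset.sum_range (fun i => stieltjes i z * stieltjes (r - i) (shift z))]

/-- The generating function of the Stieltjes–Rogers polynomials. -/
def stieltjesSeries (z : ℕ → R) : PowerSeries R := PowerSeries.mk fun r => stieltjes r z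

/-- The recursion is a convolution, so it reads F = 1 + z₀ x F F' for the series F and its shift F'.
This is F = 1 / (1 - z₀ x F') without a division. -/
lemma stieltjesSeries_eq (z : ℕ → R) :
    stieltjesSeries z =
      1 + PowerSeries.X *
        (PowerSeries.C (z 0) * (stieltjesSeries z * stieltjesSeries (shift z))) := by
  ext r
  cases r with
  | zero => simp [stieltjesSeries]
  | succ r =>
    rw [map_add, PowerSeries.coeff_succ_X_mul, PowerSeries.coeff_C_mul, PowerSeries.coeff_mul]
    rw [stieltjesSeries, PowerSeries.coeff_mk, stieltjes_succ]
    simp [stieltjesSeries, PowerSeries.coeff_one]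

lemma map_stieltjes {S : Type*} [CommRing S] (f : R →+* S) (r : ℕ) (z : ℕ → R) :
    f (stieltjes r z) = stieltjes r (fun i => f (z i)) := by
  induction r using Nat.strong_induction_on generalizing z with
  | _ r ih =>
    cases r with
    | zero => simp
    | succ r =>
      rw [stieltjes_succ, stieltjes_succ, map_mul, map_sum]
      congr 1
      refine Finset.sum_congr rfl fun p hp => ?_
      have hp := Finset.HasAntidiagonal.mem_antidiagonal.1 hp
      rw [map_mul, ih p.1 (by omega), ih p.2 (by omega)]
      rfl

lemma stieltjes_mul (κ : R) (r : ℕ) (z : ℕ → R) :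
    stieltjes r (fun i => κ * z i) = κ ^ r * stieltjes r z := by
  induction r using Nat.strong_induction_on generalizing z with
  | _ r ih =>
    cases r with
    | zero => simp
    | succ r =>
      rw [stieltjes_succ, stieltjes_succ, Finset.mul_sum, Finset.mul_sum, Finset.mul_sum]
      refine Finset.sum_congr rfl fun p hp => ?_
      have hp := Finset.HasAntidiagonal.mem_antidiagonal.1 hp
      have h2 := ih p.2 (by omega) (shift z)
      have h3 : shift (fun i => κ * z i) = fun i => κ * shift z i := rfl
      rw [ih p.1 (by omega), h3, h2, ← hp]
      ring

lemma stieltjes_congr {r : ℕ} {z z' : ℕ → R} (h : ∀ i < r, z i = z' i) :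
    stieltjes r z = stieltjes r z' := by
  induction r using Nat.strong_induction_on generalizing z z' with
  | _ r ih =>
    cases r with
    | zero => simp
    | succ r =>
      rw [stieltjes_succ, stieltjes_succ, h 0 (by omega)]
      congr 1
      refine Finset.sum_congr rfl fun p hp => ?_
      have hp := Finset.HasAntidiagonal.mem_antidiagonal.1 hp
      rw [ih p.1 (by omega) (fun i hi => h i (by omega)),
        ih p.2 (by omega) (z := shift z) (z' := shift z') (fun i hi => h (i + 1) (by omega))]

/-- The variable of highest index occurs in `stieltjes (r + 1)` only in one monomial. -/
lemma stieltjes_sub_prod_congr {r : ℕ} {z z' : ℕ → R} (h : ∀ i < r, z i = z' i) :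
    stieltjes (r + 1) z - ∏ i ∈ Finset.range (r + 1), z i =
      stieltjes (r + 1) z' - ∏ i ∈ Finset.range (r + 1), z' i := by
  induction r generalizing z z' with
  | zero => rw [stieltjes_succ, stieltjes_succ]; simp
  | succ r ih =>
    -- The term p.1 = 0 of the convolution is the same problem for the shifted sequence. All other
    -- terms involve only y 0, …, y r.
    have key : ∀ y : ℕ → R, stieltjes (r + 1 + 1) y - ∏ i ∈ Finset.range (r + 1 + 1), y i =
        y 0 * (stieltjes (r + 1) (shift y) - ∏ i ∈ Finset.range (r + 1), shift y i) +
        y 0 * ∑ p ∈ Finset.HasAntidiagonal.antidiagonal r, stieltjes (p.1 + 1) y * stieltjes p.2 (shift y) := by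
      intro y
      rw [stieltjes_succ, Finset.Nat.sum_antidiagonal_succ, Finset.prod_range_succ']
      simp only [stieltjes_zero, one_mul, shift_apply]
      ring
    rw [key, key, ih (z := shift z) (z' := shift z') (fun i hi => h (i + 1) (by omega)),
      h 0 (by omega)]
    congr 2
    refine Finset.sum_congr rfl fun p hp => ?_
    have hp := Finset.HasAntidiagonal.mem_antidiagonal.1 hp
    rw [stieltjes_congr (r := p.1 + 1) (fun i hi => h i (by omega)),
      stieltjes_congr (r := p.2) (z := shift z) (z' := shift z')
        (fun i hi => h (i + 1) (by omega))]

/-- The recursion involves only sums and products of nonnegative quantities. This is what bounds the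
limiting moments by a model sequence. -/
lemma stieltjes_mono {z z' : ℕ → ℝ} (h0 : ∀ i, 0 ≤ z i) (h : ∀ i, z i ≤ z' i) (r : ℕ) :
    0 ≤ stieltjes r z ∧ stieltjes r z ≤ stieltjes r z' := by
  induction r using Nat.strong_induction_on generalizing z z' with
  | _ r ih =>
    cases r with
    | zero => simp
    | succ r =>
      have h1 : ∀ p ∈ Finset.HasAntidiagonal.antidiagonal r, _ := fun p hp =>
        ih p.1 (by have := Finset.HasAntidiagonal.mem_antidiagonal.1 hp; omega) h0 h
      have h2 : ∀ p ∈ Finset.HasAntidiagonal.antidiagonal r, _ := fun p hp =>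
        ih p.2 (by have := Finset.HasAntidiagonal.mem_antidiagonal.1 hp; omega)
          (z := shift z) (z' := shift z') (fun i => h0 _) (fun i => h _)
      have h3 : 0 ≤ ∑ p ∈ Finset.HasAntidiagonal.antidiagonal r, stieltjes p.1 z * stieltjes p.2 (shift z) :=
        Finset.sum_nonneg fun p hp => mul_nonneg (h1 p hp).1 (h2 p hp).1
      rw [stieltjes_succ, stieltjes_succ]
      refine ⟨mul_nonneg (h0 0) h3, mul_le_mul (h 0) ?_ h3 ((h0 0).trans (h 0))⟩
      exact Finset.sum_le_sum fun p hp => mul_le_mul (h1 p hp).2 (h2 p hp).2 (h2 p hp).1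
        ((h1 p hp).1.trans (h1 p hp).2)

/-! ### Powers of bidiagonal products and Stieltjes–Rogers polynomials -/

/-- The vector `T ^ k e₀`, where `T` is the symmetric matrix on `ℕ` whose only nonzero entries are
`T (h, h + 1) = T (h + 1, h) = t (h + 1)`. -/
def walk (t : ℕ → R) : ℕ → ℕ → R
  | 0, h => if h = 0 then 1 else 0
  | k + 1, 0 => t 1 * walk t k 1
  | k + 1, h + 1 => t (h + 1) * walk t k h + t (h + 2) * walk t k (h + 2)

lemma walk_eq_zero (t : ℕ → R) {k h : ℕ} (hk : k < h) : walk t k h = 0 := by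
  induction k generalizing h with
  | zero => simp [walk]; omega
  | succ k ih =>
    cases h with
    | zero => omega
    | succ h => rw [walk, ih (by omega), ih (by omega)]; simp

/-- Height k is reached after k steps only by the path that always goes up. These products become
the diagonal of a triangular Krylov matrix. -/
lemma walk_self (t : ℕ → R) (k : ℕ) : walk t k k = ∏ i ∈ Finset.range k, t (i + 1) := by
  induction k with
  | zero => simp [walk]
  | succ k ih =>
    rw [walk, ih, walk_eq_zero t (by omega), Finset.prod_range_succ]; ring

/-- The generating function of `walk t · h`. -/
noncomputable def walkSeries (t : ℕ → R) : ℕ → PowerSeries R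
  | 0 => (stieltjesSeries fun j => t (j + 1) ^ 2).expand 2 two_ne_zero
  | h + 1 => PowerSeries.X * (PowerSeries.C (t (h + 1)) * (walkSeries t h *
      (stieltjesSeries fun j => t (h + 1 + j + 1) ^ 2).expand 2 two_ne_zero))

lemma expand_stieltjesSeries_eq (t : ℕ → R) (h : ℕ) :
    (stieltjesSeries fun j => t (h + j + 1) ^ 2).expand 2 two_ne_zero =
      1 + PowerSeries.X ^ 2 * (PowerSeries.C (t (h + 1) ^ 2) *
        ((stieltjesSeries fun j => t (h + j + 1) ^ 2).expand 2 two_ne_zero *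
          (stieltjesSeries fun j => t (h + 1 + j + 1) ^ 2).expand 2 two_ne_zero)) := by
  conv_lhs => rw [stieltjesSeries_eq]
  have h1 : shift (fun j => t (h + j + 1) ^ 2) = fun j => t (h + 1 + j + 1) ^ 2 := by
    funext j; simp only [shift_apply]; congr 2; ring
  rw [h1]
  simp [PowerSeries.expand_C, PowerSeries.expand_X]

lemma walkSeries_zero_eq (t : ℕ → R) :
    walkSeries t 0 = 1 + PowerSeries.X * (PowerSeries.C (t 1) * walkSeries t 1) := by
  have h := expand_stieltjesSeries_eq t 0
  simp only [zero_add] at h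
  rw [walkSeries, walkSeries, walkSeries]
  simp only [zero_add]
  conv_lhs => rw [h]
  rw [map_pow]
  ring

lemma walkSeries_succ_eq (t : ℕ → R) (h : ℕ) :
    walkSeries t (h + 1) = PowerSeries.X * (PowerSeries.C (t (h + 1)) * walkSeries t h +
      PowerSeries.C (t (h + 2)) * walkSeries t (h + 2)) := by
  have h1 := expand_stieltjesSeries_eq t (h + 1)
  rw [walkSeries, walkSeries, walkSeries]
  conv_lhs => rw [h1]
  rw [map_pow]
  ring

/-- Last-passage decomposition: a path ending at height h + 1 makes a last step up from h and then
an excursion staying at height h + 1 or above. Excursions have even length, hence the substitution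
of x² for x in `walkSeries`. The resulting products satisfy the one-step recursion of `walk` by the
functional equation of the continued fraction. -/
lemma walk_eq_coeff (t : ℕ → R) (k h : ℕ) :
    walk t k h = PowerSeries.coeff k (walkSeries t h) := by
  induction k generalizing h with
  | zero =>
    cases h with
    | zero => rw [walkSeries_zero_eq]; simp [walk]
    | succ h => rw [walkSeries_succ_eq]; simp [walk]
  | succ k ih =>
    cases h with
    | zero =>
      rw [walkSeries_zero_eq, map_add, PowerSeries.coeff_succ_X_mul, PowerSeries.coeff_C_mul, walk,
        ih]
      simp [PowerSeries.coeff_one]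
    | succ h =>
      rw [walkSeries_succ_eq, PowerSeries.coeff_succ_X_mul, map_add, PowerSeries.coeff_C_mul,
        PowerSeries.coeff_C_mul, walk, ih, ih]

lemma walk_return (t : ℕ → R) (r : ℕ) :
    walk t (2 * r) 0 = stieltjes r fun j => t (j + 1) ^ 2 := by
  rw [walk_eq_coeff, walkSeries, PowerSeries.coeff_expand_mul]
  simp [stieltjesSeries]

end Stieltjes
end BetaLaguerre

/-! ### Powers of B Bᵗ for bidiagonal B, infinite and truncated. -/

namespace BetaLaguerre

/-- The infinite lower bidiagonal matrix with diagonal `t 1, t 3, …` and subdiagonal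
`t 2, t 4, …`. -/
def bidiag (t : ℕ → ℝ) : Matrix ℕ ℕ ℝ :=
  Matrix.of fun i j => if i = j then t (2 * i + 1) else if i = j + 1 then t (2 * i) else 0

lemma bidiag_eq_add (t : ℕ → ℝ) (i j : ℕ) :
    bidiag t i j = (if i = j then t (2 * i + 1) else 0) + if i = j + 1 then t (2 * i) else 0 := by
  simp only [bidiag, Matrix.of_apply]
  split_ifs <;> first | omega | simp

/-- The condition on `s` lets one statement serve both the infinite matrix and a truncation whose
first missing subdiagonal entry is zero. -/
lemma sum_mul_bidiag_col (t f : ℕ → ℝ) {s : Finset ℕ} {j : ℕ} (hj : j ∈ s)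
    (hj' : j + 1 ∉ s → t (2 * j + 2) = 0) :
    ∑ k ∈ s, f k * bidiag t k j = t (2 * j + 1) * f j + t (2 * j + 2) * f (j + 1) := by
  simp only [bidiag_eq_add, mul_add, Finset.sum_add_distrib, mul_ite, mul_zero,
    Finset.sum_ite_eq', hj, if_true]
  split_ifs with h
  · ring
  · rw [hj' h]; ring

lemma sum_mul_bidiag_row_zero (t f : ℕ → ℝ) {s : Finset ℕ} (hs : 0 ∈ s) :
    ∑ k ∈ s, f k * bidiag t 0 k = t 1 * f 0 := by
  simp [bidiag_eq_add, Finset.sum_ite_eq, hs, mul_comm]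

lemma sum_mul_bidiag_row_succ (t f : ℕ → ℝ) {s : Finset ℕ} {j : ℕ} (hj : j ∈ s)
    (hj' : j + 1 ∈ s) :
    ∑ k ∈ s, f k * bidiag t (j + 1) k = t (2 * j + 2) * f j + t (2 * j + 3) * f (j + 1) := by
  simp only [bidiag_eq_add, mul_add, Finset.sum_add_distrib, mul_ite, mul_zero, add_left_inj,
    Finset.sum_ite_eq, hj, hj', if_true, mul_one]
  rw [show 2 * j + 2 + 1 = 2 * j + 3 by ring]
  ring

lemma finsum_mul_bidiag_row (t f : ℕ → ℝ) (j : ℕ) :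
    ∑ᶠ k, f k * bidiag t j k = ∑ k ∈ Finset.range (j + 1), f k * bidiag t j k := by
  refine finsum_eq_sum_of_support_subset _ fun k hk => ?_
  by_contra h
  apply hk
  have : ¬ k < j + 1 := by simpa using h
  simp only [bidiag_eq_add]
  rw [if_neg (by omega), if_neg (by omega)]
  simp

lemma infMul_bidiag (t : ℕ → ℝ) (i j : ℕ) :
    infMul (bidiag t) (bidiag t).transpose i j =
      ∑ l ∈ Finset.range (j + 1), bidiag t i l * bidiag t j l := by
  simp only [infMul, Matrix.of_apply, Matrix.transpose_apply]
  exact finsum_mul_bidiag_row t _ j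

lemma finsum_mul_infMul_bidiag (t f : ℕ → ℝ) (j : ℕ) :
    ∑ᶠ k, f k * infMul (bidiag t) (bidiag t).transpose k j =
      ∑ l ∈ Finset.range (j + 1), (t (2 * l + 1) * f l + t (2 * l + 2) * f (l + 1)) *
        bidiag t j l := by
  have h : Function.support (fun k => f k * infMul (bidiag t) (bidiag t).transpose k j) ⊆
      (Finset.range (j + 2) : Finset ℕ) := by
    intro k hk
    by_contra h
    apply hk
    have : ¬ k < j + 2 := by simpa using h
    simp only [infMul_bidiag]
    rw [Finset.sum_eq_zero, mul_zero]
    intro l hl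
    have := Finset.mem_range.1 hl
    rw [bidiag_eq_add, if_neg (by omega), if_neg (by omega)]
    simp
  rw [finsum_eq_sum_of_support_subset _ h]
  simp only [infMul_bidiag, Finset.mul_sum]
  rw [Finset.sum_comm]
  refine Finset.sum_congr rfl fun l hl => ?_
  have hl := Finset.mem_range.1 hl
  rw [← sum_mul_bidiag_col t f (s := Finset.range (j + 2)) (by simp; omega)
    (fun h => absurd (Finset.mem_range.2 (by omega)) h), Finset.sum_mul]
  exact Finset.sum_congr rfl fun k _ => by ring

lemma walk_two_step (t : ℕ → ℝ) (r j : ℕ) {s : Finset ℕ} (hs : ∀ l ≤ j, l ∈ s) :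
    ∑ l ∈ s, walk t (2 * r + 1) (2 * l + 1) * bidiag t j l = walk t (2 * (r + 1)) (2 * j) := by
  cases j with
  | zero =>
    rw [sum_mul_bidiag_row_zero t (fun l => walk t (2 * r + 1) (2 * l + 1)) (hs 0 le_rfl)]
    rfl
  | succ j =>
    rw [sum_mul_bidiag_row_succ t (fun l => walk t (2 * r + 1) (2 * l + 1)) (hs j (by omega))
      (hs (j + 1) le_rfl)]
    rfl

/-- The path matrix T connects only sites of opposite parity, and `bidiag t` is its block between
even and odd sites. So B Bᵗ is the even block of T², and its r-th power counts paths of length 2r.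
-/
lemma infPow_bidiag (t : ℕ → ℝ) (κ : ℝ) (r j : ℕ) :
    infPow (κ • infMul (bidiag t) (bidiag t).transpose) r 0 j = κ ^ r * walk t (2 * r) (2 * j) := by
  induction r generalizing j with
  | zero => simp [infPow, walk, Matrix.one_apply, eq_comm]
  | succ r ih =>
    have h : ∀ k, infPow (κ • infMul (bidiag t) (bidiag t).transpose) r 0 k *
        (κ • infMul (bidiag t) (bidiag t).transpose) k j =
        (κ ^ (r + 1) * walk t (2 * r) (2 * k)) * infMul (bidiag t) (bidiag t).transpose k j := by
      intro k
      rw [ih, Matrix.smul_apply, smul_eq_mul]; ring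
    rw [infPow, infMul, Matrix.of_apply, finsum_congr h,
      finsum_mul_infMul_bidiag t (fun k => κ ^ (r + 1) * walk t (2 * r) (2 * k)),
      ← walk_two_step t r j (s := Finset.range (j + 1)) (fun l hl => Finset.mem_range.2 (by omega)),
      Finset.mul_sum]
    refine Finset.sum_congr rfl fun l _ => ?_
    have : walk t (2 * r + 1) (2 * l + 1) =
      t (2 * l + 1) * walk t (2 * r) (2 * l) + t (2 * l + 2) * walk t (2 * r) (2 * (l + 1)) := rfl
    rw [this]; ring

/-- The upper left `N × N` block of `bidiag t`. -/
def bidiagFin (N : ℕ) (t : ℕ → ℝ) : Matrix (Fin N) (Fin N) ℝ :=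
  Matrix.of fun i j => bidiag t i j

/-- The vanishing coefficient cuts the path graph behind the last site of the block, so truncation
loses nothing, whatever the power. -/
lemma bidiagFin_pow_col_zero {n : ℕ} {t : ℕ → ℝ} (ht : t (2 * (n + 1)) = 0) (r : ℕ)
    (j : Fin (n + 1)) :
    ((bidiagFin (n + 1) t * (bidiagFin (n + 1) t).transpose) ^ r) j 0 =
      walk t (2 * r) (2 * j) := by
  induction r generalizing j with
  | zero =>
    have h : walk t (2 * 0) (2 * j) = if 2 * (j : ℕ) = 0 then 1 else 0 := rfl
    rw [h, pow_zero, Matrix.one_apply]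
    refine if_congr ?_ rfl rfl
    rw [Fin.ext_iff, Fin.val_zero]
    omega
  | succ r ih =>
    have h : ∀ l : Fin (n + 1), ∑ k : Fin (n + 1), bidiagFin (n + 1) t k l *
        walk t (2 * r) (2 * k) = walk t (2 * r + 1) (2 * l + 1) := by
      intro l
      have h1 := sum_mul_bidiag_col t (fun k => walk t (2 * r) (2 * k))
        (s := Finset.range (n + 1)) (j := l) (Finset.mem_range.2 l.2) (fun h => by
          have : (l : ℕ) = n := by have := l.2; simp at h; omega
          rw [this, ← ht]; congr 1)
      rw [Finset.sum_range] at h1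
      have h2 : walk t (2 * r + 1) (2 * l + 1) = t (2 * l + 1) * walk t (2 * r) (2 * l) +
        t (2 * l + 2) * walk t (2 * r) (2 * ((l : ℕ) + 1)) := rfl
      rw [h2, ← h1]
      exact Finset.sum_congr rfl fun k _ => mul_comm _ _
    rw [pow_succ', Matrix.mul_assoc, Matrix.mul_apply]
    have h3 : ∀ l : Fin (n + 1), ((bidiagFin (n + 1) t).transpose *
        (bidiagFin (n + 1) t * (bidiagFin (n + 1) t).transpose) ^ r) l 0 =
        walk t (2 * r + 1) (2 * l + 1) := by
      intro l
      rw [← h l, Matrix.mul_apply]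
      exact Finset.sum_congr rfl fun k _ => by rw [ih]; rfl
    rw [← walk_two_step t r j (s := Finset.range (n + 1))
      (fun l hl => Finset.mem_range.2 (by omega)), Finset.sum_range]
    refine Finset.sum_congr rfl fun l _ => ?_
    rw [h3, mul_comm]; rfl

lemma infPow_bidiag_zero_zero (t : ℕ → ℝ) (κ : ℝ) (r : ℕ) :
    infPow (κ • infMul (bidiag t) (bidiag t).transpose) r 0 0 =
      κ ^ r * stieltjes r fun j => t (j + 1) ^ 2 := by
  rw [infPow_bidiag, mul_zero, walk_return]

end BetaLaguerre

/-! ### Gauss's continued fraction for ₂F₀. -/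

namespace BetaLaguerre

/-- The rising factorial `a (a + 1) ⋯ (a + n - 1)`. -/
def rising (a : ℝ) (n : ℕ) : ℝ := ∏ i ∈ Finset.range n, (a + i)

@[simp] lemma rising_zero (a : ℝ) : rising a 0 = 1 := by simp [rising]

lemma rising_succ (a : ℝ) (n : ℕ) : rising a (n + 1) = rising a n * (a + n) := by
  rw [rising, Finset.prod_range_succ, rising]

lemma rising_succ' (a : ℝ) (n : ℕ) : rising a (n + 1) = a * rising (a + 1) n := by
  rw [rising, Finset.prod_range_succ', rising, mul_comm a]
  congr 1
  · exact Finset.prod_congr rfl fun i _ => by push_cast; ring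
  · simp

/-- The formal hypergeometric series `₂F₀(a, b; x)`. -/
noncomputable def hyper (a b : ℝ) : PowerSeries ℝ :=
  PowerSeries.mk fun n => rising a n * rising b n / n.factorial

lemma hyper_comm (a b : ℝ) : hyper a b = hyper b a := by
  ext n; simp [hyper, mul_comm]

lemma constantCoeff_hyper (a b : ℝ) : PowerSeries.constantCoeff (hyper a b) = 1 := by
  rw [← PowerSeries.coeff_zero_eq_constantCoeff_apply]; simp [hyper]

lemma hyper_ne_zero (a b : ℝ) : hyper a b ≠ 0 := fun h => by
  have := constantCoeff_hyper a b
  rw [h] at this; simp at this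

/-- Contiguous relation, from (b+1)_n - (b)_n = n (b+1)_{n-1} in each coefficient. -/
lemma hyper_add_one (a b : ℝ) :
    hyper a (b + 1) =
      hyper a b + PowerSeries.X * (PowerSeries.C a * hyper (a + 1) (b + 1)) := by
  ext n
  cases n with
  | zero => simp [hyper]
  | succ n =>
    rw [map_add, PowerSeries.coeff_succ_X_mul, PowerSeries.coeff_C_mul]
    simp only [hyper, PowerSeries.coeff_mk]
    rw [rising_succ' a, rising_succ (b + 1), rising_succ' b, Nat.factorial_succ]
    have : (n.factorial : ℝ) ≠ 0 := by positivity
    push_cast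
    field_simp
    ring

lemma hyper_zero_right (a : ℝ) : hyper a 0 = 1 := by
  ext n
  cases n with
  | zero => simp [hyper]
  | succ n => simp [hyper, rising_succ', PowerSeries.coeff_one]

/-- The coefficients `a, b + 1, a + 1, b + 2, a + 2, …` of Gauss's continued fraction. -/
def gaussSeq (a b : ℝ) : ℕ → ℝ
  | 0 => a
  | n + 1 => gaussSeq (b + 1) a n

lemma shift_gaussSeq (a b : ℝ) : shift (gaussSeq a b) = gaussSeq (b + 1) a := rfl

lemma gaussSeq_even (a b : ℝ) (n : ℕ) : gaussSeq a b (2 * n) = a + n := by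
  induction n generalizing a b with
  | zero => simp [gaussSeq]
  | succ n ih =>
    have : gaussSeq a b (2 * (n + 1)) = gaussSeq (a + 1) (b + 1) (2 * n) := rfl
    rw [this, ih]; push_cast; ring

lemma gaussSeq_odd (a b : ℝ) (n : ℕ) : gaussSeq a b (2 * n + 1) = b + 1 + n := by
  have : gaussSeq a b (2 * n + 1) = gaussSeq (b + 1) a (2 * n) := rfl
  rw [this, gaussSeq_even]

/-- The continued fraction and the contiguous relation have the same shape, so the defect in Gauss's
identity equals x times a multiple of the defect for (b+1, a). Iterating makes it divisible by every
power of x, hence zero. -/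
lemma stieltjesSeries_gaussSeq_sub (a b : ℝ) :
    stieltjesSeries (gaussSeq a b) * hyper a b - hyper a (b + 1) =
      PowerSeries.X * (PowerSeries.C a * stieltjesSeries (gaussSeq a b) *
        (stieltjesSeries (gaussSeq (b + 1) a) * hyper (b + 1) a - hyper (b + 1) (a + 1))) := by
  have h1 := stieltjesSeries_eq (gaussSeq a b)
  rw [shift_gaussSeq, show gaussSeq a b 0 = a from rfl] at h1
  have h2 := hyper_add_one a b
  rw [hyper_comm (b + 1) a, hyper_comm (b + 1) (a + 1)]
  linear_combination hyper a (b + 1) * h1 - stieltjesSeries (gaussSeq a b) * h2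

/-- Gauss's continued fraction for the ratio of contiguous `₂F₀` series. -/
lemma stieltjesSeries_gaussSeq (a b : ℝ) :
    stieltjesSeries (gaussSeq a b) * hyper a b = hyper a (b + 1) := by
  have h : ∀ n a b, (PowerSeries.X : PowerSeries ℝ) ^ n ∣
      stieltjesSeries (gaussSeq a b) * hyper a b - hyper a (b + 1) := by
    intro n
    induction n with
    | zero => simp
    | succ n ih =>
      intro a b
      rw [stieltjesSeries_gaussSeq_sub, pow_succ']
      exact mul_dvd_mul_left _ ((ih (b + 1) a).mul_left _)
  rw [← sub_eq_zero]
  ext n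
  simpa using PowerSeries.X_pow_dvd_iff.1 (h (n + 1) a b) n (Nat.lt_succ_self n)

/-- Euler's continued fraction, with coefficients 1, 1, 2, 2, 3, 3, …. It is the benchmark for the
growth of the limiting moments. -/
lemma stieltjes_gaussSeq_one_zero (r : ℕ) : stieltjes r (gaussSeq 1 0) = r.factorial := by
  have h := stieltjesSeries_gaussSeq 1 0
  rw [hyper_zero_right, mul_one] at h
  have h1 := congrArg (PowerSeries.coeff r) h
  have h2 : ∀ n : ℕ, rising 1 n = n.factorial := by
    intro n
    induction n with
    | zero => simp
    | succ n ih => rw [rising_succ, ih, Nat.factorial_succ]; push_cast; ring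
  simp only [stieltjesSeries, PowerSeries.coeff_mk, hyper, zero_add, h2] at h1
  rw [h1]
  field_simp

/-! ### Independent random coefficients -/

/-- The expectation of a polynomial in independent variables, where `μ i n` is the `n`-th moment
of the `i`-th variable. -/
noncomputable def expect (μ : ℕ → ℕ → ℝ) : MvPolynomial ℕ ℝ →ₗ[ℝ] ℝ :=
  (MvPolynomial.basisMonomials ℕ ℝ).constr ℝ fun m => m.prod μ

lemma expect_monomial (μ : ℕ → ℕ → ℝ) (m : ℕ →₀ ℕ) (a : ℝ) :
    expect μ (MvPolynomial.monomial m a) = a * m.prod μ := by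
  have h : MvPolynomial.monomial m a = a • MvPolynomial.basisMonomials ℕ ℝ m := by
    rw [MvPolynomial.coe_basisMonomials, MvPolynomial.smul_monomial, smul_eq_mul, mul_one]
  rw [h, map_smul, expect, Module.Basis.constr_basis, smul_eq_mul]

/-- Independence of the variable 0 from the later ones, which are renamed by the shift. -/
lemma expect_X_zero_pow_mul {μ : ℕ → ℕ → ℝ} (hμ : ∀ i, μ i 0 = 1) (k : ℕ)
    (P : MvPolynomial ℕ ℝ) :
    expect μ (MvPolynomial.X 0 ^ k * MvPolynomial.rename Nat.succ P) =
      μ 0 k * expect (shift μ) P := by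
  induction P using MvPolynomial.induction_on' with
  | add p q hp hq => rw [map_add, mul_add, map_add, hp, hq, map_add, mul_add]
  | monomial m a =>
    rw [MvPolynomial.rename_monomial, MvPolynomial.X_pow_eq_monomial, MvPolynomial.monomial_mul,
      expect_monomial, expect_monomial, one_mul]
    have h0 : m.mapDomain Nat.succ 0 = 0 :=
      Finsupp.mapDomain_of_notMem_range _ _ (by simp)
    have h1 : (Finsupp.single 0 k + m.mapDomain Nat.succ).prod μ =
        μ 0 k * m.prod (shift μ) := by
      rw [Finsupp.prod_add_index_of_disjoint, Finsupp.prod_single_index (hμ 0)]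
      · rw [Finsupp.prod_mapDomain_index_inj Nat.succ_injective]
        rfl
      · refine Finset.disjoint_left.2 fun i hi hi' => ?_
        have := Finset.mem_singleton.1 (Finsupp.support_single_subset hi)
        rw [this, Finsupp.mem_support_iff] at hi'
        exact hi' h0
    rw [h1]; ring

lemma tendsto_expect {ι : Type*} {l : Filter ι} {μ : ι → ℕ → ℕ → ℝ} {ν : ℕ → ℕ → ℝ}
    (h : ∀ i n, Tendsto (fun x => μ x i n) l (𝓝 (ν i n))) (P : MvPolynomial ℕ ℝ) :
    Tendsto (fun x => expect (μ x) P) l (𝓝 (expect ν P)) := by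
  induction P using MvPolynomial.induction_on' with
  | add p q hp hq => simpa only [map_add] using hp.add hq
  | monomial m a =>
    simp only [expect_monomial]
    exact (tendsto_finsetProd _ fun i _ => h i _).const_mul a

/-- The moments of independent standard gamma variables with alternating parameters. -/
noncomputable def alternating (a b : ℝ) (i n : ℕ) : ℝ := rising (if Even i then a else b) n

lemma shift_alternating (a b : ℝ) : shift (alternating a b) = alternating b a := by
  funext i n
  simp only [shift_apply, alternating, Nat.even_add_one, ite_not]

/-- The coefficientwise expectation. -/
noncomputable def expectSeries (μ : ℕ → ℕ → ℝ) (f : PowerSeries (MvPolynomial ℕ ℝ)) :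
    PowerSeries ℝ := PowerSeries.mk fun d => expect μ (PowerSeries.coeff d f)

/-- The auxiliary family `F ^ n * (z₀ F') ^ k`, where `F` and `F'` are the generic continued
fraction and its shift. -/
noncomputable def genericPow (n k : ℕ) : PowerSeries (MvPolynomial ℕ ℝ) :=
  stieltjesSeries (MvPolynomial.X (R := ℝ)) ^ n *
    (PowerSeries.C (MvPolynomial.X 0) *
      stieltjesSeries (shift (MvPolynomial.X (R := ℝ)))) ^ k

lemma genericPow_succ (n k : ℕ) :
    genericPow (n + 1) k = genericPow n k + PowerSeries.X * genericPow (n + 1) (k + 1) := by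
  have h := stieltjesSeries_eq (MvPolynomial.X (R := ℝ) (σ := ℕ))
  simp only [genericPow]
  rw [pow_succ (stieltjesSeries _) n]
  linear_combination (stieltjesSeries (MvPolynomial.X (R := ℝ)) ^ n *
    (PowerSeries.C (MvPolynomial.X 0) *
      stieltjesSeries (shift (MvPolynomial.X (R := ℝ)))) ^ k) * h

lemma expectSeries_genericPow_succ (μ : ℕ → ℕ → ℝ) (n k : ℕ) :
    expectSeries μ (genericPow (n + 1) k) =
      expectSeries μ (genericPow n k) +
        PowerSeries.X * expectSeries μ (genericPow (n + 1) (k + 1)) := by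
  rw [genericPow_succ]
  ext d
  cases d with
  | zero => simp [expectSeries]
  | succ d => simp [expectSeries, PowerSeries.coeff_succ_X_mul]

/-- The shifted fraction F' does not involve z₀, so the expectation of (z₀ F')^k splits. Moreover F'
is a copy of F in renamed variables, which turns a power of F' back into a power of F for the
shifted law. -/
lemma expectSeries_genericPow_zero {μ : ℕ → ℕ → ℝ} (hμ : ∀ i, μ i 0 = 1) (k : ℕ) :
    expectSeries μ (genericPow 0 k) =
      PowerSeries.C (μ 0 k) * expectSeries (shift μ) (genericPow k 0) := by
  have h : stieltjesSeries (shift (MvPolynomial.X (R := ℝ))) =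
      PowerSeries.map (MvPolynomial.rename Nat.succ : MvPolynomial ℕ ℝ →ₐ[ℝ] _).toRingHom
        (stieltjesSeries (MvPolynomial.X (R := ℝ))) := by
    ext1 d
    rw [PowerSeries.coeff_map, stieltjesSeries, stieltjesSeries, PowerSeries.coeff_mk,
      PowerSeries.coeff_mk, map_stieltjes]
    congr 1
    funext i
    simp
  ext d
  rw [PowerSeries.coeff_C_mul]
  simp only [expectSeries, PowerSeries.coeff_mk, genericPow, pow_zero, one_mul, mul_one]
  rw [h, mul_pow, ← map_pow, ← map_pow, PowerSeries.coeff_C_mul, PowerSeries.coeff_map,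
    ← expect_X_zero_pow_mul hμ]
  rfl

/-- The closed form E[F^n (z₀ F')^k] · ₂F₀(a, b) = (a)_k ₂F₀(a+k, b+n) closes the recursion.
Lowering n costs a term with k + 1 but one power of x less, as in the contiguous relation. At n = 0
independence exchanges a and b and turns (n, k) = (0, k) into (k, 0), which lowers d + k. The
induction is therefore on d + k, then d, then n. -/
lemma coeff_expectSeries_genericPow (D : ℕ) : ∀ (a b : ℝ) (d n k : ℕ), d + k ≤ D →
    PowerSeries.coeff d (expectSeries (alternating a b) (genericPow n k) * hyper a b) =
      PowerSeries.coeff d (PowerSeries.C (rising a k) * hyper (a + k) (b + n)) := by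
  induction D using Nat.strong_induction_on with
  | _ D ihD =>
    intro a b d
    have hzero : ∀ d k, d + k ≤ D →
        PowerSeries.coeff d (expectSeries (alternating a b) (genericPow 0 k) * hyper a b) =
          PowerSeries.coeff d (PowerSeries.C (rising a k) * hyper (a + k) b) := by
      intro d k hd
      cases k with
      | zero =>
        have h1 : expectSeries (alternating a b) (genericPow 0 0) = 1 := by
          ext d
          have h2 : expect (alternating a b) 1 = 1 := by
            have := expect_monomial (alternating a b) 0 1
            simpa using this
          by_cases hd : d = 0 <;>
            simp [expectSeries, genericPow, PowerSeries.coeff_one, hd, h2]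
        rw [h1]; simp
      | succ k =>
        rw [expectSeries_genericPow_zero (fun i => by simp [alternating]), mul_assoc,
          PowerSeries.coeff_C_mul, PowerSeries.coeff_C_mul, shift_alternating, hyper_comm a b,
          ihD (D - 1) (by omega) b a d (k + 1) 0 (by omega)]
        simp [alternating, hyper_comm b]
    induction d with
    | zero =>
      intro n
      induction n with
      | zero => simpa using hzero 0
      | succ n ihn =>
        intro k hk
        rw [expectSeries_genericPow_succ, add_mul, map_add, ihn k hk, Nat.cast_succ, ← add_assoc,
          hyper_add_one, mul_add, map_add]
        simp [mul_assoc]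
    | succ d ihd =>
      intro n
      induction n with
      | zero => simpa using hzero (d + 1)
      | succ n ihn =>
        intro k hk
        rw [expectSeries_genericPow_succ, add_mul, map_add, ihn k hk, Nat.cast_succ, ← add_assoc,
          hyper_add_one, mul_add, map_add, mul_assoc, PowerSeries.coeff_succ_X_mul,
          ihd (n + 1) (k + 1) (by omega), mul_left_comm, PowerSeries.coeff_succ_X_mul, rising_succ]
        simp only [PowerSeries.coeff_C_mul]
        push_cast
        rw [add_assoc a, add_assoc b]
        ring

/-- The expected continued fraction with independent gamma coefficients of alternating parameters
`a, b` is Gauss's continued fraction. -/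
lemma expect_stieltjes_alternating (a b : ℝ) (r : ℕ) :
    expect (alternating a b) (stieltjes r MvPolynomial.X) = stieltjes r (gaussSeq a b) := by
  have h : expectSeries (alternating a b) (genericPow 1 0) = stieltjesSeries (gaussSeq a b) := by
    refine mul_right_cancel₀ (hyper_ne_zero a b) ?_
    rw [stieltjesSeries_gaussSeq]
    ext d
    rw [coeff_expectSeries_genericPow d a b d 1 0 le_rfl]
    simp
  have h1 := congrArg (PowerSeries.coeff r) h
  simpa [expectSeries, genericPow, stieltjesSeries] using h1

end BetaLaguerre

/-! ### The moment problem: determinacy and existence. -/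

namespace BetaLaguerre

section Moments

/-- A measure whose even moments grow at most like `C ^ k * k!` has exponential moments. -/
lemma integrable_exp_of_moments {μ : Measure ℝ} [IsProbabilityMeasure μ] {C t : ℝ}
    (hC : 0 < C) (hint : ∀ k : ℕ, Integrable (fun x : ℝ => x ^ k) μ)
    (hm : ∀ k : ℕ, ∫ x, x ^ k ∂μ ≤ C ^ k * k.factorial) (ht : |t| * C < 1) :
    Integrable (fun x => Real.exp (t * x)) μ := by
  -- The series of cosh has nonnegative terms only, so sum and integral commute without absolute
  -- moments. The k-th term is at most (|t| C)^(2k).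
  have hcosh : ∫⁻ x, ENNReal.ofReal (Real.cosh (t * x)) ∂μ < ⊤ := by
    have h1 : ∀ x : ℝ, ENNReal.ofReal (Real.cosh (t * x)) =
        ∑' k : ℕ, ENNReal.ofReal ((t * x) ^ (2 * k) / (2 * k).factorial) := by
      intro x
      rw [Real.cosh_eq_tsum, ENNReal.ofReal_tsum_of_nonneg]
      · intro k; rw [pow_mul]; positivity
      · exact (Real.hasSum_cosh (t * x)).summable
    simp_rw [h1]
    rw [lintegral_tsum (fun k => by fun_prop)]
    have h2 : ∀ k : ℕ, ∫⁻ x, ENNReal.ofReal ((t * x) ^ (2 * k) / (2 * k).factorial) ∂μ ≤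
        ENNReal.ofReal (((|t| * C) ^ 2) ^ k) := by
      intro k
      have h3 : (fun x : ℝ => (t * x) ^ (2 * k) / (2 * k).factorial) =
          fun x => t ^ (2 * k) / (2 * k).factorial * x ^ (2 * k) := by
        funext x; rw [mul_pow]; ring
      rw [← ofReal_integral_eq_lintegral_ofReal]
      · refine ENNReal.ofReal_le_ofReal ?_
        rw [h3, integral_const_mul]
        have h4 : 0 ≤ t ^ (2 * k) / ((2 * k).factorial : ℝ) := by rw [pow_mul]; positivity
        refine (mul_le_mul_of_nonneg_left (hm _) h4).trans_eq ?_
        have : ((2 * k).factorial : ℝ) ≠ 0 := by positivity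
        rw [← pow_mul, mul_pow, pow_mul |t|, sq_abs, ← pow_mul]
        field_simp
      · rw [h3]; exact (hint _).const_mul _
      · exact ae_of_all _ fun x => by simp only [Pi.zero_apply, pow_mul]; positivity
    refine (ENNReal.tsum_le_tsum h2).trans_lt ?_
    rw [← ENNReal.ofReal_tsum_of_nonneg (fun k => by positivity)]
    · exact ENNReal.ofReal_lt_top
    · refine summable_geometric_of_lt_one (by positivity) ?_
      have : 0 ≤ |t| * C := by positivity
      nlinarith
  refine Integrable.mono' (g := fun x => 2 * Real.cosh (t * x)) ?_ (by fun_prop)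
    (ae_of_all _ fun x => ?_)
  · refine Integrable.const_mul ⟨by fun_prop, ?_⟩ _
    rw [hasFiniteIntegral_iff_ofReal (ae_of_all _ fun x => (Real.cosh_pos _).le)]
    exact hcosh
  · rw [Real.norm_eq_abs, abs_of_pos (Real.exp_pos _), Real.cosh_eq]
    have := Real.exp_pos (-(t * x))
    linarith

open ProbabilityTheory in
/-- Determinacy of the moment problem under exponential bounds. -/
lemma eq_of_moments_eq {μ μ' : Measure ℝ} [IsProbabilityMeasure μ] [IsProbabilityMeasure μ']
    {C : ℝ} (hC : 0 < C) (hint : ∀ k : ℕ, Integrable (fun x : ℝ => x ^ k) μ)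
    (hint' : ∀ k : ℕ, Integrable (fun x : ℝ => x ^ k) μ')
    (heq : ∀ k : ℕ, ∫ x, x ^ k ∂μ = ∫ x, x ^ k ∂μ')
    (hm : ∀ k : ℕ, ∫ x, x ^ k ∂μ ≤ C ^ k * k.factorial) : μ = μ' := by
  have hsub : ∀ ρ : Measure ℝ, IsProbabilityMeasure ρ →
      (∀ k : ℕ, Integrable (fun x : ℝ => x ^ k) ρ) →
      (∀ k : ℕ, ∫ x, x ^ k ∂ρ ≤ C ^ k * k.factorial) →
      Set.Ioo (-C⁻¹) C⁻¹ ⊆ interior (integrableExpSet id ρ) := by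
    intro ρ _ h1 h2
    refine interior_maximal (fun t ht => ?_) isOpen_Ioo
    refine integrable_exp_of_moments hC h1 h2 ?_
    have := mul_lt_mul_of_pos_right (abs_lt.2 ht) hC
    rwa [inv_mul_cancel₀ hC.ne'] at this
  have hs := hsub μ inferInstance hint hm
  have hs' := hsub μ' inferInstance hint' (fun k => (heq k) ▸ hm k)
  have h0 : (0 : ℝ) ∈ Set.Ioo (-C⁻¹) C⁻¹ := by constructor <;> simp [hC]
  -- Both moment generating functions are analytic at 0 with Taylor coefficients given by the common
  -- moments.
  have hmgf : ∀ᶠ y in 𝓝 (0 : ℝ), mgf id μ y = mgf id μ' y := by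
    have e1 := (hasFPowerSeriesAt_mgf (hs h0)).eventually_hasSum
    have e2 := (hasFPowerSeriesAt_mgf (hs' h0)).eventually_hasSum
    filter_upwards [e1, e2] with y h1 h2
    have : (fun n : ℕ => (μ[fun ω ↦ id ω ^ n * Real.exp (0 * id ω)] : ℝ) / n.factorial) =
        fun n : ℕ => (μ'[fun ω ↦ id ω ^ n * Real.exp (0 * id ω)] : ℝ) / n.factorial := by
      funext n
      simp [heq n]
    rw [this] at h1
    simpa using h1.unique h2
  -- The identity theorem propagates the equality to the vertical strip |Re z| < 1/C. It contains
  -- the imaginary axis, where the complex generating function is the characteristic function.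
  have hstrip : Set.EqOn (complexMGF id μ) (complexMGF id μ')
      {z : ℂ | z.re ∈ Set.Ioo (-C⁻¹) C⁻¹} := by
    refine AnalyticOnNhd.eqOn_of_preconnected_of_frequently_eq (z₀ := 0)
      (analyticOnNhd_complexMGF.mono fun z hz => hs hz)
      (analyticOnNhd_complexMGF.mono fun z hz => hs' hz)
      ((convex_Ioo (-C⁻¹) C⁻¹).linear_preimage Complex.reLm).isPreconnected
      (by simpa using h0) ?_
    have h1 : ∃ᶠ y in 𝓝[≠] (0 : ℝ), mgf id μ y = mgf id μ' y :=
      (hmgf.filter_mono nhdsWithin_le_nhds).frequently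
    have h2 : Tendsto (fun y : ℝ => (y : ℂ)) (𝓝[≠] 0) (𝓝[≠] 0) := by
      refine tendsto_nhdsWithin_iff.2 ⟨?_, ?_⟩
      · exact (Complex.continuous_ofReal.tendsto' 0 0 (by simp)).mono_left nhdsWithin_le_nhds
      · filter_upwards [self_mem_nhdsWithin] with y hy
        simpa using hy
    refine h2.frequently (h1.mono fun y hy => ?_)
    rw [complexMGF_ofReal, complexMGF_ofReal, hy]
  refine Measure.ext_of_charFun (funext fun t => ?_)
  rw [← complexMGF_id_mul_I, ← complexMGF_id_mul_I]
  exact hstrip (by simpa using h0)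

lemma abs_sub_clamp_le {R y : ℝ} (hR : 0 < R) : |y - max (-R) (min R y)| ≤ y ^ 2 / R := by
  have h0 : 0 ≤ y ^ 2 / R := by positivity
  rcases le_total y R with h1 | h1
  · rw [min_eq_right h1]
    rcases le_total (-R) y with h2 | h2
    · rw [max_eq_right h2]; simpa using h0
    · rw [max_eq_left h2, abs_of_nonpos (by linarith), le_div_iff₀ hR]; nlinarith
  · rw [min_eq_left h1, max_eq_right (by linarith), abs_of_nonneg (by linarith), le_div_iff₀ hR]
    nlinarith

/-- Moments converge along weakly convergent families with eventually constant moments. -/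
lemma moments_of_tendsto {ι : Type*} {l : Filter ι} [l.NeBot] {μ : ι → ProbabilityMeasure ℝ}
    {ν : ProbabilityMeasure ℝ} (hμ : Tendsto μ l (𝓝 ν)) {m : ℕ → ℝ}
    (hm : ∀ k : ℕ, ∀ᶠ n in l, Integrable (fun x : ℝ => x ^ k) (μ n : Measure ℝ) ∧
      ∫ x, x ^ k ∂(μ n : Measure ℝ) = m k) (k : ℕ) :
    Integrable (fun x : ℝ => x ^ k) (ν : Measure ℝ) ∧ ∫ x, x ^ k ∂(ν : Measure ℝ) = m k := by
  rw [ProbabilityMeasure.tendsto_iff_forall_integral_tendsto] at hμ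
  have hclamp : ∀ (R : ℝ) (f : ℝ → ℝ), 0 ≤ R → Continuous f →
      Tendsto (fun n => ∫ x, max (-R) (min R (f x)) ∂(μ n : Measure ℝ)) l
        (𝓝 (∫ x, max (-R) (min R (f x)) ∂(ν : Measure ℝ))) := by
    intro R f hR hf
    exact hμ (BoundedContinuousFunction.ofNormedAddCommGroup
      (fun x => max (-R) (min R (f x))) (by fun_prop) R fun x => by
        rw [Real.norm_eq_abs, abs_le]
        exact ⟨le_max_left _ _, max_le (by linarith) (min_le_left _ _)⟩)
  have hcint : ∀ (ρ : Measure ℝ) [IsProbabilityMeasure ρ] (R : ℝ) (f : ℝ → ℝ), 0 ≤ R →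
      Continuous f → Integrable (fun x => max (-R) (min R (f x))) ρ := by
    intro ρ _ R f hR hf
    refine Integrable.mono' (integrable_const R) (by fun_prop) (ae_of_all _ fun x => ?_)
    rw [Real.norm_eq_abs, abs_le]
    exact ⟨le_max_left _ _, max_le (by linarith) (min_le_left _ _)⟩
  -- Weak convergence controls only bounded functions. The truncated even powers have integral at
  -- most m (2j) under the limit, and monotone convergence removes the truncation.
  have heven : ∀ j : ℕ, Integrable (fun x : ℝ => (x ^ j) ^ 2) (ν : Measure ℝ) ∧
      ∫ x, (x ^ j) ^ 2 ∂(ν : Measure ℝ) ≤ m (2 * j) := by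
    intro j
    have hb : ∀ R : ℕ, ∫ x, max (-(R : ℝ)) (min (R : ℝ) ((x ^ j) ^ 2)) ∂(ν : Measure ℝ) ≤
        m (2 * j) := by
      intro R
      refine le_of_tendsto (hclamp R (fun x => (x ^ j) ^ 2) (by positivity) (by fun_prop)) ?_
      filter_upwards [hm (2 * j)] with n hn
      rw [← hn.2]
      refine integral_mono (hcint _ _ _ (by positivity) (by fun_prop)) hn.1 fun x => ?_
      have h1 : 0 ≤ (x ^ j) ^ 2 := by positivity
      have h2 : x ^ (2 * j) = (x ^ j) ^ 2 := by rw [← pow_mul, mul_comm]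
      simp only [h2]
      have h3 : (0 : ℝ) ≤ R := by positivity
      exact max_le (by linarith) (min_le_right _ _)
    have hl : ∫⁻ x, ENNReal.ofReal ((x ^ j) ^ 2) ∂(ν : Measure ℝ) ≤
        ENNReal.ofReal (m (2 * j)) := by
      have h1 : ∀ x : ℝ, ENNReal.ofReal ((x ^ j) ^ 2) =
          ⨆ R : ℕ, ENNReal.ofReal (max (-(R : ℝ)) (min (R : ℝ) ((x ^ j) ^ 2))) := by
        intro x
        have h0 : 0 ≤ (x ^ j) ^ 2 := by positivity
        refine le_antisymm ?_ (iSup_le fun R => ENNReal.ofReal_le_ofReal ?_)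
        · obtain ⟨R, hR⟩ := exists_nat_ge ((x ^ j) ^ 2)
          refine le_iSup_of_le R (ENNReal.ofReal_le_ofReal ?_)
          rw [min_eq_right hR]
          exact le_max_right _ _
        · exact max_le (by have : (0 : ℝ) ≤ R := by positivity
                           linarith) (min_le_right _ _)
      simp_rw [h1]
      rw [lintegral_iSup (fun R => by fun_prop)]
      · refine iSup_le fun R => ?_
        rw [← ofReal_integral_eq_lintegral_ofReal
          (hcint _ _ _ (by positivity) (by fun_prop)) (ae_of_all _ fun x => ?_)]
        · exact ENNReal.ofReal_le_ofReal (hb R)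
        · exact le_max_of_le_right (le_min (by positivity) (by positivity))
      · intro R R' hRR' x
        refine ENNReal.ofReal_le_ofReal ?_
        have h3 : (R : ℝ) ≤ R' := by exact_mod_cast hRR'
        have h4 : 0 ≤ (x ^ j) ^ 2 := by positivity
        have h5 : (0 : ℝ) ≤ R := by positivity
        rw [max_eq_right (by have := le_min h5 h4; linarith),
          max_eq_right (by have := le_min (h5.trans h3) h4; linarith)]
        exact min_le_min_right _ h3
    have hi : Integrable (fun x : ℝ => (x ^ j) ^ 2) (ν : Measure ℝ) := by
      refine ⟨by fun_prop, ?_⟩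
      rw [hasFiniteIntegral_iff_ofReal (ae_of_all _ fun x => by positivity)]
      exact hl.trans_lt ENNReal.ofReal_lt_top
    refine ⟨hi, ?_⟩
    rw [← ofReal_integral_eq_lintegral_ofReal hi (ae_of_all _ fun x => by positivity)] at hl
    obtain ⟨n, hn⟩ := (hm (2 * j)).exists
    refine (ENNReal.ofReal_le_ofReal_iff ?_).1 hl
    rw [← hn.2]
    exact integral_nonneg fun x => by simp only [pow_mul, Pi.zero_apply]; positivity
  have hint : Integrable (fun x : ℝ => x ^ k) (ν : Measure ℝ) := by
    refine Integrable.mono' ((integrable_const 1).add (heven k).1) (by fun_prop)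
      (ae_of_all _ fun x => ?_)
    rw [Real.norm_eq_abs, Pi.add_apply, ← sq_abs (x ^ k)]
    nlinarith [sq_nonneg (|x ^ k| - 1), abs_nonneg (x ^ k)]
  refine ⟨hint, ?_⟩
  have hdiff : ∀ (ρ : Measure ℝ) [IsProbabilityMeasure ρ] (R : ℝ), 0 < R →
      Integrable (fun x : ℝ => x ^ k) ρ → Integrable (fun x : ℝ => (x ^ k) ^ 2) ρ →
      |∫ x, x ^ k ∂ρ - ∫ x, max (-R) (min R (x ^ k)) ∂ρ| ≤ (∫ x, (x ^ k) ^ 2 ∂ρ) / R := by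
    intro ρ _ R hR h1 h2
    rw [← integral_sub h1 (hcint ρ R _ hR.le (by fun_prop)), ← integral_div]
    refine (abs_integral_le_integral_abs).trans ?_
    refine integral_mono (h1.sub (hcint ρ R _ hR.le (by fun_prop))).abs (h2.div_const R) ?_
    exact fun x => abs_sub_clamp_le hR
  -- Truncating at height R costs at most m (2k) / R under the limit measure, and again at most m
  -- (2k) / R under the approximating measures, uniformly.
  have hbound : ∀ R : ℝ, 0 < R → |∫ x, x ^ k ∂(ν : Measure ℝ) - m k| ≤ 2 * m (2 * k) / R := by
    intro R hR
    have h1 := (hdiff (ν : Measure ℝ) R hR hint (heven k).1).trans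
      (div_le_div_of_nonneg_right (heven k).2 hR.le)
    have h2 : |∫ x, max (-R) (min R (x ^ k)) ∂(ν : Measure ℝ) - m k| ≤ m (2 * k) / R := by
      refine le_of_tendsto (((hclamp R (fun x => x ^ k) hR.le (by fun_prop)).sub_const
        (m k)).abs) ?_
      filter_upwards [hm k, hm (2 * k)] with n hn hn'
      have h3 : (fun x : ℝ => x ^ (2 * k)) = fun x => (x ^ k) ^ 2 := by
        funext x; rw [← pow_mul, mul_comm]
      rw [h3] at hn'
      rw [abs_sub_comm, ← hn.2, ← hn'.2]
      exact hdiff _ R hR hn.1 hn'.1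
    calc _ ≤ _ := abs_sub_le _ (∫ x, max (-R) (min R (x ^ k)) ∂(ν : Measure ℝ)) _
      _ ≤ _ := add_le_add h1 h2
      _ = _ := by ring
  have hlim : Tendsto (fun R : ℝ => 2 * m (2 * k) / R) atTop (𝓝 0) :=
    tendsto_const_nhds.div_atTop tendsto_id
  have h0 : |∫ x, x ^ k ∂(ν : Measure ℝ) - m k| ≤ 0 :=
    ge_of_tendsto hlim ((eventually_gt_atTop 0).mono hbound)
  exact sub_eq_zero.1 (abs_nonpos_iff.1 h0)

/-- A sequence all of whose initial segments are moments of probability measures is a moment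
sequence. -/
lemma exists_of_truncated_moments {m : ℕ → ℝ}
    (h : ∀ n : ℕ, ∃ μ : Measure ℝ, IsProbabilityMeasure μ ∧ ∀ k ≤ n,
      Integrable (fun x : ℝ => x ^ k) μ ∧ ∫ x, x ^ k ∂μ = m k) :
    ∃ ν : Measure ℝ, IsProbabilityMeasure ν ∧ ∀ k,
      Integrable (fun x : ℝ => x ^ k) ν ∧ ∫ x, x ^ k ∂ν = m k := by
  -- The offset 2 makes every measure of the sequence have second moment m 2, so Chebyshev's
  -- inequality gives tightness.
  choose μ hp hμ using fun n => h (n + 2)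
  let ρ : ℕ → ProbabilityMeasure ℝ := fun n => ⟨μ n, hp n⟩
  have htight : IsTightMeasureSet {((μ : ProbabilityMeasure ℝ) : Measure ℝ) | μ ∈ Set.range ρ} := by
    rw [isTightMeasureSet_iff_exists_isCompact_measure_compl_le]
    intro ε hε
    have hlim : Tendsto (fun R : ℝ => ENNReal.ofReal (m 2 / R)) atTop (𝓝 0) := by
      rw [← ENNReal.ofReal_zero]
      exact ENNReal.tendsto_ofReal (tendsto_const_nhds.div_atTop tendsto_id)
    obtain ⟨R, hR, hRpos⟩ :=
      ((hlim.eventually_lt_const hε).and (eventually_gt_atTop 0)).exists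
    refine ⟨Metric.closedBall 0 (Real.sqrt R), isCompact_closedBall _ _, ?_⟩
    rintro _ ⟨_, ⟨n, rfl⟩, rfl⟩
    have := hp n
    have h2 := hμ n 2 (by omega)
    have hmk := mul_meas_ge_le_integral_of_nonneg (μ := μ n) (f := fun x : ℝ => x ^ 2)
      (ae_of_all _ fun x => sq_nonneg x) h2.1 R
    rw [h2.2] at hmk
    have hreal : (μ n).real {x | R ≤ x ^ 2} ≤ m 2 / R := by
      rw [le_div_iff₀ hRpos, mul_comm]; exact hmk
    calc (μ n) (Metric.closedBall 0 (Real.sqrt R))ᶜ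
        ≤ μ n {x | R ≤ x ^ 2} := by
          refine measure_mono fun x hx => ?_
          have hx : Real.sqrt R < |x| := by simpa using hx
          exact ((Real.sqrt_lt' (lt_of_le_of_lt (Real.sqrt_nonneg R) hx)).1 hx).le.trans_eq
            (sq_abs x)
      _ = ENNReal.ofReal ((μ n).real {x | R ≤ x ^ 2}) := by
          rw [Measure.real, ENNReal.ofReal_toReal (measure_ne_top _ _)]
      _ ≤ ENNReal.ofReal (m 2 / R) := ENNReal.ofReal_le_ofReal hreal
      _ ≤ ε := hR.le
  -- A limit along a nonprincipal ultrafilter replaces the choice of a convergent subsequence.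
  obtain ⟨ν, -, hν⟩ := (isCompact_closure_of_isTightMeasureSet htight).ultrafilter_le_nhds
    ((hyperfilter ℕ).map ρ) (by
      refine le_trans ?_ (monotone_principal subset_closure)
      rw [Ultrafilter.coe_map, le_principal_iff, mem_map]
      exact univ_mem' fun n => Set.mem_range_self n)
  refine ⟨ν, inferInstance, fun k => ?_⟩
  have hν' : Tendsto ρ (hyperfilter ℕ : Filter ℕ) (𝓝 ν) := hν
  refine moments_of_tendsto hν' (fun k => ?_) k
  have h1 : ∀ᶠ n in (atTop : Filter ℕ), k ≤ n + 2 :=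
    (eventually_ge_atTop k).mono fun n hn => by omega
  exact (h1.filter_mono (Nat.cofinite_eq_atTop ▸ hyperfilter_le_cofinite)).mono
    fun n hn => hμ n k hn

end Moments
end BetaLaguerre

/-! ### Spectral data of finite Jacobi matrices. -/

namespace BetaLaguerre

/-- The spectral theorem for real symmetric matrices, with ordered eigenvalues. -/
lemma exists_spectral {n : ℕ} {A : Matrix (Fin n) (Fin n) ℝ} (hA : A.transpose = A) :
    ∃ (U : Matrix (Fin n) (Fin n) ℝ) (l : Fin n → ℝ), Monotone l ∧ U.transpose * U = 1 ∧
      A = U * Matrix.diagonal l * U.transpose := by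
  have hH : A.IsHermitian := by
    rw [Matrix.IsHermitian, Matrix.conjTranspose_eq_transpose_of_trivial, hA]
  have key : ∃ (U : Matrix (Fin n) (Fin n) ℝ) (l : Fin n → ℝ), U.transpose * U = 1 ∧
      A = U * Matrix.diagonal l * U.transpose := by
    refine ⟨hH.eigenvectorUnitary, hH.eigenvalues, ?_, ?_⟩
    · have h := Unitary.coe_star_mul_self hH.eigenvectorUnitary
      rwa [Matrix.star_eq_conjTranspose, Matrix.conjTranspose_eq_transpose_of_trivial] at h
    · have h := hH.spectral_theorem
      rw [Unitary.conjStarAlgAut_apply] at h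
      rw [← Matrix.conjTranspose_eq_transpose_of_trivial, ← Matrix.star_eq_conjTranspose]
      exact h
  obtain ⟨U, l, hU, hA'⟩ := key
  let σ := Tuple.sort l
  refine ⟨U.submatrix id σ, l ∘ σ, Tuple.monotone_sort l, ?_, ?_⟩
  · rw [Matrix.transpose_submatrix, ← Matrix.submatrix_mul _ _ _ _ _ Function.bijective_id, hU]
    exact Matrix.submatrix_one _ σ.injective
  · rw [← Matrix.submatrix_diagonal _ _ σ.injective, Matrix.transpose_submatrix,
      ← Matrix.submatrix_mul _ _ _ _ _ σ.bijective, ← Matrix.submatrix_mul _ _ _ _ _ σ.bijective,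
      ← hA', Matrix.submatrix_id_id]

lemma pow_of_spectral {n : ℕ} {U : Matrix (Fin n) (Fin n) ℝ} {l : Fin n → ℝ}
    (hU : U.transpose * U = 1) (k : ℕ) :
    (U * Matrix.diagonal l * U.transpose) ^ k =
      U * Matrix.diagonal (fun i => l i ^ k) * U.transpose := by
  induction k with
  | zero => simpa using (mul_eq_one_comm.1 hU).symm
  | succ k ih =>
    rw [pow_succ, ih]
    calc _ = U * Matrix.diagonal (fun i => l i ^ k) * (U.transpose * U) *
          Matrix.diagonal l * U.transpose := by simp only [Matrix.mul_assoc]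
      _ = _ := by
        rw [hU, Matrix.mul_one, Matrix.mul_assoc U, Matrix.diagonal_mul_diagonal]
        rfl

lemma pow_apply_of_spectral {n : ℕ} {U : Matrix (Fin n) (Fin n) ℝ} {l : Fin n → ℝ}
    (hU : U.transpose * U = 1) (k : ℕ) (i j : Fin n) :
    ((U * Matrix.diagonal l * U.transpose) ^ k) i j = ∑ m, U i m * l m ^ k * U j m := by
  rw [pow_of_spectral hU, Matrix.mul_apply]
  simp [Matrix.mul_diagonal]

lemma trace_pow_of_spectral {n : ℕ} {U : Matrix (Fin n) (Fin n) ℝ} {l : Fin n → ℝ}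
    (hU : U.transpose * U = 1) (k : ℕ) :
    ((U * Matrix.diagonal l * U.transpose) ^ k).trace = ∑ m, l m ^ k := by
  rw [pow_of_spectral hU, Matrix.trace_mul_comm, ← Matrix.mul_assoc, hU, Matrix.one_mul,
    Matrix.trace_diagonal]

/-- The symmetric tridiagonal matrix with Stieltjes continued fraction `κ t₁², κ t₂², …`. -/
def jacobiFin (n : ℕ) (κ : ℝ) (t : ℕ → ℝ) : Matrix (Fin n) (Fin n) ℝ :=
  κ • (bidiagFin n t * (bidiagFin n t).transpose)

lemma jacobiFin_transpose (n : ℕ) (κ : ℝ) (t : ℕ → ℝ) :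
    (jacobiFin n κ t).transpose = jacobiFin n κ t := by
  simp [jacobiFin, Matrix.transpose_mul]

lemma jacobiFin_pow_col_zero {n : ℕ} {t : ℕ → ℝ} (ht : t (2 * (n + 1)) = 0) (κ : ℝ) (r : ℕ)
    (j : Fin (n + 1)) : (jacobiFin (n + 1) κ t ^ r) j 0 = κ ^ r * walk t (2 * r) (2 * j) := by
  rw [jacobiFin, smul_pow, Matrix.smul_apply, bidiagFin_pow_col_zero ht, smul_eq_mul]

lemma jacobiFin_pow_zero_zero {n : ℕ} {t : ℕ → ℝ} (ht : t (2 * (n + 1)) = 0) (κ : ℝ) (r : ℕ) :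
    (jacobiFin (n + 1) κ t ^ r) 0 0 = stieltjes r fun j => κ * t (j + 1) ^ 2 := by
  rw [jacobiFin_pow_col_zero ht, Fin.val_zero, mul_zero, walk_return, stieltjes_mul]

/-- Nonnegative numbers are the coefficients of the Stieltjes continued fraction of a probability
measure, up to any given order. -/
lemma exists_measure_stieltjes {z : ℕ → ℝ} (hz : ∀ i, 0 ≤ z i) (n : ℕ) :
    ∃ μ : Measure ℝ, IsProbabilityMeasure μ ∧ ∀ k ≤ n,
      Integrable (fun x : ℝ => x ^ k) μ ∧ ∫ x, x ^ k ∂μ = stieltjes k z := by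
  -- Path weights are indexed from 1, hence i - 1. Cutting them off after n makes the (n+1)-block
  -- decouple and does not affect moments of order at most n.
  let t : ℕ → ℝ := fun i => if i ≤ n then Real.sqrt (z (i - 1)) else 0
  have ht : t (2 * (n + 1)) = 0 := if_neg (by omega)
  obtain ⟨U, l, -, hU, hJ⟩ := exists_spectral (jacobiFin_transpose (n + 1) 1 t)
  let μ : Measure ℝ := ∑ m : Fin (n + 1), ENNReal.ofReal (U 0 m ^ 2) • Measure.dirac (l m)
  have hint : ∀ k : ℕ, Integrable (fun x : ℝ => x ^ k) μ := fun k =>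
    integrable_finsetSum_measure.2 fun m _ =>
      (integrable_dirac (by simp)).smul_measure ENNReal.ofReal_ne_top
  have hmom : ∀ k : ℕ, ∫ x, x ^ k ∂μ = (jacobiFin (n + 1) 1 t ^ k) 0 0 := by
    intro k
    rw [integral_finsetSum_measure fun m _ =>
      (integrable_dirac (by simp)).smul_measure ENNReal.ofReal_ne_top, hJ,
      pow_apply_of_spectral hU]
    refine Finset.sum_congr rfl fun m _ => ?_
    rw [integral_smul_measure, integral_dirac, ENNReal.toReal_ofReal (sq_nonneg _), smul_eq_mul]
    ring
  have hone : μ Set.univ = 1 := by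
    have h1 : ∑ m, U 0 m ^ 2 = 1 := by
      have hU' : U * U.transpose = 1 := mul_eq_one_comm.1 hU
      have := congrFun (congrFun hU' 0) 0
      rw [Matrix.mul_apply, Matrix.one_apply_eq] at this
      rw [← this]
      exact Finset.sum_congr rfl fun m _ => by rw [Matrix.transpose_apply, sq]
    simp only [μ, Measure.coe_finsetSum, Finset.sum_apply, Measure.smul_apply, measure_univ,
      smul_eq_mul, mul_one]
    rw [← ENNReal.ofReal_sum_of_nonneg fun m _ => sq_nonneg _, h1, ENNReal.ofReal_one]
  refine ⟨μ, ⟨hone⟩, fun k hk => ⟨hint k, ?_⟩⟩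
  rw [hmom, jacobiFin_pow_zero_zero ht]
  refine stieltjes_congr fun i hi => ?_
  have : t (i + 1) = Real.sqrt (z i) := if_pos (by omega)
  rw [this, one_mul, Real.sq_sqrt (hz i)]

/-- The spectral data of a tridiagonal matrix with positive coefficients. -/
lemma exists_spectral_data {n : ℕ} {κ : ℝ} {t : ℕ → ℝ} (hκ : 0 < κ)
    (ht : t (2 * (n + 1)) = 0) (hpos : ∀ i < 2 * n + 1, 0 < t (i + 1)) :
    ∃ q l : Fin (n + 1) → ℝ, (∀ i, 0 < q i) ∧ (∀ i, 0 < l i) ∧ StrictMono l ∧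
      (∀ k, stieltjes k (fun j => κ * t (j + 1) ^ 2) = ∑ i, q i * l i ^ k) ∧
      (∀ k, (jacobiFin (n + 1) κ t ^ k).trace = ∑ i, l i ^ k) ∧
      (∏ i, l i = ∏ i : Fin (n + 1), (κ * t (2 * i + 1) ^ 2)) ∧
      (∏ i, q i) * (Matrix.vandermonde l).det ^ 2 =
        ∏ k : Fin (n + 1), (κ ^ (k : ℕ) * ∏ i ∈ Finset.range (2 * k), t (i + 1)) ^ 2 := by
  obtain ⟨U, l, hmono, hU, hJ⟩ := exists_spectral (jacobiFin_transpose (n + 1) κ t)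
  have hdetU : U.det ^ 2 = 1 := by
    have := congrArg Matrix.det hU
    rwa [Matrix.det_mul, Matrix.det_transpose, Matrix.det_one, ← sq] at this
  have hvand : (∏ i, U 0 i ^ 2) * (Matrix.vandermonde l).det ^ 2 =
      ∏ k : Fin (n + 1), (κ ^ (k : ℕ) * ∏ i ∈ Finset.range (2 * k), t (i + 1)) ^ 2 := by
    -- The Krylov matrix with columns J^k e₀. It is upper triangular with diagonal κ^k t₁ ⋯ t_{2k}.
    -- It also factors as U times the Vandermonde matrix with rows scaled by the first components of
    -- the eigenvectors. Comparing squared determinants gives the formula.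
    let K : Matrix (Fin (n + 1)) (Fin (n + 1)) ℝ :=
      Matrix.of fun j k => (jacobiFin (n + 1) κ t ^ (k : ℕ)) j 0
    have h1 : K = U * Matrix.of fun i k => U 0 i * Matrix.vandermonde l i k := by
      ext j k
      simp only [K, Matrix.of_apply, Matrix.mul_apply]
      rw [hJ, pow_apply_of_spectral hU]
      exact Finset.sum_congr rfl fun m _ => by rw [Matrix.vandermonde_apply]; ring
    have h2 : K.det = ∏ k : Fin (n + 1), K k k := by
      refine Matrix.det_of_isUpperTriangular fun i j hij => ?_
      have hij : j < i := hij
      simp only [K, Matrix.of_apply]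
      rw [jacobiFin_pow_col_zero ht, walk_eq_zero t (by have := Fin.lt_def.1 hij; omega), mul_zero]
    have h3 : ∀ k : Fin (n + 1),
        K k k = κ ^ (k : ℕ) * ∏ i ∈ Finset.range (2 * k), t (i + 1) := by
      intro k
      simp only [K, Matrix.of_apply]
      rw [jacobiFin_pow_col_zero ht, walk_self]
    have h4 := congrArg (fun x : ℝ => x ^ 2) h2
    simp only [h1, Matrix.det_mul, Matrix.det_mul_column, mul_pow, hdetU, one_mul] at h4
    rw [Finset.prod_pow, h4, ← h1, Finset.prod_pow]
    simp only [h3]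
  have hvpos : 0 < (∏ i, U 0 i ^ 2) * (Matrix.vandermonde l).det ^ 2 := by
    rw [hvand]
    refine Finset.prod_pos fun k _ => pow_pos (mul_pos (pow_pos hκ _) ?_) 2
    refine Finset.prod_pos fun i hi => hpos i ?_
    have := Finset.mem_range.1 hi
    have := k.2
    omega
  have hUne : ∀ i, U 0 i ≠ 0 := by
    intro i hi
    have : ∏ i, U 0 i ^ 2 = 0 := Finset.prod_eq_zero (Finset.mem_univ i) (by rw [hi]; ring)
    rw [this, zero_mul] at hvpos
    exact lt_irrefl _ hvpos
  have hinj : Function.Injective l := by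
    refine Matrix.det_vandermonde_ne_zero_iff.1 fun h => ?_
    rw [h] at hvpos
    simp at hvpos
  have hprod : ∏ i, l i = ∏ i : Fin (n + 1), (κ * t (2 * i + 1) ^ 2) := by
    have h1 : (jacobiFin (n + 1) κ t).det = ∏ i, l i := by
      rw [hJ, Matrix.det_mul, Matrix.det_mul, Matrix.det_diagonal, Matrix.det_transpose]
      linear_combination (∏ i, l i) * hdetU
    have h2 : (bidiagFin (n + 1) t).det = ∏ i : Fin (n + 1), t (2 * i + 1) := by
      rw [Matrix.det_of_isLowerTriangular]
      · exact Finset.prod_congr rfl fun i _ => by simp [bidiagFin, bidiag]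
      · intro i j hij
        have hij : i < j := hij
        have := Fin.lt_def.1 hij
        simp only [bidiagFin, bidiag, Matrix.of_apply]
        rw [if_neg (by omega), if_neg (by omega)]
    rw [← h1, jacobiFin, Matrix.det_smul, Matrix.det_mul, Matrix.det_transpose, h2,
      Finset.prod_mul_distrib, Finset.prod_pow]
    simp [sq]
  -- The diagonalized matrix is κ C Cᵗ with C = Uᵗ B, so its diagonal entries are sums of squares.
  have hnn : ∀ i, 0 ≤ l i := by
    intro i
    have h1 : U.transpose * jacobiFin (n + 1) κ t * U = Matrix.diagonal l := by
      rw [hJ]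
      calc _ = (U.transpose * U) * Matrix.diagonal l * (U.transpose * U) := by
            simp only [Matrix.mul_assoc]
        _ = _ := by rw [hU, Matrix.one_mul, Matrix.mul_one]
    have h2 : U.transpose * jacobiFin (n + 1) κ t * U =
        κ • ((U.transpose * bidiagFin (n + 1) t) *
          (U.transpose * bidiagFin (n + 1) t).transpose) := by
      simp [jacobiFin, Matrix.transpose_mul, Matrix.mul_assoc]
    have h3 := congrFun (congrFun (h1.symm.trans h2) i) i
    rw [Matrix.diagonal_apply_eq, Matrix.smul_apply, Matrix.mul_apply, smul_eq_mul] at h3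
    rw [h3]
    exact mul_nonneg hκ.le (Finset.sum_nonneg fun m _ => mul_self_nonneg _)
  refine ⟨fun i => U 0 i ^ 2, l, fun i => by have := hUne i; positivity, fun i => ?_,
    hmono.strictMono_of_injective hinj, fun k => ?_, fun k => ?_, hprod, hvand⟩
  · refine lt_of_le_of_ne (hnn i) fun h => ?_
    have h1 : ∏ i, l i = 0 := Finset.prod_eq_zero (Finset.mem_univ i) h.symm
    have h2 : 0 < ∏ i : Fin (n + 1), (κ * t (2 * i + 1) ^ 2) :=
      Finset.prod_pos fun i _ => mul_pos hκ (pow_pos (hpos _ (by omega)) 2)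
    rw [← hprod, h1] at h2
    exact lt_irrefl _ h2
  · rw [← jacobiFin_pow_zero_zero ht, hJ, pow_apply_of_spectral hU]
    exact Finset.sum_congr rfl fun m _ => by ring
  · rw [hJ, trace_pow_of_spectral hU]

end BetaLaguerre

namespace BetaLaguerre

/-! ### The interleaved index type -/

/-- The rank of an index in the order `inl 0, inr 0, inl 1, inr 1, …`. -/
def rank {N : ℕ} : Fin N ⊕ Fin N → ℕ := Sum.elim (fun i => 2 * (i : ℕ)) fun i => 2 * (i : ℕ) + 1

@[simp] lemma rank_inl {N : ℕ} (i : Fin N) : rank (Sum.inl i) = 2 * (i : ℕ) := rfl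

@[simp] lemma rank_inr {N : ℕ} (i : Fin N) : rank (Sum.inr i) = 2 * (i : ℕ) + 1 := rfl

lemma rank_lt {N : ℕ} (k : Fin N ⊕ Fin N) : rank k < 2 * N := by
  rcases k with i | i <;> (simp only [rank_inl, rank_inr]; omega)

lemma rank_injective {N : ℕ} : Function.Injective (rank (N := N)) := by
  rintro (i | i) (j | j) h <;> (simp at h; first | omega | (congr 1; omega))

lemma sum_rank {A : Type*} [AddCommMonoid A] (N : ℕ) (f : ℕ → A) :
    ∑ k : Fin N ⊕ Fin N, f (rank k) = ∑ d ∈ Finset.range (2 * N), f d := by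
  rw [Fintype.sum_sum_type]
  simp only [rank_inl, rank_inr]
  rw [← Finset.sum_range (fun i => f (2 * i)), ← Finset.sum_range (fun i => f (2 * i + 1)),
    ← Finset.sum_add_distrib]
  induction N with
  | zero => simp
  | succ N ih =>
    rw [Finset.sum_range_succ, ih, Nat.mul_succ, Finset.sum_range_succ, Finset.sum_range_succ,
      add_assoc]

lemma det_of_triangular {ι : Type*} [Fintype ι] [DecidableEq ι] {M : Matrix ι ι ℝ} {b : ι → ℕ}
    (hb : Function.Injective b) (h : ∀ i j, b i < b j → M i j = 0) : M.det = ∏ i, M i i := by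
  let _ : LinearOrder ι := LinearOrder.lift' b hb
  exact Matrix.det_of_isLowerTriangular M fun i j hij => h i j hij

/-- The sequence `t (inl 0), t (inr 0), t (inl 1), …`, continued by zeros. -/
def interleave {N : ℕ} (t : Fin N ⊕ Fin N → ℝ) (h : ℕ) : ℝ :=
  if h' : h / 2 < N then
    if h % 2 = 0 then t (Sum.inl ⟨h / 2, h'⟩) else t (Sum.inr ⟨h / 2, h'⟩)
  else 0

@[simp] lemma interleave_rank {N : ℕ} (t : Fin N ⊕ Fin N → ℝ) (k : Fin N ⊕ Fin N) :
    interleave t (rank k) = t k := by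
  rcases k with i | i
  · have h1 : 2 * (i : ℕ) / 2 = i := by omega
    have h2 : 2 * (i : ℕ) % 2 = 0 := by omega
    simp [interleave]
  · have h1 : (2 * (i : ℕ) + 1) / 2 = i := by omega
    have h2 : (2 * (i : ℕ) + 1) % 2 ≠ 0 := by omega
    simp [interleave, h1]

lemma exists_rank_eq {N h : ℕ} (hh : h < 2 * N) : ∃ k : Fin N ⊕ Fin N, rank k = h := by
  rcases Nat.even_or_odd' h with ⟨j, rfl | rfl⟩
  · exact ⟨Sum.inl ⟨j, by omega⟩, rfl⟩
  · exact ⟨Sum.inr ⟨j, by omega⟩, rfl⟩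

lemma interleave_of_le {N : ℕ} (t : Fin N ⊕ Fin N → ℝ) {h : ℕ} (hh : 2 * N ≤ h) :
    interleave t h = 0 := dif_neg (by omega)

lemma contDiff_interleave {N : ℕ} {m : WithTop ℕ∞} (h : ℕ) :
    ContDiff ℝ m fun t : Fin N ⊕ Fin N → ℝ => interleave t h := by
  simp only [interleave]
  split_ifs <;> fun_prop

/-! ### Moments as functions of the chi variables -/

/-- The moments `s₀² · stieltjes d (κ s₁², κ s₂², …)`. -/
def chiMoment (κ : ℝ) (d : ℕ) (s : ℕ → ℝ) : ℝ :=
  s 0 ^ 2 * stieltjes d fun j => κ * s (j + 1) ^ 2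

lemma chiMoment_congr (κ : ℝ) {d : ℕ} {s s' : ℕ → ℝ} (h : ∀ i ≤ d, s i = s' i) :
    chiMoment κ d s = chiMoment κ d s' := by
  rw [chiMoment, chiMoment, h 0 (Nat.zero_le _),
    stieltjes_congr fun i hi => by rw [h (i + 1) (by omega)]]

/-- The moment of order d contains its last variable s d only in the monomial κ^d s₀² ⋯ s_d². This
gives the diagonal of the triangular Jacobian of `chiMap` and lets the variables be recovered one
after the other. -/
lemma chiMoment_sub_congr (κ : ℝ) {d : ℕ} {s s' : ℕ → ℝ} (h : ∀ i < d, s i = s' i) :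
    chiMoment κ d s - κ ^ d * (∏ i ∈ Finset.range d, s i) ^ 2 * s d ^ 2 =
      chiMoment κ d s' - κ ^ d * (∏ i ∈ Finset.range d, s' i) ^ 2 * s' d ^ 2 := by
  cases d with
  | zero => simp [chiMoment]
  | succ d =>
    have key : ∀ s : ℕ → ℝ, chiMoment κ (d + 1) s -
        κ ^ (d + 1) * (∏ i ∈ Finset.range (d + 1), s i) ^ 2 * s (d + 1) ^ 2 =
        s 0 ^ 2 * (stieltjes (d + 1) (fun j => κ * s (j + 1) ^ 2) -
          ∏ i ∈ Finset.range (d + 1), (κ * s (i + 1) ^ 2)) := by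
      intro s
      rw [chiMoment, Finset.prod_mul_distrib, Finset.prod_const, Finset.card_range,
        Finset.prod_pow, mul_assoc (κ ^ (d + 1)), ← mul_pow, ← Finset.prod_range_succ,
        Finset.prod_range_succ']
      ring
    rw [key, key, h 0 (by omega), stieltjes_sub_prod_congr fun i hi => by rw [h (i + 1) (by omega)]]

lemma contDiff_stieltjes {E : Type*} [NormedAddCommGroup E] [NormedSpace ℝ E] {m : WithTop ℕ∞}
    {r : ℕ} {z : E → ℕ → ℝ} (hz : ∀ i, ContDiff ℝ m fun x => z x i) :
    ContDiff ℝ m fun x => stieltjes r (z x) := by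
  induction r using Nat.strong_induction_on generalizing z with
  | _ r ih =>
    cases r with
    | zero => simpa using contDiff_const
    | succ r =>
      simp only [stieltjes_succ]
      refine (hz 0).mul (ContDiff.sum fun p hp => ?_)
      have hp := Finset.HasAntidiagonal.mem_antidiagonal.1 hp
      exact (ih p.1 (by omega) hz).mul
        (ih p.2 (by omega) (z := fun x => shift (z x)) fun i => hz (i + 1))

variable {N : ℕ}

/-- The moments of even and odd rank as a function of the chi variables. -/
def chiMap (κ : ℝ) (t : Fin N ⊕ Fin N → ℝ) : Fin N ⊕ Fin N → ℝ :=
  fun k => chiMoment κ (rank k) (interleave t)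

lemma contDiff_chiMap (κ : ℝ) {m : WithTop ℕ∞} : ContDiff ℝ m (chiMap (N := N) κ) := by
  refine contDiff_pi.2 fun k => ?_
  refine ((contDiff_interleave 0).pow 2).mul (contDiff_stieltjes fun i => ?_)
  exact contDiff_const.mul ((contDiff_interleave (i + 1)).pow 2)

lemma differentiable_chiMap (κ : ℝ) : Differentiable ℝ (chiMap (N := N) κ) :=
  (contDiff_chiMap (m := 1) κ).differentiable one_ne_zero

lemma interleave_add_single_of_lt (t : Fin N ⊕ Fin N → ℝ) {j : Fin N ⊕ Fin N} (s : ℝ) {h : ℕ}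
    (hh : h ≠ rank j) : interleave (t + s • Pi.single j 1) h = interleave t h := by
  by_cases h' : h < 2 * N
  · obtain ⟨k, rfl⟩ := exists_rank_eq h'
    have : k ≠ j := fun h => hh (by rw [h])
    simp [this]
  · rw [interleave_of_le _ (by omega), interleave_of_le _ (by omega)]

lemma hasDerivAt_line {E F : Type*} [NormedAddCommGroup E] [NormedSpace ℝ E]
    [NormedAddCommGroup F] [NormedSpace ℝ F] {f : E → F} {x v : E} (hf : DifferentiableAt ℝ f x) :
    HasDerivAt (fun s : ℝ => f (x + s • v)) (fderiv ℝ f x v) 0 := by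
  have h1 : HasDerivAt (fun s : ℝ => x + s • v) v 0 := by
    simpa using ((hasDerivAt_id (0 : ℝ)).smul_const v).const_add x
  have h2 : HasFDerivAt f (fderiv ℝ f x) (x + (0 : ℝ) • v) := by simpa using hf.hasFDerivAt
  exact h2.comp_hasDerivAt (0 : ℝ) h1

lemma det_fderiv_eq {ι : Type*} [Fintype ι] [DecidableEq ι] (f : (ι → ℝ) → ι → ℝ) (x : ι → ℝ) :
    (fderiv ℝ f x).det = (Matrix.of fun k j => fderiv ℝ f x (Pi.single j 1) k).det := by
  rw [ContinuousLinearMap.det, ← LinearMap.det_toMatrix']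
  congr 1

/-- A moment does not depend on variables of higher rank, so the Jacobian matrix is triangular for
the rank order. The diagonal entries are the derivatives of the single monomial in which the last
variable occurs. -/
lemma det_fderiv_chiMap (κ : ℝ) (t : Fin N ⊕ Fin N → ℝ) :
    (fderiv ℝ (chiMap κ) t).det =
      ∏ k : Fin N ⊕ Fin N,
        κ ^ rank k * (∏ i ∈ Finset.range (rank k), interleave t i) ^ 2 * (2 * t k) := by
  have hline : ∀ k j : Fin N ⊕ Fin N, HasDerivAt
      (fun s : ℝ => chiMap κ (t + s • Pi.single j 1) k)
      (fderiv ℝ (chiMap κ) t (Pi.single j 1) k) 0 := fun k j =>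
    hasDerivAt_pi.1 (hasDerivAt_line (differentiable_chiMap κ t)) k
  rw [det_fderiv_eq, det_of_triangular rank_injective]
  · refine Finset.prod_congr rfl fun k _ => ?_
    refine (hline k k).unique ?_
    have h1 : (fun s : ℝ => chiMap κ (t + s • Pi.single k 1) k) = fun s : ℝ =>
        κ ^ rank k * (∏ i ∈ Finset.range (rank k), interleave t i) ^ 2 * (t k + s) ^ 2 +
        (chiMoment κ (rank k) (interleave t) -
          κ ^ rank k * (∏ i ∈ Finset.range (rank k), interleave t i) ^ 2 *
            interleave t (rank k) ^ 2) := by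
      funext s
      have h2 : ∀ i < rank k, interleave (t + s • Pi.single k 1) i = interleave t i :=
        fun i hi => interleave_add_single_of_lt t s hi.ne
      have h3 := chiMoment_sub_congr κ h2
      rw [Finset.prod_congr rfl fun i hi => h2 i (Finset.mem_range.1 hi)] at h3
      rw [← h3, interleave_rank]
      simp [chiMap]
    rw [h1]
    have h2 : HasDerivAt (fun s : ℝ => (t k + s) ^ 2) (2 * t k) 0 := by
      simpa using ((hasDerivAt_id (0 : ℝ)).const_add (t k)).fun_pow 2
    exact (h2.const_mul _).add_const _
  · intro k j hkj
    refine (hline k j).unique ?_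
    have h1 : (fun s : ℝ => chiMap κ (t + s • Pi.single j 1) k) = fun _ => chiMap κ t k := by
      funext s
      exact chiMoment_congr κ fun i hi => interleave_add_single_of_lt t s (by omega)
    rw [h1]
    exact hasDerivAt_const _ _

/-- Solve the triangular system by increasing rank. Each step determines the square of one variable,
and positivity fixes the root. -/
lemma chiMap_injOn {κ : ℝ} (hκ : 0 < κ) :
    Set.InjOn (chiMap (N := N) κ) {t | ∀ k, 0 < t k} := by
  intro t ht t' ht' h
  have key : ∀ d, interleave t d = interleave t' d := by
    intro d
    induction d using Nat.strong_induction_on with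
    | _ d ih =>
      by_cases hd : d < 2 * N
      · obtain ⟨k, rfl⟩ := exists_rank_eq hd
        have h1 := chiMoment_sub_congr κ ih
        have h2 : chiMoment κ (rank k) (interleave t) = chiMoment κ (rank k) (interleave t') :=
          congrFun h k
        rw [Finset.prod_congr rfl fun i hi => ih i (Finset.mem_range.1 hi), h2, sub_right_inj] at h1
        have h3 : (∏ i ∈ Finset.range (rank k), interleave t' i) ≠ 0 := by
          refine Finset.prod_ne_zero_iff.2 fun i hi => ?_
          obtain ⟨j, rfl⟩ := exists_rank_eq ((Finset.mem_range.1 hi).trans (rank_lt k))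
          rw [interleave_rank]
          exact (ht' j).ne'
        have h4 := mul_left_cancel₀ (by positivity) h1
        rw [interleave_rank, interleave_rank] at h4 ⊢
        exact (pow_left_inj₀ (ht k).le (ht' k).le two_ne_zero).1 h4
      · rw [interleave_of_le _ (by omega), interleave_of_le _ (by omega)]
  funext k
  rw [← interleave_rank t, key, interleave_rank]

/-! ### Moments as functions of atoms and weights -/

/-- The moments of the measure with weights `y (inl i)` at the points `y (inr i)`. -/
def atomMap (y : Fin N ⊕ Fin N → ℝ) : Fin N ⊕ Fin N → ℝ :=
  fun k => ∑ i, y (Sum.inl i) * y (Sum.inr i) ^ rank k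

lemma differentiable_atomMap : Differentiable ℝ (atomMap (N := N)) := by
  refine differentiable_pi.2 fun k => ?_
  simp only [atomMap]
  fun_prop

/-- The 2N moments determine the integral of every polynomial of degree below 2N, so injectivity of
`atomMap` reduces to the choice of test polynomials. -/
lemma sum_mul_eval_eq (p : Polynomial ℝ) (hp : p.natDegree < 2 * N) (y : Fin N ⊕ Fin N → ℝ) :
    ∑ i, y (Sum.inl i) * p.eval (y (Sum.inr i)) =
      ∑ k : Fin N ⊕ Fin N, p.coeff (rank k) * atomMap y k := by
  simp only [atomMap]
  rw [sum_rank N fun d => p.coeff d * ∑ i, y (Sum.inl i) * y (Sum.inr i) ^ d]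
  simp only [Polynomial.eval_eq_sum_range' hp, Finset.mul_sum]
  rw [Finset.sum_comm]
  exact Finset.sum_congr rfl fun d _ => Finset.sum_congr rfl fun i _ => by ring

lemma range_subset_of_atomMap_eq {y y' : Fin N ⊕ Fin N → ℝ} (hy : ∀ k, 0 < y k)
    (hinj : Function.Injective fun i => y (Sum.inr i)) (h : atomMap y = atomMap y') :
    Set.range (fun i => y (Sum.inr i)) ⊆ Set.range fun i => y' (Sum.inr i) := by
  rintro _ ⟨i, rfl⟩
  by_contra hi
  -- A polynomial of degree 2N - 1 vanishing at all atoms of both measures except the given one.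
  let p : Polynomial ℝ := (∏ j ∈ Finset.univ.erase i, (Polynomial.X - Polynomial.C (y (Sum.inr j)))) *
    ∏ j, (Polynomial.X - Polynomial.C (y' (Sum.inr j)))
  have hdeg : p.natDegree < 2 * N := by
    rw [Polynomial.Monic.natDegree_mul (Polynomial.monic_prod_of_monic _ _ fun j _ =>
      Polynomial.monic_X_sub_C _) (Polynomial.monic_prod_of_monic _ _ fun j _ =>
      Polynomial.monic_X_sub_C _), Polynomial.natDegree_finsetProd_X_sub_C_eq_card,
      Polynomial.natDegree_finsetProd_X_sub_C_eq_card, Finset.card_erase_of_mem (Finset.mem_univ i)]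
    simp only [Finset.card_univ, Fintype.card_fin]
    have := i.2
    omega
  have h1 := sum_mul_eval_eq p hdeg y
  rw [h, ← sum_mul_eval_eq p hdeg y', Finset.sum_eq_single i, Finset.sum_eq_zero] at h1
  · rcases mul_eq_zero.1 h1 with h2 | h2
    · exact (hy _).ne' h2
    · simp only [p, Polynomial.eval_mul, Polynomial.eval_prod, Polynomial.eval_sub,
        Polynomial.eval_X, Polynomial.eval_C] at h2
      rcases mul_eq_zero.1 h2 with h3 | h3
      · obtain ⟨j, hj, hj'⟩ := Finset.prod_eq_zero_iff.1 h3
        exact (Finset.ne_of_mem_erase hj) (hinj (sub_eq_zero.1 hj')).symm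
      · obtain ⟨j, -, hj'⟩ := Finset.prod_eq_zero_iff.1 h3
        exact hi ⟨j, (sub_eq_zero.1 hj').symm⟩
  · intro j _
    simp only [p, Polynomial.eval_mul, Polynomial.eval_prod, Polynomial.eval_sub,
        Polynomial.eval_X, Polynomial.eval_C]
    rw [Finset.prod_eq_zero (Finset.mem_univ j) (sub_self _)]
    simp
  · intro j _ hj
    simp only [p, Polynomial.eval_mul, Polynomial.eval_prod, Polynomial.eval_sub,
        Polynomial.eval_X, Polynomial.eval_C]
    rw [Finset.prod_eq_zero (Finset.mem_erase.2 ⟨hj, Finset.mem_univ j⟩) (sub_self _)]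
    simp
  · simp

/-- Positive weights and increasing positive atoms. -/
def chamber (N : ℕ) : Set (Fin N ⊕ Fin N → ℝ) :=
  {y | (∀ k, 0 < y k) ∧ StrictMono fun i => y (Sum.inr i)}

lemma atomMap_injOn : Set.InjOn (atomMap (N := N)) (chamber N) := by
  intro y hy y' hy' h
  have hr : (fun i => y (Sum.inr i)) = fun i => y' (Sum.inr i) :=
    (hy.2.range_inj hy'.2).1 ((range_subset_of_atomMap_eq hy.1 hy.2.injective h).antisymm
      (range_subset_of_atomMap_eq hy'.1 hy'.2.injective h.symm))
  have hw : ∀ i, y (Sum.inl i) = y' (Sum.inl i) := by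
    intro i
    -- Once the atoms agree, this multiple of a Lagrange polynomial isolates the i-th weight.
    let p : Polynomial ℝ :=
      ∏ j ∈ Finset.univ.erase i, (Polynomial.X - Polynomial.C (y (Sum.inr j)))
    have hdeg : p.natDegree < 2 * N := by
      rw [Polynomial.natDegree_finsetProd_X_sub_C_eq_card,
        Finset.card_erase_of_mem (Finset.mem_univ i)]
      simp only [Finset.card_univ, Fintype.card_fin]
      have := i.2
      omega
    have hp : ∀ j, j ≠ i → p.eval (y (Sum.inr j)) = 0 := by
      intro j hj
      simp only [p, Polynomial.eval_prod, Polynomial.eval_sub, Polynomial.eval_X, Polynomial.eval_C]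
      exact Finset.prod_eq_zero (Finset.mem_erase.2 ⟨hj, Finset.mem_univ j⟩) (sub_self _)
    have hpi : p.eval (y (Sum.inr i)) ≠ 0 := by
      simp only [p, Polynomial.eval_prod, Polynomial.eval_sub, Polynomial.eval_X, Polynomial.eval_C]
      refine Finset.prod_ne_zero_iff.2 fun j hj => sub_ne_zero.2 fun h => ?_
      exact (Finset.ne_of_mem_erase hj) (hy.2.injective h).symm
    have h1 := sum_mul_eval_eq p hdeg y
    rw [h, ← sum_mul_eval_eq p hdeg y', Finset.sum_eq_single i, Finset.sum_eq_single i] at h1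
    · rw [← congrFun hr i] at h1
      exact mul_right_cancel₀ hpi h1
    · intro j _ hj
      rw [← congrFun hr j, hp j hj, mul_zero]
    · simp
    · intro j _ hj
      rw [hp j hj, mul_zero]
    · simp
  funext k
  rcases k with i | i
  · exact hw i
  · exact congrFun hr i

/-- The Newton polynomials of the doubled nodes. -/
noncomputable def newton (l : Fin N → ℝ) : Fin N ⊕ Fin N → Polynomial ℝ :=
  Sum.elim (fun a => (∏ b ∈ Finset.Iio a, (Polynomial.X - Polynomial.C (l b))) ^ 2)
    fun a => (∏ b ∈ Finset.Iio a, (Polynomial.X - Polynomial.C (l b))) ^ 2 *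
      (Polynomial.X - Polynomial.C (l a))

lemma newton_monic_natDegree (l : Fin N → ℝ) (k : Fin N ⊕ Fin N) :
    (newton l k).Monic ∧ (newton l k).natDegree = rank k := by
  have h1 : ∀ a : Fin N, (∏ b ∈ Finset.Iio a, (Polynomial.X - Polynomial.C (l b))).Monic :=
    fun a => Polynomial.monic_prod_of_monic _ _ fun j _ => Polynomial.monic_X_sub_C _
  have h2 : ∀ a : Fin N, ((∏ b ∈ Finset.Iio a,
      (Polynomial.X - Polynomial.C (l b))) ^ 2).natDegree = 2 * (a : ℕ) := fun a => by
    rw [(h1 a).natDegree_pow, Polynomial.natDegree_finsetProd_X_sub_C_eq_card, Fin.card_Iio]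
  rcases k with a | a
  · exact ⟨(h1 a).pow 2, h2 a⟩
  · refine ⟨((h1 a).pow 2).mul (Polynomial.monic_X_sub_C _), ?_⟩
    simp only [newton, Sum.elim_inr]
    rw [((h1 a).pow 2).natDegree_mul (Polynomial.monic_X_sub_C _), h2,
      Polynomial.natDegree_X_sub_C, rank_inr]

/-- The confluent Vandermonde determinant. -/
lemma det_confluent_vandermonde (l : Fin N → ℝ) :
    (Matrix.of fun k j : Fin N ⊕ Fin N => Sum.elim (fun i => l i ^ rank k)
      (fun i => (rank k : ℝ) * l i ^ (rank k - 1)) j).det = (Matrix.vandermonde l).det ^ 4 := by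
  set M := (Matrix.of fun k j : Fin N ⊕ Fin N => Sum.elim (fun i => l i ^ rank k)
      (fun i => (rank k : ℝ) * l i ^ (rank k - 1)) j) with hM
  -- Change of basis from monomials to Newton polynomials with each node doubled. It is
  -- unitriangular, so it does not change the determinant.
  let T : Matrix (Fin N ⊕ Fin N) (Fin N ⊕ Fin N) ℝ := Matrix.of fun k' k => (newton l k').coeff (rank k)
  have hT : T.det = 1 := by
    rw [det_of_triangular rank_injective]
    · refine Finset.prod_eq_one fun k _ => ?_
      have := (newton_monic_natDegree l k).1
      rwa [Polynomial.Monic, Polynomial.leadingCoeff, (newton_monic_natDegree l k).2] at this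
    · intro k j hkj
      exact Polynomial.coeff_eq_zero_of_natDegree_lt ((newton_monic_natDegree l k).2 ▸ hkj)
  have hdeg : ∀ k, (newton l k).natDegree < 2 * N := fun k =>
    (newton_monic_natDegree l k).2 ▸ rank_lt k
  have hl : ∀ k i, (T * M) k (Sum.inl i) = (newton l k).eval (l i) := by
    intro k i
    rw [Matrix.mul_apply, Polynomial.eval_eq_sum_range' (hdeg k), ← sum_rank]
    rfl
  have hr : ∀ k i, (T * M) k (Sum.inr i) = (newton l k).derivative.eval (l i) := by
    intro k i
    rw [Matrix.mul_apply, Polynomial.derivative_eval, Polynomial.sum_over_range' _ (by simp) _ (hdeg k),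
      ← sum_rank]
    exact Finset.sum_congr rfl fun j _ => (mul_assoc _ _ _).symm
  have hzero : ∀ a i : Fin N, i < a →
      (∏ b ∈ Finset.Iio a, (Polynomial.X - Polynomial.C (l b))).eval (l i) = 0 := by
    intro a i hi
    rw [Polynomial.eval_prod]
    exact Finset.prod_eq_zero (Finset.mem_Iio.2 hi) (by simp)
  have hdet : (T * M).det = ∏ a : Fin N, ((∏ b ∈ Finset.Iio a, (l a - l b)) ^ 2 *
      (∏ b ∈ Finset.Iio a, (l a - l b)) ^ 2) := by
    -- A Newton polynomial vanishes to second order at all earlier nodes, and the one with the extra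
    -- factor vanishes to first order at its own node. Hence values and derivatives form a
    -- triangular matrix.
    have htri : (T * M).transpose.det = ∏ k, (T * M).transpose k k := by
      refine det_of_triangular rank_injective fun j k hjk => ?_
      rw [Matrix.transpose_apply]
      rcases j with i | i <;> rcases k with a | a <;> simp only [rank_inl, rank_inr] at hjk
      · rw [hl]
        simp [newton, hzero a i (Fin.lt_def.2 (by omega))]
      · rw [hl]
        rcases lt_or_eq_of_le (show i ≤ a from Fin.le_def.2 (by omega)) with h | rfl
        · simp [newton, hzero a i h]
        · simp [newton]
      · rw [hr]
        simp [newton, Polynomial.derivative_pow, hzero a i (Fin.lt_def.2 (by omega))]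
      · rw [hr]
        simp [newton, Polynomial.derivative_pow, hzero a i (Fin.lt_def.2 (by omega))]
    rw [← Matrix.det_transpose, htri, Fintype.prod_sum_type, ← Finset.prod_mul_distrib]
    refine Finset.prod_congr rfl fun a _ => ?_
    rw [Matrix.transpose_apply, Matrix.transpose_apply, hl, hr]
    simp [newton, Polynomial.eval_prod]
  rw [Matrix.det_mul, hT, one_mul] at hdet
  have hV : (Matrix.vandermonde l).det = ∏ a : Fin N, ∏ b ∈ Finset.Iio a, (l a - l b) := by
    rw [Matrix.det_vandermonde]
    exact Finset.prod_comm' (by simp)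
  rw [hdet, hV, ← Finset.prod_pow]
  exact Finset.prod_congr rfl fun a _ => by ring

/-- The derivative in a weight is a column of powers; the derivative in an atom is the weight times
the derivative of that column. Taking the weights out of the columns leaves the confluent
Vandermonde matrix. -/
lemma det_fderiv_atomMap (y : Fin N ⊕ Fin N → ℝ) :
    (fderiv ℝ atomMap y).det =
      (∏ i, y (Sum.inl i)) * (Matrix.vandermonde fun i => y (Sum.inr i)).det ^ 4 := by
  rw [det_fderiv_eq, ← det_confluent_vandermonde]
  have h : (Matrix.of fun k j => fderiv ℝ atomMap y (Pi.single j 1) k) =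
      Matrix.of fun k j => Sum.elim (fun _ => 1) (fun i => y (Sum.inl i)) j *
        (Matrix.of fun k j : Fin N ⊕ Fin N => Sum.elim (fun i => y (Sum.inr i) ^ rank k)
        (fun i => (rank k : ℝ) * y (Sum.inr i) ^ (rank k - 1)) j) k j := by
    ext k j
    have h1 := hasDerivAt_pi.1
      (hasDerivAt_line (v := Pi.single j (1 : ℝ)) (differentiable_atomMap y)) k
    refine h1.unique ?_
    have h2 : ∀ a b u v : ℝ, HasDerivAt (fun s : ℝ => (a + s * u) * (b + s * v) ^ rank k)
        (u * b ^ rank k + a * (rank k * b ^ (rank k - 1) * v)) 0 := by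
      intro a b u v
      have h3 : ∀ a u : ℝ, HasDerivAt (fun s : ℝ => a + s * u) u 0 := fun a u => by
        simpa using ((hasDerivAt_id (0 : ℝ)).mul_const u).const_add a
      simpa using (h3 a u).fun_mul ((h3 b v).fun_pow (rank k))
    have h3 := HasDerivAt.fun_sum (u := Finset.univ) fun i (_ : i ∈ Finset.univ) =>
      h2 (y (Sum.inl i)) (y (Sum.inr i)) ((Pi.single j 1 : Fin N ⊕ Fin N → ℝ) (Sum.inl i))
        ((Pi.single j 1 : Fin N ⊕ Fin N → ℝ) (Sum.inr i))
    have h4 : HasDerivAt (fun s : ℝ => atomMap (y + s • Pi.single j (1 : ℝ)) k) _ 0 := h3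
    refine h4.congr_deriv ?_
    rcases j with j | j <;> simp [Pi.single_apply]
  rw [h, Matrix.det_mul_row, Fintype.prod_sum_type]
  simp

end BetaLaguerre

/-! ### Chi variables and spectral data parametrize the same moments. -/

namespace BetaLaguerre

variable {n : ℕ}

/-- The trace of κ B Bᵗ is κ times the sum of the squared entries of B, and the first term restores
the variable that does not enter B. This later matches the exponential factors of the two densities,
and it supplies compactness. -/
lemma trace_jacobiFin (κ : ℝ) (t : Fin (n + 1) ⊕ Fin (n + 1) → ℝ) :
    κ * t (Sum.inl 0) ^ 2 + (jacobiFin (n + 1) κ (interleave t)).trace = κ * ∑ k, t k ^ 2 := by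
  have h0 : interleave t 0 = t (Sum.inl 0) := interleave_rank t (Sum.inl 0)
  set s := interleave t with hs
  have hlast : s (2 * (n + 1)) = 0 := interleave_of_le t le_rfl
  have h1 : ∑ k, t k ^ 2 = ∑ d ∈ Finset.range (2 * (n + 1)), s d ^ 2 := by
    rw [← sum_rank (n + 1) fun d => s d ^ 2]
    exact Finset.sum_congr rfl fun k _ => by rw [hs, interleave_rank]
  have h2 : (jacobiFin (n + 1) κ s).trace =
      κ * ∑ j ∈ Finset.range (n + 1), (s (2 * j + 1) ^ 2 + s (2 * j + 2) ^ 2) := by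
    rw [jacobiFin, Matrix.trace_smul, smul_eq_mul, Matrix.trace_mul_comm, Matrix.trace,
      Finset.sum_range]
    congr 1
    refine Finset.sum_congr rfl fun j _ => ?_
    have h3 := sum_mul_bidiag_col s (fun k => bidiag s k j) (s := Finset.range (n + 1)) (j := j)
      (Finset.mem_range.2 j.2) (fun h => by
        have : (j : ℕ) = n := by have := j.2; simp at h; omega
        rw [this, ← hlast]; congr 1)
    rw [Finset.sum_range] at h3
    rw [Matrix.diag_apply, Matrix.mul_apply]
    refine Eq.trans h3 ?_
    simp [bidiag, sq]
    left; ring_nf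
  have h4 : ∀ m, ∑ j ∈ Finset.range m, (s (2 * j + 1) ^ 2 + s (2 * j + 2) ^ 2) =
      ∑ d ∈ Finset.range (2 * m), s (d + 1) ^ 2 := by
    intro m
    induction m with
    | zero => simp
    | succ m ih =>
      rw [Finset.sum_range_succ, ih, Nat.mul_succ, Finset.sum_range_succ, Finset.sum_range_succ,
        add_assoc]
  have h5 : ∑ d ∈ Finset.range (2 * (n + 1)), s (d + 1) ^ 2 + s 0 ^ 2 =
      ∑ d ∈ Finset.range (2 * (n + 1)), s d ^ 2 := by
    rw [← Finset.sum_range_succ' (fun d => s d ^ 2), Finset.sum_range_succ, hlast]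
    simp
  rw [h2, h4, h1, ← h5, h0]
  ring

/-- The relations between chi variables and the spectral data `y` of the tridiagonal matrix. -/
structure IsSpectralData (κ : ℝ) (t y : Fin (n + 1) ⊕ Fin (n + 1) → ℝ) : Prop where
  mem_chamber : y ∈ chamber (n + 1)
  map_eq : chiMap κ t = atomMap y
  moment : ∀ k, t (Sum.inl 0) ^ 2 * (jacobiFin (n + 1) κ (interleave t) ^ k) 0 0 =
    ∑ i, y (Sum.inl i) * y (Sum.inr i) ^ k
  trace : ∀ k, (jacobiFin (n + 1) κ (interleave t) ^ k).trace = ∑ i, y (Sum.inr i) ^ k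
  prod_atoms : ∏ i, y (Sum.inr i) = ∏ i, (κ * t (Sum.inr i) ^ 2)
  prod_weights : (∏ i, y (Sum.inl i)) * (Matrix.vandermonde fun i => y (Sum.inr i)).det ^ 2 =
    ∏ k : Fin (n + 1),
      (κ ^ (k : ℕ) * ∏ i ∈ Finset.range (2 * k + 1), interleave t i) ^ 2

/-- Scaling the spectral probabilities by the square of the variable of rank 0 frees their total
mass. The same factor extends the products in the Vandermonde formula to start at index 0. -/
lemma exists_isSpectralData {κ : ℝ} (hκ : 0 < κ) {t : Fin (n + 1) ⊕ Fin (n + 1) → ℝ}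
    (ht : ∀ k, 0 < t k) : ∃ y, IsSpectralData κ t y := by
  have hlast : interleave t (2 * (n + 1)) = 0 := interleave_of_le t le_rfl
  have h0 : interleave t 0 = t (Sum.inl 0) := interleave_rank t (Sum.inl 0)
  obtain ⟨q, l, hq, hl, hmono, hmom, htr, hprod, hvand⟩ :=
    exists_spectral_data hκ hlast fun i hi => by
      obtain ⟨k, hk⟩ := exists_rank_eq (N := n + 1) (show i + 1 < 2 * (n + 1) by omega)
      rw [← hk, interleave_rank]; exact ht k
  refine ⟨Sum.elim (fun i => t (Sum.inl 0) ^ 2 * q i) l, ⟨?_, hmono⟩, ?_, fun k => ?_, htr, ?_, ?_⟩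
  · rintro (i | i)
    · exact mul_pos (pow_pos (ht _) 2) (hq i)
    · exact hl i
  · funext k
    simp only [chiMap, chiMoment, atomMap, Sum.elim_inl, Sum.elim_inr]
    rw [hmom, h0, Finset.mul_sum]
    exact Finset.sum_congr rfl fun i _ => by ring
  · rw [jacobiFin_pow_zero_zero hlast, hmom, Finset.mul_sum]
    exact Finset.sum_congr rfl fun i _ => by simp only [Sum.elim_inl, Sum.elim_inr]; ring
  · simp only [Sum.elim_inr]
    rw [hprod]
    exact Finset.prod_congr rfl fun i _ => by rw [← rank_inr, interleave_rank]
  · simp only [Sum.elim_inl, Sum.elim_inr]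
    rw [Finset.prod_mul_distrib, mul_assoc, hvand, ← Finset.prod_mul_distrib]
    refine Finset.prod_congr rfl fun k _ => ?_
    rw [Finset.prod_range_succ', h0]
    ring

lemma isSpectralData_of_map_eq {κ : ℝ} (hκ : 0 < κ) {t y : Fin (n + 1) ⊕ Fin (n + 1) → ℝ}
    (ht : ∀ k, 0 < t k) (hy : y ∈ chamber (n + 1)) (h : chiMap κ t = atomMap y) :
    IsSpectralData κ t y := by
  obtain ⟨y', hy'⟩ := exists_isSpectralData hκ ht
  have : y' = y := atomMap_injOn hy'.mem_chamber hy (hy'.map_eq.symm.trans h)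
  exact this ▸ hy'

lemma IsSpectralData.sum_weights {κ : ℝ} {t y : Fin (n + 1) ⊕ Fin (n + 1) → ℝ}
    (h : IsSpectralData κ t y) : ∑ i, y (Sum.inl i) = t (Sum.inl 0) ^ 2 := by
  simpa using (h.moment 0).symm

lemma IsSpectralData.sum_sq {κ : ℝ} {t y : Fin (n + 1) ⊕ Fin (n + 1) → ℝ}
    (h : IsSpectralData κ t y) :
    κ * ∑ k, t k ^ 2 = κ * ∑ i, y (Sum.inl i) + ∑ i, y (Sum.inr i) := by
  rw [← trace_jacobiFin, h.sum_weights]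
  simpa using h.trace 1

lemma isOpen_pos {ι : Type*} [Finite ι] : IsOpen {t : ι → ℝ | ∀ k, 0 < t k} := by
  simp only [Set.ofPred_forall]
  exact isOpen_iInter_of_finite fun k => isOpen_lt continuous_const (continuous_apply k)

lemma isOpen_chamber (N : ℕ) : IsOpen (chamber N) := by
  have h : chamber N = {y | ∀ k, 0 < y k} ∩
      ⋂ i : Fin N, ⋂ j : Fin N, ⋂ _ : i < j, {y | y (Sum.inr i) < y (Sum.inr j)} := by
    ext y
    simp only [chamber, Set.mem_ofPred_eq, Set.mem_inter_iff, Set.mem_iInter]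
    exact and_congr_right fun _ => ⟨fun h i j hij => h hij, fun h i j hij => h i j hij⟩
  rw [h]
  refine isOpen_pos.inter (isOpen_iInter_of_finite fun i => isOpen_iInter_of_finite fun j =>
    isOpen_iInter_of_finite fun _ => isOpen_lt (continuous_apply _) (continuous_apply _))

lemma convex_chamber (N : ℕ) : Convex ℝ (chamber N) := by
  intro x hx y hy a b ha hb hab
  refine ⟨fun k => ?_, fun i j hij => ?_⟩
  · exact convex_Ioi (𝕜 := ℝ) (0 : ℝ) (hx.1 k) (hy.1 k) ha hb hab
  · have h1 : x (Sum.inr i) < x (Sum.inr j) := hx.2 hij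
    have h2 : y (Sum.inr i) < y (Sum.inr j) := hy.2 hij
    simp only [Pi.add_apply, Pi.smul_apply, smul_eq_mul]
    rcases ha.eq_or_lt with rfl | ha
    · have : b = 1 := by linarith
      subst this; linarith
    · have := mul_lt_mul_of_pos_left h1 ha
      have := mul_le_mul_of_nonneg_left h2.le hb
      linarith

lemma det_fderiv_chiMap_pos {N : ℕ} {κ : ℝ} (hκ : 0 < κ) {t : Fin N ⊕ Fin N → ℝ}
    (ht : ∀ k, 0 < t k) : 0 < (fderiv ℝ (chiMap κ) t).det := by
  rw [det_fderiv_chiMap]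
  refine Finset.prod_pos fun k _ => mul_pos (mul_pos (pow_pos hκ _) (pow_pos ?_ 2))
    (mul_pos two_pos (ht k))
  refine Finset.prod_pos fun i hi => ?_
  obtain ⟨j, rfl⟩ := exists_rank_eq ((Finset.mem_range.1 hi).trans (rank_lt k))
  rw [interleave_rank]
  exact ht j

/-- The Jacobian determinant is positive on positive variables, so the map is locally open there. -/
lemma isOpen_image_chiMap {N : ℕ} {κ : ℝ} (hκ : 0 < κ) :
    IsOpen (chiMap κ '' {t : Fin N ⊕ Fin N → ℝ | ∀ k, 0 < t k}) := by
  refine isOpen_iff_mem_nhds.2 ?_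
  rintro _ ⟨t, ht, rfl⟩
  have h1 : HasStrictFDerivAt (chiMap κ) (fderiv ℝ (chiMap κ) t) t :=
    ((contDiff_chiMap (m := 1) κ).contDiffAt).hasStrictFDerivAt one_ne_zero
  have h0 : Function.Surjective (fderiv ℝ (chiMap κ) t) :=
    (LinearMap.equivOfDetNeZero _ (det_fderiv_chiMap_pos hκ ht).ne').surjective
  have h2 : (fderiv ℝ (chiMap κ) t).range = ⊤ := LinearMap.range_eq_top.2 h0
  rw [← h1.map_nhds_eq_of_surj h2]
  exact image_mem_map (isOpen_pos.mem_nhds ht)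

/-- Every increasing configuration of positive atoms with positive weights comes from positive
chi variables. -/
lemma image_chiMap_eq {κ : ℝ} (hκ : 0 < κ) :
    chiMap κ '' {t : Fin (n + 1) ⊕ Fin (n + 1) → ℝ | ∀ k, 0 < t k} =
      atomMap '' chamber (n + 1) := by
  refine Set.Subset.antisymm ?_ ?_
  · rintro _ ⟨t, ht, rfl⟩
    obtain ⟨y, hy⟩ := exists_isSpectralData hκ ht
    exact ⟨y, hy.mem_chamber, hy.map_eq.symm⟩
  set O : Set (Fin (n + 1) ⊕ Fin (n + 1) → ℝ) := {t | ∀ k, 0 < t k} with hO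
  set u := chamber (n + 1) ∩ atomMap ⁻¹' (chiMap κ '' O) with hu
  -- The chamber is convex, hence connected. The configurations reached from positive chi variables
  -- form an open, nonempty and relatively closed part of it.
  have hsub : chamber (n + 1) ⊆ u := by
    refine (convex_chamber (n + 1)).isPreconnected.subset_of_closure_inter_subset
      ((isOpen_chamber _).inter ((isOpen_image_chiMap hκ).preimage
        differentiable_atomMap.continuous)) ?_ ?_
    · obtain ⟨y, hy⟩ := exists_isSpectralData (n := n) hκ (t := fun _ => 1) (fun _ => one_pos)
      exact ⟨y, hy.mem_chamber, hy.mem_chamber, _, fun _ => one_pos, hy.map_eq⟩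
    · rintro y ⟨hy, hyc⟩
      refine ⟨hyc, ?_⟩
      obtain ⟨ys, hys, hlim⟩ := mem_closure_iff_seq_limit.1 hy
      choose ts hts hmap using fun m => (hys m).2
      have hdata : ∀ m, IsSpectralData κ (ts m) (ys m) := fun m =>
        isSpectralData_of_map_eq hκ (hts m) (hys m).1 (hmap m)
      have hcoord : ∀ k, Tendsto (fun m => ys m k) atTop (𝓝 (y k)) := tendsto_pi_nhds.1 hlim
      -- By the trace identity the sums of squares of the chi variables converge, so the preimages
      -- stay in a compact box and a subsequence converges.
      have hsum : Tendsto (fun m => κ * ∑ k, ts m k ^ 2) atTop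
          (𝓝 (κ * ∑ i, y (Sum.inl i) + ∑ i, y (Sum.inr i))) := by
        simp only [fun m => (hdata m).sum_sq]
        exact ((tendsto_finsetSum _ fun i _ => hcoord _).const_mul κ).add
          (tendsto_finsetSum _ fun i _ => hcoord _)
      obtain ⟨R, hR⟩ := hsum.bddAbove_range
      have hbound : ∀ m, ts m ∈ Set.Icc (0 : Fin (n + 1) ⊕ Fin (n + 1) → ℝ)
          (fun _ => R / κ + 1) := by
        intro m
        refine ⟨fun k => (hts m k).le, fun k => ?_⟩
        have h1 : κ * ∑ k, ts m k ^ 2 ≤ R := hR ⟨m, rfl⟩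
        have h2 : ts m k ^ 2 ≤ ∑ k, ts m k ^ 2 :=
          Finset.single_le_sum (f := fun k => ts m k ^ 2) (fun k _ => sq_nonneg _)
            (Finset.mem_univ k)
        have h3 : ∑ k, ts m k ^ 2 ≤ R / κ := by
          rw [le_div_iff₀ hκ, mul_comm]; exact h1
        have h4 := hts m k
        nlinarith [sq_nonneg (ts m k - 1)]
      obtain ⟨t, ht, σ, hσ, htlim⟩ := isCompact_Icc.tendsto_subseq hbound
      have hylim := hlim.comp hσ.tendsto_atTop
      have hycoord : ∀ k, Tendsto (fun m => ys (σ m) k) atTop (𝓝 (y k)) :=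
        fun k => (hcoord k).comp hσ.tendsto_atTop
      have htcoord : ∀ k, Tendsto (fun m => ts (σ m) k) atTop (𝓝 (t k)) :=
        tendsto_pi_nhds.1 htlim
      have hint : ∀ h, Tendsto (fun m => interleave (ts (σ m)) h) atTop (𝓝 (interleave t h)) :=
        fun h => ((contDiff_interleave (m := 0) h).continuous.tendsto t).comp htlim
      have heq : chiMap κ t = atomMap y := by
        refine tendsto_nhds_unique
          (((differentiable_chiMap κ).continuous.tendsto t).comp htlim) ?_
        refine (((differentiable_atomMap).continuous.tendsto y).comp hylim).congr fun m => ?_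
        exact (hmap (σ m)).symm
      have hp1 : ∏ i, y (Sum.inr i) = ∏ i, (κ * t (Sum.inr i) ^ 2) := by
        refine tendsto_nhds_unique (tendsto_finsetProd _ fun i _ => hycoord (Sum.inr i)) ?_
        refine (tendsto_finsetProd _ fun i _ => ((htcoord (Sum.inr i)).pow 2).const_mul κ).congr
          fun m => ?_
        exact (hdata (σ m)).prod_atoms.symm
      have hvcont : Continuous fun y : Fin (n + 1) ⊕ Fin (n + 1) → ℝ =>
          (Matrix.vandermonde fun i => y (Sum.inr i)).det := by
        refine Continuous.matrix_det (continuous_matrix fun i j => ?_)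
        simp only [Matrix.vandermonde_apply]
        fun_prop
      have hp2 : (∏ i, y (Sum.inl i)) * (Matrix.vandermonde fun i => y (Sum.inr i)).det ^ 2 =
          ∏ k : Fin (n + 1),
            (κ ^ (k : ℕ) * ∏ i ∈ Finset.range (2 * k + 1), interleave t i) ^ 2 := by
        refine tendsto_nhds_unique ((tendsto_finsetProd _ fun i _ => hycoord (Sum.inl i)).mul
          (((hvcont.tendsto y).comp hylim).pow 2)) ?_
        refine (tendsto_finsetProd Finset.univ fun (k : Fin (n + 1)) _ =>
          ((tendsto_finsetProd (Finset.range (2 * k + 1)) fun i _ =>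
            hint i).const_mul (κ ^ (k : ℕ))).pow 2).congr fun m => ?_
        exact (hdata (σ m)).prod_weights.symm
      -- The limit variables are a priori only nonnegative. A zero would make the product of atoms,
      -- or the product of weights times the squared Vandermonde determinant, vanish at y, which is
      -- impossible inside the chamber.
      have hne : ∀ k, t k ≠ 0 := by
        rintro (i | i) hi
        · have h1 : 0 < (∏ i, y (Sum.inl i)) *
              (Matrix.vandermonde fun i => y (Sum.inr i)).det ^ 2 :=
            mul_pos (Finset.prod_pos fun i _ => hyc.1 _)
              (sq_pos_of_ne_zero (Matrix.det_vandermonde_ne_zero_iff.2 hyc.2.injective))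
          rw [hp2] at h1
          refine h1.ne' (Finset.prod_eq_zero (Finset.mem_univ i) ?_)
          rw [Finset.prod_eq_zero (i := 2 * (i : ℕ)) (Finset.mem_range.2 (by omega))
            (by rw [← rank_inl, interleave_rank, hi])]
          ring
        · have h1 : 0 < ∏ i, y (Sum.inr i) := Finset.prod_pos fun i _ => hyc.1 _
          rw [hp1] at h1
          exact h1.ne' (Finset.prod_eq_zero (Finset.mem_univ i) (by rw [hi]; ring))
      exact ⟨t, fun k => lt_of_le_of_ne (ht.1 k) (hne k).symm, heq⟩
  rintro _ ⟨y, hy, rfl⟩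
  exact (hsub hy).2

end BetaLaguerre

namespace BetaLaguerre

/-! ### Product densities and the chi distribution -/

lemma lintegral_fin_prod_eq_prod {n : ℕ} {E : Type*} [MeasurableSpace E]
    {μ : Fin n → Measure E} [∀ i, SigmaFinite (μ i)] {f : Fin n → E → ENNReal}
    (hf : ∀ i, Measurable (f i)) :
    ∫⁻ x, ∏ i, f i (x i) ∂(Measure.pi μ) = ∏ i, ∫⁻ x, f i x ∂(μ i) := by
  induction n with
  | zero => simp
  | succ n ih =>
    have hm : Measurable fun x : Fin (n + 1) → E => ∏ i, f i (x i) :=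
      Finset.measurable_fun_prod _ fun i _ => (hf i).comp (measurable_pi_apply i)
    have hm' : Measurable fun x : Fin n → E =>
        ∏ i : Fin n, f (Fin.succAbove 0 i) (x i) :=
      Finset.measurable_fun_prod _ fun i _ => (hf _).comp (measurable_pi_apply i)
    have hprod : ∀ x : E × (Fin n → E),
        ∏ i, f i ((MeasurableEquiv.piFinSuccAbove (fun _ : Fin (n + 1) => E) 0).symm x i) =
          f 0 x.1 * ∏ i, f (Fin.succAbove 0 i) (x.2 i) := by
      intro x
      rw [Fin.prod_univ_succAbove _ 0]
      rfl
    rw [← ((measurePreserving_piFinSuccAbove μ 0).symm).lintegral_comp hm,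
      lintegral_congr hprod, lintegral_prod_mul (hf 0).aemeasurable hm'.aemeasurable,
      ih fun i => hf _, Fin.prod_univ_succAbove _ 0]

lemma lintegral_pi_prod_eq_prod {ι : Type*} [Fintype ι] {E : Type*} [MeasurableSpace E]
    {μ : ι → Measure E} [∀ i, SigmaFinite (μ i)] {f : ι → E → ENNReal}
    (hf : ∀ i, Measurable (f i)) :
    ∫⁻ x, ∏ i, f i (x i) ∂(Measure.pi μ) = ∏ i, ∫⁻ x, f i x ∂(μ i) := by
  let e := (Fintype.equivFin ι).symm
  have hm : Measurable fun x : ι → E => ∏ i, f i (x i) :=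
    Finset.measurable_fun_prod _ fun i _ => (hf i).comp (measurable_pi_apply i)
  rw [← (measurePreserving_piCongrLeft μ e).lintegral_comp hm]
  simp_rw [← e.prod_comp, MeasurableEquiv.coe_piCongrLeft]
  rw [← lintegral_fin_prod_eq_prod fun i => hf (e i)]
  refine lintegral_congr fun x => Finset.prod_congr rfl fun i _ => ?_
  rw [Equiv.piCongrLeft_apply_apply]

lemma pi_withDensity {ι : Type*} [Fintype ι] {E : Type*} [MeasurableSpace E]
    {μ : ι → Measure E} [∀ i, SigmaFinite (μ i)] {f : ι → E → ENNReal}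
    (hf : ∀ i, Measurable (f i)) [∀ i, SigmaFinite ((μ i).withDensity (f i))] :
    Measure.pi (fun i => (μ i).withDensity (f i)) =
      (Measure.pi μ).withDensity fun x => ∏ i, f i (x i) := by
  refine Measure.pi_eq fun s hs => ?_
  rw [withDensity_apply _ (MeasurableSet.univ_pi hs), ← lintegral_indicator (MeasurableSet.univ_pi hs)]
  have h : (Set.univ.pi s).indicator (fun x : ι → E => ∏ i, f i (x i)) =
      fun x => ∏ i, (s i).indicator (f i) (x i) := by
    funext x
    by_cases hx : x ∈ Set.univ.pi s
    · rw [Set.indicator_of_mem hx]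
      exact Finset.prod_congr rfl fun i _ => by rw [Set.indicator_of_mem (hx i trivial)]
    · rw [Set.indicator_of_notMem hx]
      have h1 : ∃ i, x i ∉ s i := by simpa [Set.mem_pi] using hx
      obtain ⟨i, hi⟩ := h1
      exact (Finset.prod_eq_zero (Finset.mem_univ i) (Set.indicator_of_notMem hi _)).symm
  rw [h, lintegral_pi_prod_eq_prod fun i => (hf i).indicator (hs i)]
  exact Finset.prod_congr rfl fun i _ => by
    rw [lintegral_indicator (hs i), withDensity_apply _ (hs i)]

/-- The density of the chi distribution. -/
noncomputable def chiPdf (k x : ℝ) : ℝ :=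
  if 0 < x then
    1 / ((2 : ℝ) ^ (k / 2 - 1) * Real.Gamma (k / 2)) * x ^ (k - 1) * Real.exp (-x ^ 2 / 2)
  else 0

lemma chiLaw_eq (k : ℝ) :
    chiLaw k = volume.withDensity fun x => ENNReal.ofReal (chiPdf k x) := rfl

lemma measurable_chiPdf (k : ℝ) : Measurable (chiPdf k) :=
  Measurable.ite measurableSet_Ioi (by fun_prop) measurable_const

lemma chiPdf_nonneg {k : ℝ} (hk : 0 < k) (x : ℝ) : 0 ≤ chiPdf k x := by
  rw [chiPdf]
  split_ifs with h
  · have := Real.Gamma_pos_of_pos (half_pos hk)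
    positivity
  · exact le_rfl

lemma Gamma_add_natCast {a : ℝ} (ha : 0 < a) (m : ℕ) :
    Real.Gamma (a + m) = rising a m * Real.Gamma a := by
  induction m with
  | zero => simp
  | succ m ih =>
    rw [rising_succ, Nat.cast_succ, ← add_assoc, Real.Gamma_add_one (by positivity), ih]; ring

/-- Half the square of a χ_k variable is a gamma variable of shape k/2, whose moments are rising
factorials. The case m = 0 is the normalization of the chi density. -/
lemma chiLaw_even_moment {k : ℝ} (hk : 0 < k) (m : ℕ) :
    Integrable (fun x : ℝ => (x ^ 2) ^ m) (chiLaw k) ∧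
      ∫ x, (x ^ 2) ^ m ∂(chiLaw k) = 2 ^ m * rising (k / 2) m := by
  have hG := Real.Gamma_pos_of_pos (half_pos hk)
  have h1 : (fun x : ℝ => (ENNReal.ofReal (chiPdf k x)).toReal • (x ^ 2) ^ m) =
      (Set.Ioi 0).indicator fun x : ℝ => 1 / ((2 : ℝ) ^ (k / 2 - 1) * Real.Gamma (k / 2)) *
        (x ^ (k - 1 + 2 * m) * Real.exp (-(1 / 2) * x ^ (2 : ℝ))) := by
    funext x
    rw [ENNReal.toReal_ofReal (chiPdf_nonneg hk x)]
    by_cases hx : 0 < x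
    · rw [Set.indicator_of_mem (Set.mem_Ioi.2 hx), chiPdf, if_pos hx, Real.rpow_add hx,
        smul_eq_mul, ← pow_mul]
      have e1 : x ^ (2 * (m : ℝ)) = x ^ (2 * m) := by
        rw [← Real.rpow_natCast]; push_cast; rfl
      have e2 : x ^ (2 : ℝ) = x ^ 2 := by rw [← Real.rpow_natCast]; norm_num
      have e3 : -x ^ 2 / 2 = -(1 / 2) * x ^ 2 := by ring
      rw [e1, e2, e3]
      ring
    · rw [Set.indicator_of_notMem (by simpa using hx), chiPdf, if_neg hx, zero_smul]
  have hq : -1 < k - 1 + 2 * (m : ℝ) := by have : (0 : ℝ) ≤ m := by positivity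
                                           linarith
  have hint : IntegrableOn (fun x : ℝ => 1 / ((2 : ℝ) ^ (k / 2 - 1) * Real.Gamma (k / 2)) *
      (x ^ (k - 1 + 2 * m) * Real.exp (-(1 / 2) * x ^ (2 : ℝ)))) (Set.Ioi 0) :=
    (integrableOn_rpow_mul_exp_neg_mul_rpow hq (by norm_num) (by norm_num)).const_mul _
  constructor
  · rw [chiLaw_eq, integrable_withDensity_iff_integrable_smul' (measurable_chiPdf k).ennreal_ofReal
      (ae_of_all _ fun _ => ENNReal.ofReal_lt_top), h1]
    exact hint.integrable_indicator measurableSet_Ioi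
  · rw [chiLaw_eq, integral_withDensity_eq_integral_toReal_smul (measurable_chiPdf k).ennreal_ofReal
      (ae_of_all _ fun _ => ENNReal.ofReal_lt_top), h1, integral_indicator measurableSet_Ioi,
      integral_const_mul, integral_rpow_mul_exp_neg_mul_rpow (by norm_num) hq (by norm_num)]
    have e1 : (k - 1 + 2 * (m : ℝ) + 1) / 2 = k / 2 + m := by ring
    have e2 : -(k - 1 + 2 * (m : ℝ) + 1) / 2 = -(k / 2 + m) := by ring
    have e3 : (1 / 2 : ℝ) ^ (-(k / 2 + m)) = 2 ^ (k / 2 - 1) * 2 * 2 ^ m := by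
      rw [one_div, Real.inv_rpow (by norm_num), Real.rpow_neg (by norm_num), inv_inv,
        ← Real.rpow_natCast 2 m, Real.rpow_sub_one (by norm_num), Real.rpow_add (by norm_num)]
      field_simp
    rw [e1, e2, e3, Gamma_add_natCast (half_pos hk)]
    have : (2 : ℝ) ^ (k / 2 - 1) ≠ 0 := by positivity
    field_simp

lemma isProbabilityMeasure_chiLaw {k : ℝ} (hk : 0 < k) : IsProbabilityMeasure (chiLaw k) := by
  have h := (chiLaw_even_moment hk 0)
  simp only [pow_zero, rising_zero, integral_const, smul_eq_mul, mul_one] at h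
  have hfin : IsFiniteMeasure (chiLaw k) := by
    rcases integrable_const_iff.1 h.1 with h0 | h0
    · exact absurd h0 one_ne_zero
    · exact h0
  exact isProbabilityMeasure_iff_real.2 h.2

end BetaLaguerre

namespace BetaLaguerre

/-! ### The densities in the two coordinate systems -/

/-- The degrees of freedom of the chi variables. -/
def dof (N : ℕ) (M β : ℝ) : Fin N ⊕ Fin N → ℝ :=
  Sum.elim (fun i => β * (N - (i : ℕ))) fun i => β * (M - (i : ℕ))

lemma dof_pos {N : ℕ} {M β : ℝ} (hβ : 0 < β) (hM : (N : ℝ) - 1 < M) (k : Fin N ⊕ Fin N) :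
    0 < dof N M β k := by
  rcases k with i | i
  · refine mul_pos hβ (sub_pos.2 (by exact_mod_cast i.2))
  · have : ((i : ℕ) : ℝ) + 1 ≤ N := by exact_mod_cast i.2
    exact mul_pos hβ (by linarith)

/-- The unnormalized density of a gamma distribution. -/
noncomputable def gammaWeight (β x : ℝ) : ℝ :=
  if 0 < x then x ^ (β / 2 - 1) * Real.exp (-x / 2) else 0

lemma measurable_gammaWeight (β : ℝ) : Measurable (gammaWeight β) :=
  Measurable.ite measurableSet_Ioi (by fun_prop) measurable_const

lemma gammaWeight_nonneg (β x : ℝ) : 0 ≤ gammaWeight β x := by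
  rw [gammaWeight]; split_ifs <;> positivity

/-- The unnormalized joint density of weights and atoms. -/
noncomputable def atomWeight (N : ℕ) (M β : ℝ) (y : Fin N ⊕ Fin N → ℝ) : ℝ :=
  (∏ i, gammaWeight β (y (Sum.inl i))) * laguerreWeight N M β fun i => y (Sum.inr i)

/-- Double counting: x h appears once for each k with 2k ≥ h. The multiplicities N - i and N - 1 - i
are what produces the degrees of freedom of the chi variables from the Vandermonde factor. -/
lemma sum_sum_range_two_mul_add_one (N : ℕ) (x : ℕ → ℝ) :
    ∑ k ∈ Finset.range N, ∑ h ∈ Finset.range (2 * k + 1), x h =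
      ∑ i ∈ Finset.range N, (((N : ℝ) - i) * x (2 * i) + ((N : ℝ) - 1 - i) * x (2 * i + 1)) := by
  induction N with
  | zero => simp
  | succ N ih =>
    have h1 : ∀ m, ∑ i ∈ Finset.range m, (x (2 * i) + x (2 * i + 1)) =
        ∑ h ∈ Finset.range (2 * m), x h := by
      intro m
      induction m with
      | zero => simp
      | succ m ih =>
        rw [Finset.sum_range_succ, ih, Nat.mul_succ, Finset.sum_range_succ, Finset.sum_range_succ,
          add_assoc]
    rw [Finset.sum_range_succ, ih, Finset.sum_range_succ, ← h1, ← add_assoc,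
      ← Finset.sum_add_distrib, Finset.sum_range_succ]
    push_cast
    have h2 : ((N : ℝ) + 1 - N) * x (2 * N) + ((N : ℝ) + 1 - 1 - N) * x (2 * N + 1) =
        x (2 * N) := by ring
    rw [h2]
    congr 1
    exact Finset.sum_congr rfl fun i _ => by ring

variable {n : ℕ}

lemma log_prod_chiPdf {ι : Type*} [Fintype ι] {p t : ι → ℝ} (hp : ∀ k, 0 < p k)
    (ht : ∀ k, 0 < t k) :
    Real.log (∏ k, chiPdf (p k) (t k)) =
      ∑ k, Real.log (1 / ((2 : ℝ) ^ (p k / 2 - 1) * Real.Gamma (p k / 2))) +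
        ∑ k, p k * Real.log (t k) - ∑ k, Real.log (t k) - (∑ k, t k ^ 2) / 2 := by
  have hG : ∀ k, 0 < 1 / ((2 : ℝ) ^ (p k / 2 - 1) * Real.Gamma (p k / 2)) := fun k => by
    have := Real.Gamma_pos_of_pos (half_pos (hp k))
    positivity
  rw [Real.log_prod fun k _ => ?_, ← Finset.sum_add_distrib, ← Finset.sum_sub_distrib,
    Finset.sum_div, ← Finset.sum_sub_distrib]
  · refine Finset.sum_congr rfl fun k _ => ?_
    have h1 := Real.rpow_pos_of_pos (ht k) (p k - 1)
    rw [chiPdf, if_pos (ht k), Real.log_mul (mul_pos (hG k) h1).ne' (Real.exp_pos _).ne',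
      Real.log_mul (hG k).ne' h1.ne', Real.log_exp, Real.log_rpow (ht k)]
    ring
  · rw [chiPdf, if_pos (ht k)]
    exact (mul_pos (mul_pos (hG k) (Real.rpow_pos_of_pos (ht k) _)) (Real.exp_pos _)).ne'

lemma laguerreWeight_of_pos {N : ℕ} {M β : ℝ} {l : Fin N → ℝ} (hl : ∀ i, 0 < l i) :
    laguerreWeight N M β l = |(Matrix.vandermonde l).det| ^ β *
      ∏ i, (l i ^ (β / 2 * (M - N + 1) - 1) * Real.exp (-(β * M / 2) * l i)) := by
  rw [laguerreWeight, if_pos hl, Matrix.det_vandermonde, Finset.abs_prod,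
    ← Real.finsetProd_rpow _ _ fun i _ => abs_nonneg _]
  congr 1
  refine Finset.prod_congr rfl fun i _ => ?_
  rw [Finset.abs_prod, ← Real.finsetProd_rpow _ _ fun i _ => abs_nonneg _]

lemma atomWeight_pos {N : ℕ} {M β : ℝ} {y : Fin N ⊕ Fin N → ℝ} (hy : y ∈ chamber N) :
    0 < atomWeight N M β y := by
  have hV := Matrix.det_vandermonde_ne_zero_iff.2 hy.2.injective
  rw [atomWeight, laguerreWeight_of_pos fun i => hy.1 _]
  refine mul_pos (Finset.prod_pos fun i _ => ?_) (mul_pos (Real.rpow_pos_of_pos (abs_pos.2 hV) _)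
    (Finset.prod_pos fun i _ => mul_pos (Real.rpow_pos_of_pos (hy.1 _) _) (Real.exp_pos _)))
  rw [gammaWeight, if_pos (hy.1 _)]
  exact mul_pos (Real.rpow_pos_of_pos (hy.1 _) _) (Real.exp_pos _)

lemma log_atomWeight {N : ℕ} {M β : ℝ} {y : Fin N ⊕ Fin N → ℝ} (hy : y ∈ chamber N) :
    Real.log (atomWeight N M β y) =
      β / 2 * Real.log ((∏ i, y (Sum.inl i)) *
        (Matrix.vandermonde fun i => y (Sum.inr i)).det ^ 2) -
      Real.log (∏ i, y (Sum.inl i)) +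
      (β / 2 * (M - N + 1) - 1) * Real.log (∏ i, y (Sum.inr i)) -
      (∑ i, y (Sum.inl i) + β * M * ∑ i, y (Sum.inr i)) / 2 := by
  have hV := Matrix.det_vandermonde_ne_zero_iff.2 hy.2.injective
  have hVp := Real.rpow_pos_of_pos (abs_pos.2 hV) β
  have hl : ∀ i, 0 < y (Sum.inr i) ^ (β / 2 * (M - N + 1) - 1) *
      Real.exp (-(β * M / 2) * y (Sum.inr i)) :=
    fun i => mul_pos (Real.rpow_pos_of_pos (hy.1 _) _) (Real.exp_pos _)
  have hw : ∀ i, gammaWeight β (y (Sum.inl i)) =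
      y (Sum.inl i) ^ (β / 2 - 1) * Real.exp (-y (Sum.inl i) / 2) := fun i => if_pos (hy.1 _)
  have hw' : ∀ i, 0 < gammaWeight β (y (Sum.inl i)) := fun i => by
    rw [hw]; exact mul_pos (Real.rpow_pos_of_pos (hy.1 _) _) (Real.exp_pos _)
  have hwp : 0 < ∏ i, y (Sum.inl i) := Finset.prod_pos fun i _ => hy.1 _
  rw [atomWeight, laguerreWeight_of_pos fun i => hy.1 _,
    Real.log_mul (Finset.prod_pos fun i _ => hw' i).ne'
      (mul_pos hVp (Finset.prod_pos fun i _ => hl i)).ne',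
    Real.log_mul hVp.ne' (Finset.prod_pos fun i _ => hl i).ne',
    Real.log_prod fun i _ => (hw' i).ne', Real.log_prod fun i _ => (hl i).ne',
    Real.log_rpow (abs_pos.2 hV), Real.log_abs, Real.log_mul hwp.ne' (pow_ne_zero 2 hV),
    Real.log_pow, Real.log_prod fun i _ => (hy.1 (Sum.inl i)).ne',
    Real.log_prod fun i _ => (hy.1 (Sum.inr i)).ne']
  have e1 : ∑ i, Real.log (gammaWeight β (y (Sum.inl i))) =
      (β / 2 - 1) * ∑ i, Real.log (y (Sum.inl i)) - (∑ i, y (Sum.inl i)) / 2 := by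
    rw [Finset.mul_sum, Finset.sum_div, ← Finset.sum_sub_distrib]
    refine Finset.sum_congr rfl fun i _ => ?_
    rw [hw, Real.log_mul (Real.rpow_pos_of_pos (hy.1 _) _).ne' (Real.exp_pos _).ne',
      Real.log_rpow (hy.1 _), Real.log_exp]
    ring
  have e2 : ∑ i, Real.log (y (Sum.inr i) ^ (β / 2 * (M - N + 1) - 1) *
      Real.exp (-(β * M / 2) * y (Sum.inr i))) =
      (β / 2 * (M - N + 1) - 1) * ∑ i, Real.log (y (Sum.inr i)) -
        β * M / 2 * ∑ i, y (Sum.inr i) := by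
    rw [Finset.mul_sum, Finset.mul_sum, ← Finset.sum_sub_distrib]
    refine Finset.sum_congr rfl fun i _ => ?_
    rw [Real.log_mul (Real.rpow_pos_of_pos (hy.1 _) _).ne' (Real.exp_pos _).ne',
      Real.log_rpow (hy.1 _), Real.log_exp]
    ring
  rw [e1, e2]
  push_cast
  ring

/-- The logarithm of the Jacobian determinant of `chiMap`. -/
lemma log_det_fderiv_chiMap {N : ℕ} {κ : ℝ} (hκ : 0 < κ) {t : Fin N ⊕ Fin N → ℝ}
    (ht : ∀ k, 0 < t k) :
    Real.log (fderiv ℝ (chiMap κ) t).det =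
      ∑ k : Fin N ⊕ Fin N, ((rank k : ℝ) * Real.log κ + Real.log 2) +
      4 * ∑ k : Fin N, ∑ h ∈ Finset.range (2 * (k : ℕ) + 1), Real.log (interleave t h) -
      ∑ i, Real.log (t (Sum.inl i)) + ∑ i, Real.log (t (Sum.inr i)) := by
  have hs : ∀ h < 2 * N, 0 < interleave t h := fun h hh => by
    obtain ⟨j, rfl⟩ := exists_rank_eq hh
    rw [interleave_rank]
    exact ht j
  have hp : ∀ k : Fin N ⊕ Fin N, 0 < ∏ i ∈ Finset.range (rank k), interleave t i := fun k =>
    Finset.prod_pos fun i hi => hs i ((Finset.mem_range.1 hi).trans (rank_lt k))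
  have h1 : ∀ k : Fin N ⊕ Fin N,
      Real.log (κ ^ rank k * (∏ i ∈ Finset.range (rank k), interleave t i) ^ 2 * (2 * t k)) =
      ((rank k : ℝ) * Real.log κ + Real.log 2) +
        (2 * ∑ i ∈ Finset.range (rank k), Real.log (interleave t i) + Real.log (t k)) := by
    intro k
    rw [Real.log_mul (mul_pos (pow_pos hκ _) (pow_pos (hp k) 2)).ne'
      (mul_pos two_pos (ht k)).ne', Real.log_mul (pow_pos hκ _).ne' (pow_pos (hp k) 2).ne',
      Real.log_mul two_ne_zero (ht k).ne', Real.log_pow, Real.log_pow,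
      Real.log_prod fun i hi => (hs i ((Finset.mem_range.1 hi).trans (rank_lt k))).ne']
    push_cast
    ring
  rw [det_fderiv_chiMap, Real.log_prod fun k _ => (mul_pos (mul_pos (pow_pos hκ _)
    (pow_pos (hp k) 2)) (mul_pos two_pos (ht k))).ne']
  simp only [h1]
  rw [Finset.sum_add_distrib, add_sub_assoc, add_assoc]
  congr 1
  rw [Fintype.sum_sum_type, Finset.mul_sum, ← Finset.sum_sub_distrib, ← Finset.sum_add_distrib,
    ← Finset.sum_add_distrib]
  refine Finset.sum_congr rfl fun i _ => ?_
  have e1 : interleave t (2 * i) = t (Sum.inl i) := interleave_rank t (Sum.inl i)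
  rw [rank_inl, rank_inr, Finset.sum_range_succ, e1]
  ring

/-- Equality of the two densities of the moment vector, cleared of denominators. The product of
weights times the squared Vandermonde determinant and the product of atoms are monomials in the chi
variables, and the quadratic exponents agree by the trace identity. What remains is a comparison of
exponents, made linear by taking logarithms. -/
lemma chiPdf_mul_det_eq {M β : ℝ} (hβ : 0 < β) (hM : (n : ℝ) < M) :
    ∃ K : ℝ, 0 < K ∧ ∀ t y : Fin (n + 1) ⊕ Fin (n + 1) → ℝ, (∀ k, 0 < t k) →
      IsSpectralData (1 / (β * M)) t y →
      (∏ k, chiPdf (dof (n + 1) M β k) (t k)) * (fderiv ℝ atomMap y).det =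
        K * (fderiv ℝ (chiMap (1 / (β * M))) t).det * atomWeight (n + 1) M β y := by
  have hM0 : 0 < M := lt_of_le_of_lt (Nat.cast_nonneg n) hM
  have hβM : 0 < β * M := mul_pos hβ hM0
  set κ := 1 / (β * M) with hκdef
  have hκ : 0 < κ := by positivity
  have hdof : ∀ k, 0 < dof (n + 1) M β k :=
    dof_pos hβ (by push_cast; linarith)
  let c0 := ∑ k, Real.log (1 / ((2 : ℝ) ^ (dof (n + 1) M β k / 2 - 1) *
    Real.Gamma (dof (n + 1) M β k / 2)))
  let c1 := ∑ k : Fin (n + 1) ⊕ Fin (n + 1), ((rank k : ℝ) * Real.log κ + Real.log 2)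
  let c2 := ∑ k : Fin (n + 1), 2 * (((k : ℕ) : ℝ) * Real.log κ)
  let c3 := ∑ _k : Fin (n + 1), Real.log κ
  let e := β / 2 * (M - (n + 1 : ℕ) + 1) - 1
  -- The constant gathers the chi normalizations together with the powers of κ and 2 coming from the
  -- Jacobian and from the product formulas.
  refine ⟨Real.exp (c0 + 2 * c2 - c1 - β / 2 * c2 - e * c3), Real.exp_pos _, fun t y ht hd => ?_⟩
  have hy := hd.mem_chamber
  have hs : ∀ h < 2 * (n + 1), 0 < interleave t h := fun h hh => by
    obtain ⟨j, rfl⟩ := exists_rank_eq hh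
    rw [interleave_rank]
    exact ht j
  have hwp : 0 < ∏ i, y (Sum.inl i) := Finset.prod_pos fun i _ => hy.1 _
  have hV := Matrix.det_vandermonde_ne_zero_iff.2 hy.2.injective
  have hPpos : 0 < (∏ i, y (Sum.inl i)) *
      (Matrix.vandermonde fun i => y (Sum.inr i)).det ^ 2 := mul_pos hwp (sq_pos_of_ne_zero hV)
  -- Written through the quantity of the product formula, the determinant leaves one inverse product
  -- of weights, which cancels the one in `log_atomWeight`.
  have hdetA : (fderiv ℝ atomMap y).det = ((∏ i, y (Sum.inl i)) *
      (Matrix.vandermonde fun i => y (Sum.inr i)).det ^ 2) ^ 2 / ∏ i, y (Sum.inl i) := by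
    rw [det_fderiv_atomMap]
    field_simp
  have hchipos : 0 < ∏ k, chiPdf (dof (n + 1) M β k) (t k) := Finset.prod_pos fun k _ => by
    rw [chiPdf, if_pos (ht k)]
    have := Real.Gamma_pos_of_pos (half_pos (hdof k))
    have := ht k
    positivity
  have hdetC := det_fderiv_chiMap_pos hκ ht
  have hlogP : Real.log ((∏ i, y (Sum.inl i)) *
      (Matrix.vandermonde fun i => y (Sum.inr i)).det ^ 2) =
      c2 + 2 * ∑ k : Fin (n + 1),
        ∑ h ∈ Finset.range (2 * (k : ℕ) + 1), Real.log (interleave t h) := by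
    have hp : ∀ k : Fin (n + 1), 0 < ∏ i ∈ Finset.range (2 * (k : ℕ) + 1), interleave t i :=
      fun k => Finset.prod_pos fun i hi => hs i (by have := Finset.mem_range.1 hi; omega)
    rw [hd.prod_weights, Real.log_prod fun k _ => (pow_pos (mul_pos (pow_pos hκ _) (hp k)) 2).ne',
      Finset.mul_sum, ← Finset.sum_add_distrib]
    refine Finset.sum_congr rfl fun k _ => ?_
    rw [Real.log_pow, Real.log_mul (pow_pos hκ _).ne' (hp k).ne', Real.log_pow,
      Real.log_prod fun i hi => (hs i (by have := Finset.mem_range.1 hi; omega)).ne']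
    push_cast
    ring
  have hlogQ : Real.log (∏ i, y (Sum.inr i)) = c3 + 2 * ∑ i, Real.log (t (Sum.inr i)) := by
    rw [hd.prod_atoms, Real.log_prod fun k _ => (mul_pos hκ (pow_pos (ht _) 2)).ne',
      Finset.mul_sum, ← Finset.sum_add_distrib]
    refine Finset.sum_congr rfl fun k _ => ?_
    rw [Real.log_mul hκ.ne' (pow_pos (ht _) 2).ne', Real.log_pow]
    push_cast
    ring
  have hS : ∑ k, dof (n + 1) M β k * Real.log (t k) =
      β * ∑ k : Fin (n + 1), ∑ h ∈ Finset.range (2 * (k : ℕ) + 1), Real.log (interleave t h) +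
        β * (M - (n + 1 : ℕ) + 1) * ∑ i, Real.log (t (Sum.inr i)) := by
    rw [← Finset.sum_range fun k => ∑ h ∈ Finset.range (2 * k + 1), Real.log (interleave t h),
      sum_sum_range_two_mul_add_one, Finset.sum_range, Fintype.sum_sum_type, Finset.mul_sum,
      Finset.mul_sum, ← Finset.sum_add_distrib, ← Finset.sum_add_distrib]
    refine Finset.sum_congr rfl fun i _ => ?_
    have e1 : interleave t (2 * i) = t (Sum.inl i) := interleave_rank t (Sum.inl i)
    have e2 : interleave t (2 * i + 1) = t (Sum.inr i) := interleave_rank t (Sum.inr i)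
    rw [e1, e2]
    simp only [dof, Sum.elim_inl, Sum.elim_inr]
    ring
  have hT : ∑ k, t k ^ 2 = ∑ i, y (Sum.inl i) + β * M * ∑ i, y (Sum.inr i) := by
    have h1 := congrArg (fun x => β * M * x) hd.sum_sq
    simp only [mul_add, ← mul_assoc] at h1
    have h2 : β * M * κ = 1 := by rw [hκdef]; field_simp
    rwa [h2, one_mul, one_mul] at h1
  have hX : ∑ k, Real.log (t k) =
      ∑ i, Real.log (t (Sum.inl i)) + ∑ i, Real.log (t (Sum.inr i)) := Fintype.sum_sum_type _
  have hA := atomWeight_pos (M := M) (β := β) hy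
  have hdetApos : 0 < (fderiv ℝ atomMap y).det := by
    rw [hdetA]; exact div_pos (pow_pos hPpos 2) hwp
  refine Real.log_injOn_pos (Set.mem_Ioi.2 (mul_pos hchipos hdetApos))
    (Set.mem_Ioi.2 (mul_pos (mul_pos (Real.exp_pos _) hdetC) hA)) ?_
  rw [Real.log_mul hchipos.ne' hdetApos.ne', Real.log_mul (mul_pos (Real.exp_pos _) hdetC).ne' hA.ne',
    Real.log_mul (Real.exp_pos _).ne' hdetC.ne', Real.log_exp, log_prod_chiPdf hdof ht,
    log_atomWeight hy, log_det_fderiv_chiMap hκ ht, hdetA,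
    Real.log_div (pow_pos hPpos 2).ne' hwp.ne', Real.log_pow, hlogP, hlogQ, hS, hT, hX]
  simp only [c0, c1, e]
  push_cast
  ring

end BetaLaguerre

namespace BetaLaguerre

/-! ### Change of variables between chi variables and spectral data -/

variable {n : ℕ}

/-- Two changes of variables through the common image in moment space. The constant is uniform in
the integrand, so it can be eliminated later by inserting the constant function 1. The integrands
need not be measurable. -/
lemma exists_lintegral_pi_chiLaw_eq {M β : ℝ} (hβ : 0 < β) (hM : (n : ℝ) < M) :
    ∃ K : ENNReal, ∀ h H : (Fin (n + 1) ⊕ Fin (n + 1) → ℝ) → ENNReal,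
      (∀ t y, (∀ k, 0 < t k) → IsSpectralData (1 / (β * M)) t y → h t = H y) →
      ∫⁻ t, h t ∂(Measure.pi fun k => chiLaw (dof (n + 1) M β k)) =
        K * ∫⁻ y in chamber (n + 1), ENNReal.ofReal (atomWeight (n + 1) M β y) * H y := by
  obtain ⟨K, hK, hKeq⟩ := chiPdf_mul_det_eq hβ hM
  have hκ : 0 < 1 / (β * M) := by
    have hM0 : 0 < M := lt_of_le_of_lt (Nat.cast_nonneg n) hM
    positivity
  set κ := 1 / (β * M)
  have hdof : ∀ k, 0 < dof (n + 1) M β k := dof_pos hβ (by push_cast; linarith)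
  refine ⟨ENNReal.ofReal K, fun h H hH => ?_⟩
  set O : Set (Fin (n + 1) ⊕ Fin (n + 1) → ℝ) := {t | ∀ k, 0 < t k} with hO
  let D : (Fin (n + 1) ⊕ Fin (n + 1) → ℝ) → ℝ := fun t => ∏ k, chiPdf (dof (n + 1) M β k) (t k)
  have hD0 : ∀ t, 0 ≤ D t := fun t => Finset.prod_nonneg fun k _ => chiPdf_nonneg (hdof k) _
  let inv := Function.invFunOn (chiMap κ) O
  have hinv : ∀ t ∈ O, inv (chiMap κ t) = t := fun t ht =>
    (chiMap_injOn hκ).leftInvOn_invFunOn ht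
  -- The integrand transported to moment space, with the density of the image measure of the chi
  -- law.
  let G : (Fin (n + 1) ⊕ Fin (n + 1) → ℝ) → ENNReal := fun m =>
    ENNReal.ofReal (D (inv m) / (fderiv ℝ (chiMap κ) (inv m)).det) * h (inv m)
  have : ∀ k, IsProbabilityMeasure (chiLaw (dof (n + 1) M β k)) :=
    fun k => isProbabilityMeasure_chiLaw (hdof k)
  have : ∀ k : Fin (n + 1) ⊕ Fin (n + 1), SigmaFinite ((volume : Measure ℝ).withDensity
      fun x => ENNReal.ofReal (chiPdf (dof (n + 1) M β k) x)) := fun k => by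
    rw [← chiLaw_eq]; infer_instance
  have h1 : ∫⁻ t, h t ∂(Measure.pi fun k => chiLaw (dof (n + 1) M β k)) =
      ∫⁻ t in O, ENNReal.ofReal (D t) * h t := by
    simp only [chiLaw_eq]
    rw [pi_withDensity fun k => (measurable_chiPdf _).ennreal_ofReal,
      lintegral_withDensity_eq_lintegral_mul_non_measurable _ ?_ ?_,
      ← lintegral_indicator isOpen_pos.measurableSet]
    · refine lintegral_congr fun t => ?_
      rw [Pi.mul_apply, ← ENNReal.ofReal_prod_of_nonneg fun k _ => chiPdf_nonneg (hdof k) _]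
      by_cases ht : t ∈ O
      · rw [Set.indicator_of_mem ht]
      · rw [Set.indicator_of_notMem ht]
        have h2 : ∃ k, ¬ 0 < t k := by
          by_contra! h3
          exact ht h3
        obtain ⟨k, hk⟩ := h2
        rw [Finset.prod_eq_zero (Finset.mem_univ k) (by rw [chiPdf, if_neg hk])]
        simp
    · exact Finset.measurable_fun_prod _ fun k _ =>
        (measurable_chiPdf _).ennreal_ofReal.comp (measurable_pi_apply k)
    · exact ae_of_all _ fun t => ENNReal.prod_lt_top fun k _ => ENNReal.ofReal_lt_top
  have h2 : ∫⁻ t in O, ENNReal.ofReal (D t) * h t =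
      ∫⁻ t in O, ENNReal.ofReal |(fderiv ℝ (chiMap κ) t).det| * G (chiMap κ t) := by
    refine setLIntegral_congr_fun isOpen_pos.measurableSet fun t ht => ?_
    have hd := det_fderiv_chiMap_pos hκ ht
    simp only [G, hinv t ht]
    rw [← mul_assoc, ← ENNReal.ofReal_mul (abs_nonneg _), abs_of_pos hd, mul_div_cancel₀ _ hd.ne']
  rw [h1, h2, ← lintegral_image_eq_lintegral_abs_det_fderiv_mul volume isOpen_pos.measurableSet
    (fun t _ => (differentiable_chiMap κ t).hasFDerivAt.hasFDerivWithinAt) (chiMap_injOn hκ),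
    image_chiMap_eq hκ, lintegral_image_eq_lintegral_abs_det_fderiv_mul volume
    (isOpen_chamber _).measurableSet
    (fun t _ => (differentiable_atomMap t).hasFDerivAt.hasFDerivWithinAt) atomMap_injOn,
    ← lintegral_const_mul' _ _ ENNReal.ofReal_ne_top]
  refine setLIntegral_congr_fun (isOpen_chamber _).measurableSet fun y hy => ?_
  have hmem : atomMap y ∈ chiMap κ '' O := by
    rw [hO, image_chiMap_eq hκ]; exact Set.mem_image_of_mem _ hy
  obtain ⟨t, ht, hty⟩ := hmem
  have hdata := isSpectralData_of_map_eq hκ ht hy hty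
  have hd := det_fderiv_chiMap_pos hκ ht
  have hdA : 0 ≤ (fderiv ℝ atomMap y).det := by
    rw [det_fderiv_atomMap]
    exact mul_nonneg (Finset.prod_nonneg fun i _ => (hy.1 _).le) (by positivity)
  simp only [G, ← hty, hinv t ht]
  rw [← mul_assoc, ← mul_assoc, ← ENNReal.ofReal_mul (abs_nonneg _), ← ENNReal.ofReal_mul hK.le,
    abs_of_nonneg hdA, hH t y ht hdata]
  congr 2
  rw [← mul_div_assoc, div_eq_iff hd.ne', mul_comm, hKeq t y ht hdata]
  ring

/-! ### Symmetrization -/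

lemma laguerreWeight_of_not_pos {N : ℕ} {M β : ℝ} {l : Fin N → ℝ} (hl : ¬ ∀ i, 0 < l i) :
    laguerreWeight N M β l = 0 := by
  rw [laguerreWeight, if_neg hl]

lemma measurable_laguerreWeight (N : ℕ) (M β : ℝ) : Measurable (laguerreWeight N M β) := by
  classical
  have h : Measurable fun x : Fin N → ℝ => if ∀ i, 0 < x i then
      (∏ i, ∏ j ∈ Finset.Ioi i, |x j - x i| ^ β) *
        ∏ i, (x i ^ (β / 2 * (M - N + 1) - 1) * Real.exp (-(β * M / 2) * x i)) else 0 := by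
    refine Measurable.ite isOpen_pos.measurableSet (Measurable.mul ?_ ?_) measurable_const
    · exact Finset.measurable_fun_prod _ fun i _ => Finset.measurable_fun_prod _ fun j _ => by
        fun_prop
    · exact Finset.measurable_fun_prod _ fun i _ => by fun_prop
  convert h using 2 with x
  simp only [laguerreWeight]

lemma laguerreWeight_comp_perm {N : ℕ} {M β : ℝ} (l : Fin N → ℝ) (σ : Equiv.Perm (Fin N)) :
    laguerreWeight N M β (l ∘ σ) = laguerreWeight N M β l := by
  by_cases hl : ∀ i, 0 < l i
  · rw [laguerreWeight_of_pos (l := l ∘ σ) fun i => hl (σ i), laguerreWeight_of_pos hl]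
    congr 1
    · have h1 : Matrix.vandermonde (l ∘ σ) = (Matrix.vandermonde l).submatrix σ id := rfl
      rw [h1, Matrix.det_permute, abs_mul]
      rcases Int.units_eq_one_or (Equiv.Perm.sign σ) with h | h <;> simp [h]
    · exact Equiv.prod_comp σ fun i =>
        l i ^ (β / 2 * (M - N + 1) - 1) * Real.exp (-(β * M / 2) * l i)
  · rw [laguerreWeight_of_not_pos hl, laguerreWeight_of_not_pos]
    intro h
    exact hl fun i => by simpa using h (σ.symm i)

lemma laguerreWeight_eq_zero {N : ℕ} {M β : ℝ} (hβ : 0 < β) {l : Fin N → ℝ}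
    (hl : ¬ Function.Injective l) : laguerreWeight N M β l = 0 := by
  by_cases hp : ∀ i, 0 < l i
  · rw [laguerreWeight_of_pos hp]
    have : (Matrix.vandermonde l).det = 0 := by
      by_contra h; exact hl (Matrix.det_vandermonde_ne_zero_iff.1 h)
    rw [this, abs_zero, Real.zero_rpow hβ.ne', zero_mul]
  · exact laguerreWeight_of_not_pos hp

lemma measurableSet_strictMono (N : ℕ) : MeasurableSet {l : Fin N → ℝ | StrictMono l} := by
  have h : {l : Fin N → ℝ | StrictMono l} =
      ⋂ i : Fin N, ⋂ j : Fin N, ⋂ _ : i < j, {l | l i < l j} := by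
    ext l
    simp only [Set.mem_ofPred_eq, Set.mem_iInter]
    exact ⟨fun h i j hij => h hij, fun h i j hij => h i j hij⟩
  rw [h]
  exact MeasurableSet.iInter fun i => MeasurableSet.iInter fun j => MeasurableSet.iInter fun _ =>
    measurableSet_lt (measurable_pi_apply i) (measurable_pi_apply j)

lemma lintegral_comp_perm {ι : Type*} [Fintype ι] (f : (ι → ℝ) → ENNReal) (σ : Equiv.Perm ι) :
    ∫⁻ l : ι → ℝ, f (l ∘ σ) = ∫⁻ l, f l := by
  have h := volume_measurePreserving_piCongrLeft (fun _ : ι => ℝ) σ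
  rw [← h.lintegral_comp_emb (MeasurableEquiv.measurableEmbedding _)]
  refine lintegral_congr fun l => congrArg f ?_
  funext i
  rw [MeasurableEquiv.coe_piCongrLeft]
  exact Equiv.piCongrLeft_apply_apply (fun _ : ι => ℝ) σ l i

/-- The integral of a symmetric function vanishing on the diagonals is `N!` times its integral
over increasing configurations. -/
lemma lintegral_eq_factorial_mul {N : ℕ} {f : (Fin N → ℝ) → ENNReal} (hf : Measurable f)
    (hsymm : ∀ l (σ : Equiv.Perm (Fin N)), f (l ∘ σ) = f l)
    (hzero : ∀ l, ¬ Function.Injective l → f l = 0) :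
    ∫⁻ l, f l = (N.factorial : ENNReal) * ∫⁻ l in {l : Fin N → ℝ | StrictMono l}, f l := by
  set S : Set (Fin N → ℝ) := {l | StrictMono l}
  have hS : MeasurableSet S := measurableSet_strictMono N
  -- Exactly one permutation sorts a configuration with distinct points; the others contribute
  -- nothing.
  have h1 : ∀ l, f l = ∑ σ : Equiv.Perm (Fin N), S.indicator f (l ∘ σ) := by
    intro l
    by_cases hl : Function.Injective l
    · have hsort : l ∘ Tuple.sort l ∈ S :=
        (Tuple.monotone_sort l).strictMono_of_injective (hl.comp (Tuple.sort l).injective)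
      rw [Finset.sum_eq_single (Tuple.sort l), Set.indicator_of_mem hsort, hsymm]
      · intro σ _ hσ
        refine Set.indicator_of_notMem (fun hmem => hσ ?_) _
        have hr : l ∘ σ = l ∘ Tuple.sort l := by
          refine (StrictMono.range_inj hmem hsort).1 ?_
          rw [σ.surjective.range_comp, (Tuple.sort l).surjective.range_comp]
        exact Equiv.ext fun i => hl (congrFun hr i)
      · simp
    · rw [hzero l hl, Finset.sum_eq_zero]
      intro σ _
      rw [Set.indicator_apply_eq_zero]
      exact fun _ => by rw [hsymm, hzero l hl]
  rw [lintegral_congr h1, lintegral_finsetSum]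
  · rw [Finset.sum_congr rfl fun σ _ => lintegral_comp_perm (S.indicator f) σ,
      lintegral_indicator hS]
    simp [Fintype.card_perm]
  · intro σ _
    exact (hf.indicator hS).comp (measurable_pi_iff.2 fun i => measurable_pi_apply _)

/-- Tonelli's theorem applies because the weight density factors. Positivity of weights and atoms
need not be imposed, since the densities vanish otherwise; only the ordering of the atoms remains as
a constraint. -/
lemma lintegral_chamber_eq {N : ℕ} {M β : ℝ} {H : (Fin N ⊕ Fin N → ℝ) → ENNReal}
    (hH : Measurable H) :
    ∫⁻ y in chamber N, ENNReal.ofReal (atomWeight N M β y) * H y =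
      ∫⁻ l in {l : Fin N → ℝ | StrictMono l}, ENNReal.ofReal (laguerreWeight N M β l) *
        ∫⁻ w : Fin N → ℝ, ENNReal.ofReal (∏ i, gammaWeight β (w i)) * H (Sum.elim w l) := by
  have hS := measurableSet_strictMono N
  set S : Set (Fin N → ℝ) := {l | StrictMono l} with hSdef
  have hgw : Measurable fun w : Fin N → ℝ => ENNReal.ofReal (∏ i, gammaWeight β (w i)) :=
    (Finset.measurable_fun_prod _ fun i _ =>
      (measurable_gammaWeight β).comp (measurable_pi_apply i)).ennreal_ofReal
  have hlw := (measurable_laguerreWeight N M β).ennreal_ofReal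
  have helim : Measurable fun p : (Fin N → ℝ) × (Fin N → ℝ) =>
      (Sum.elim p.1 p.2 : Fin N ⊕ Fin N → ℝ) := by
    refine measurable_pi_iff.2 fun k => ?_
    rcases k with i | i
    · exact (measurable_pi_apply i).comp measurable_fst
    · exact (measurable_pi_apply i).comp measurable_snd
  let F : (Fin N → ℝ) × (Fin N → ℝ) → ENNReal := fun p =>
    S.indicator (fun l => ENNReal.ofReal (laguerreWeight N M β l)) p.2 *
      (ENNReal.ofReal (∏ i, gammaWeight β (p.1 i)) * H (Sum.elim p.1 p.2))
  have hF : Measurable F := ((hlw.indicator hS).comp measurable_snd).mul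
    ((hgw.comp measurable_fst).mul (hH.comp helim))
  have hsum := volume_measurePreserving_sumPiEquivProdPi (fun _ : Fin N ⊕ Fin N => ℝ)
  rw [← lintegral_indicator (isOpen_chamber N).measurableSet, ← lintegral_indicator hS]
  have h1 : ∫⁻ y, (chamber N).indicator
      (fun y => ENNReal.ofReal (atomWeight N M β y) * H y) y =
      ∫⁻ y, F (MeasurableEquiv.sumPiEquivProdPi (fun _ : Fin N ⊕ Fin N => ℝ) y) := by
    refine lintegral_congr fun y => ?_
    have hy : (Sum.elim (fun i => y (Sum.inl i)) fun i => y (Sum.inr i)) = y :=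
      Sum.elim_comp_inl_inr y
    change _ = S.indicator (fun l => ENNReal.ofReal (laguerreWeight N M β l))
      (fun i => y (Sum.inr i)) * (ENNReal.ofReal (∏ i, gammaWeight β (y (Sum.inl i))) *
        H (Sum.elim (fun i => y (Sum.inl i)) fun i => y (Sum.inr i)))
    rw [hy]
    have hnn : 0 ≤ ∏ i, gammaWeight β (y (Sum.inl i)) :=
      Finset.prod_nonneg fun i _ => gammaWeight_nonneg _ _
    by_cases hc : y ∈ chamber N
    · rw [Set.indicator_of_mem hc, Set.indicator_of_mem (show (fun i => y (Sum.inr i)) ∈ S from hc.2),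
        atomWeight, ENNReal.ofReal_mul hnn]
      ring
    · rw [Set.indicator_of_notMem hc]
      by_cases hs : (fun i => y (Sum.inr i)) ∈ S
      · rw [Set.indicator_of_mem hs]
        have h2 : ∃ k, ¬ 0 < y k := by
          by_contra! h
          exact hc ⟨h, hs⟩
        obtain ⟨k | k, hk⟩ := h2
        · rw [Finset.prod_eq_zero (Finset.mem_univ k) (if_neg hk)]
          simp
        · rw [laguerreWeight_of_not_pos fun h => hk (h k)]
          simp
      · rw [Set.indicator_of_notMem hs, zero_mul]
  rw [h1, hsum.lintegral_comp hF, Measure.volume_eq_prod, lintegral_prod_symm _ hF.aemeasurable]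
  refine lintegral_congr fun l => ?_
  have hm : Measurable fun w : Fin N → ℝ =>
      ENNReal.ofReal (∏ i, gammaWeight β (w i)) * H (Sum.elim w l) :=
    hgw.mul (hH.comp (helim.comp (measurable_id.prodMk measurable_const)))
  simp only [F]
  rw [lintegral_const_mul _ hm]
  by_cases hl : l ∈ S
  · rw [Set.indicator_of_mem hl, Set.indicator_of_mem hl]
  · rw [Set.indicator_of_notMem hl, Set.indicator_of_notMem hl, zero_mul]

/-- The normalized weights are exchangeable, hence each has mean `1 / N`. -/
lemma lintegral_gammaWeight_mul_average {N : ℕ} (β : ℝ) (a : Fin N → ENNReal) :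
    ∫⁻ w : Fin N → ℝ, ENNReal.ofReal (∏ i, gammaWeight β (w i)) *
        ((∑ i, ENNReal.ofReal (w i) * a i) / ∑ i, ENNReal.ofReal (w i)) =
      (∫⁻ w : Fin N → ℝ, ENNReal.ofReal (∏ i, gammaWeight β (w i))) * ((∑ i, a i) / N) := by
  rcases Nat.eq_zero_or_pos N with rfl | hN
  · simp
  have hgw : Measurable fun w : Fin N → ℝ => ENNReal.ofReal (∏ i, gammaWeight β (w i)) :=
    (Finset.measurable_fun_prod _ fun i _ =>
      (measurable_gammaWeight β).comp (measurable_pi_apply i)).ennreal_ofReal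
  have hsm : Measurable fun w : Fin N → ℝ => ∑ i, ENNReal.ofReal (w i) := by fun_prop
  let c : Fin N → ENNReal := fun i => ∫⁻ w : Fin N → ℝ,
    ENNReal.ofReal (∏ i, gammaWeight β (w i)) * (ENNReal.ofReal (w i) / ∑ i, ENNReal.ofReal (w i))
  have hm : ∀ i, Measurable fun w : Fin N → ℝ => ENNReal.ofReal (∏ i, gammaWeight β (w i)) *
      (ENNReal.ofReal (w i) / ∑ i, ENNReal.ofReal (w i)) := fun i =>
    hgw.mul ((measurable_pi_apply i).ennreal_ofReal.div hsm)
  -- Exchangeability, by transposing two coordinates. Since the normalized weights sum to 1, each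
  -- mean is then 1/N of the total.
  have hc : ∀ i j, c i = c j := by
    intro i j
    simp only [c]
    rw [← lintegral_comp_perm _ (Equiv.swap i j)]
    refine lintegral_congr fun w => ?_
    simp only [Function.comp_apply, Equiv.swap_apply_left]
    rw [Equiv.sum_comp (Equiv.swap i j) (fun k => ENNReal.ofReal (w k)),
      Equiv.prod_comp (Equiv.swap i j) (fun k => gammaWeight β (w k))]
  have hsum : ∑ i, c i = ∫⁻ w : Fin N → ℝ, ENNReal.ofReal (∏ i, gammaWeight β (w i)) := by
    rw [← lintegral_finsetSum _ fun i _ => hm i]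
    refine lintegral_congr fun w => ?_
    rw [← Finset.mul_sum]
    by_cases hw : ∀ i, 0 < w i
    · simp only [div_eq_mul_inv]
      rw [← Finset.sum_mul, ENNReal.mul_inv_cancel, mul_one]
      · intro h
        rw [Finset.sum_eq_zero_iff] at h
        have := h ⟨0, hN⟩ (Finset.mem_univ _)
        exact absurd (ENNReal.ofReal_eq_zero.1 this) (not_le.2 (hw _))
      · exact (ENNReal.sum_lt_top.2 fun i _ => ENNReal.ofReal_lt_top).ne
    · push Not at hw
      obtain ⟨i, hi⟩ := hw
      rw [Finset.prod_eq_zero (Finset.mem_univ i) (if_neg (not_lt.2 hi))]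
      simp
  have hci : ∀ i, c i = (∫⁻ w : Fin N → ℝ, ENNReal.ofReal (∏ i, gammaWeight β (w i))) / N := by
    intro i
    rw [← hsum, Finset.sum_congr rfl fun j _ => hc j i, Finset.sum_const, Finset.card_univ,
      Fintype.card_fin, nsmul_eq_mul, mul_comm, ENNReal.mul_div_cancel_right]
    · exact_mod_cast hN.ne'
    · exact ENNReal.natCast_ne_top N
  have h1 : ∀ w : Fin N → ℝ, ENNReal.ofReal (∏ i, gammaWeight β (w i)) *
      ((∑ i, ENNReal.ofReal (w i) * a i) / ∑ i, ENNReal.ofReal (w i)) =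
      ∑ i, ENNReal.ofReal (∏ i, gammaWeight β (w i)) *
        (ENNReal.ofReal (w i) / ∑ i, ENNReal.ofReal (w i)) * a i := by
    intro w
    rw [div_eq_mul_inv, Finset.sum_mul, Finset.mul_sum]
    exact Finset.sum_congr rfl fun i _ => by rw [div_eq_mul_inv]; ring
  rw [lintegral_congr h1, lintegral_finsetSum _ fun i _ => (hm i).mul_const _]
  rw [Finset.sum_congr rfl fun i _ => lintegral_mul_const (a i) (hm i), div_eq_mul_inv, Finset.sum_mul, Finset.mul_sum]
  refine Finset.sum_congr rfl fun i _ => ?_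
  rw [show (∫⁻ w : Fin N → ℝ, ENNReal.ofReal (∏ i, gammaWeight β (w i)) *
    (ENNReal.ofReal (w i) / ∑ i, ENNReal.ofReal (w i))) = c i from rfl, hci, div_eq_mul_inv]
  ring

end BetaLaguerre

namespace BetaLaguerre

/-! ### Moments of the chi variables -/

variable {n : ℕ}

lemma isProbabilityMeasure_chiLaw_dof {N : ℕ} {M β : ℝ} (hβ : 0 < β) (hM : (N : ℝ) - 1 < M)
    (k : Fin N ⊕ Fin N) : IsProbabilityMeasure (chiLaw (dof N M β k)) :=
  isProbabilityMeasure_chiLaw (dof_pos hβ hM k)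

lemma prod_rank {A : Type*} [CommMonoid A] (N : ℕ) (f : ℕ → A) :
    ∏ k : Fin N ⊕ Fin N, f (rank k) = ∏ d ∈ Finset.range (2 * N), f d :=
  sum_rank (A := Additive A) N f

/-- The degrees of freedom of the chi variable at position `d` of the sequence `interleave`. -/
noncomputable def seqDof (N : ℕ) (M β : ℝ) (d : ℕ) : ℝ :=
  if Even d then β * (N - (d / 2 : ℕ)) else β * (M - (d / 2 : ℕ))

lemma seqDof_rank (N : ℕ) (M β : ℝ) (k : Fin N ⊕ Fin N) : seqDof N M β (rank k) = dof N M β k := by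
  rcases k with i | i
  · simp [seqDof, dof]
  · have h : (2 * (i : ℕ) + 1) / 2 = i := by omega
    simp [seqDof, dof, h]

/-- The moments of half the squares of the chi variables `1, 2, …`, continued by zeros. -/
noncomputable def chiSqMoment (N : ℕ) (M β : ℝ) (j m : ℕ) : ℝ :=
  if j + 1 < 2 * N then rising (seqDof N M β (j + 1) / 2) m else 0 ^ m

/-- By independence the expectation of a monomial is a product of gamma moments. Monomials reaching
beyond the last variable vanish on both sides. -/
lemma integral_eval_halfSq {N : ℕ} {M β : ℝ} (hβ : 0 < β) (hM : (N : ℝ) - 1 < M)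
    (P : MvPolynomial ℕ ℝ) :
    Integrable (fun t => MvPolynomial.eval (fun j => interleave t (j + 1) ^ 2 / 2) P)
        (Measure.pi fun k => chiLaw (dof N M β k)) ∧
      ∫ t, MvPolynomial.eval (fun j => interleave t (j + 1) ^ 2 / 2) P
        ∂(Measure.pi fun k => chiLaw (dof N M β k)) = expect (chiSqMoment N M β) P := by
  have hprob := isProbabilityMeasure_chiLaw_dof hβ hM
  induction P using MvPolynomial.induction_on' with
  | add p q hp hq =>
    simp only [map_add]
    exact ⟨hp.1.add hq.1, by rw [integral_add hp.1 hq.1, hp.2, hq.2]⟩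
  | monomial m a =>
    simp only [MvPolynomial.eval_monomial, expect_monomial]
    by_cases hm : ∀ j ∈ m.support, j + 1 < 2 * N
    -- The variable of rank 0 is auxiliary and does not enter the polynomial, so its factor is 1 and
    -- the other indices move down by one.
    · let f : ℕ → ℝ → ℝ := fun d x => if d = 0 then 1 else (x ^ 2 / 2) ^ m (d - 1)
      have hf : ∀ k : Fin N ⊕ Fin N, Integrable (f (rank k)) (chiLaw (dof N M β k)) ∧
          ∫ x, f (rank k) x ∂(chiLaw (dof N M β k)) =
            if rank k = 0 then 1 else chiSqMoment N M β (rank k - 1) (m (rank k - 1)) := by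
        intro k
        have := hprob k
        by_cases hk : rank k = 0
        · simp [f, hk]
        · have h1 := chiLaw_even_moment (dof_pos hβ hM k) (m (rank k - 1))
          have h2 : rank k - 1 + 1 = rank k := by omega
          simp only [f, if_neg hk, div_pow, chiSqMoment, h2, if_pos (rank_lt k), seqDof_rank]
          refine ⟨h1.1.div_const _, ?_⟩
          rw [integral_div, h1.2]
          field_simp
      have hsub : ∀ g : ℕ → ℕ → ℝ, (∀ j, g j 0 = 1) → (m.prod g) =
          ∏ k : Fin N ⊕ Fin N, if rank k = 0 then 1 else g (rank k - 1) (m (rank k - 1)) := by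
        intro g hg
        rw [prod_rank N fun d => if d = 0 then 1 else g (d - 1) (m (d - 1))]
        rcases Nat.eq_zero_or_pos N with rfl | hN
        · have : m.support = ∅ := by
            refine Finset.eq_empty_of_forall_notMem fun j hj => ?_
            have := hm j hj
            omega
          simp [Finsupp.prod, this]
        obtain ⟨D, hD⟩ : ∃ D, 2 * N = D + 1 := ⟨2 * N - 1, by omega⟩
        rw [hD, Finset.prod_range_succ']
        simp only [Nat.succ_ne_zero, if_false, if_true, mul_one, Nat.add_sub_cancel]
        refine Finset.prod_subset (fun j hj => Finset.mem_range.2 ?_) fun j _ hj => ?_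
        · have := hm j hj; omega
        · rw [Finsupp.notMem_support_iff.1 hj, hg]
      have h1 : (fun t : Fin N ⊕ Fin N → ℝ =>
          a * m.prod fun j e => (interleave t (j + 1) ^ 2 / 2) ^ e) =
          fun t => a * ∏ k, f (rank k) (t k) := by
        funext t
        rw [hsub _ fun j => pow_zero _]
        congr 1
        refine Finset.prod_congr rfl fun k _ => ?_
        by_cases hk : rank k = 0
        · simp [f, hk]
        · have h2 : rank k - 1 + 1 = rank k := by omega
          simp only [f, if_neg hk, h2, interleave_rank]
      rw [h1]
      refine ⟨(Integrable.fintype_prod fun k => (hf k).1).const_mul a, ?_⟩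
      rw [integral_const_mul, integral_fintype_prod_eq_prod, hsub]
      · congr 1
        exact Finset.prod_congr rfl fun k _ => (hf k).2
      · intro j
        rw [chiSqMoment]
        split_ifs <;> simp
    · push Not at hm
      obtain ⟨j, hj, hj2⟩ := hm
      have hmj : m j ≠ 0 := Finsupp.mem_support_iff.1 hj
      have h1 : ∀ t : Fin N ⊕ Fin N → ℝ,
          (m.prod fun j e => (interleave t (j + 1) ^ 2 / 2) ^ e) = 0 := fun t =>
        Finset.prod_eq_zero hj (by simp [interleave_of_le t hj2, hmj])
      have h2 : m.prod (chiSqMoment N M β) = 0 :=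
        Finset.prod_eq_zero hj (by rw [chiSqMoment, if_neg (not_lt.2 hj2), zero_pow hmj])
      simp [h1, h2]

lemma stieltjes_eq_eval (r : ℕ) (z : ℕ → ℝ) :
    stieltjes r z = MvPolynomial.eval z (stieltjes r MvPolynomial.X) := by
  rw [map_stieltjes]
  simp

lemma integral_jacobiFin_pow_zero_zero {M β : ℝ} (hβ : 0 < β) (hM : (n : ℝ) < M) (r : ℕ) :
    Integrable (fun t => (jacobiFin (n + 1) (1 / (β * M)) (interleave t) ^ r) 0 0)
        (Measure.pi fun k => chiLaw (dof (n + 1) M β k)) ∧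
      ∫ t, (jacobiFin (n + 1) (1 / (β * M)) (interleave t) ^ r) 0 0
        ∂(Measure.pi fun k => chiLaw (dof (n + 1) M β k)) =
        (2 / (β * M)) ^ r * expect (chiSqMoment (n + 1) M β) (stieltjes r MvPolynomial.X) := by
  have h := integral_eval_halfSq (N := n + 1) hβ (by push_cast; linarith)
    (stieltjes r MvPolynomial.X)
  have h1 : ∀ t : Fin (n + 1) ⊕ Fin (n + 1) → ℝ,
      (jacobiFin (n + 1) (1 / (β * M)) (interleave t) ^ r) 0 0 = (2 / (β * M)) ^ r *
        MvPolynomial.eval (fun j => interleave t (j + 1) ^ 2 / 2) (stieltjes r MvPolynomial.X) := by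
    intro t
    rw [jacobiFin_pow_zero_zero (interleave_of_le t le_rfl), ← stieltjes_eq_eval, ← stieltjes_mul]
    congr 1
    funext j
    ring
  simp only [h1]
  exact ⟨h.1.const_mul _, by rw [integral_const_mul, h.2]⟩

/-! ### Comparison of the three expectations -/

lemma posSemidef_jacobiFin (N : ℕ) {κ : ℝ} (hκ : 0 ≤ κ) (t : ℕ → ℝ) :
    (jacobiFin N κ t).PosSemidef := by
  have := Matrix.posSemidef_self_mul_conjTranspose (bidiagFin N t)
  rw [Matrix.conjTranspose_eq_transpose_of_trivial] at this
  exact this.smul hκ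

/-- In spectral coordinates the trace depends on the atoms only, while the corner entry averages the
atoms with weights independent of them and of mean 1/N. Working with nonnegative integrals avoids
any integrability question at this stage. -/
lemma lintegral_average_eq {M β : ℝ} (hβ : 0 < β) (hM : (n : ℝ) < M) (r : ℕ) :
    ∫⁻ t, ENNReal.ofReal ((jacobiFin (n + 1) (1 / (β * M)) (interleave t) ^ r) 0 0)
        ∂(Measure.pi fun k => chiLaw (dof (n + 1) M β k)) =
      ∫⁻ t, ENNReal.ofReal
          (1 / ((n + 1 : ℕ) : ℝ) * (jacobiFin (n + 1) (1 / (β * M)) (interleave t) ^ r).trace)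
        ∂(Measure.pi fun k => chiLaw (dof (n + 1) M β k)) ∧
    ∫⁻ l, (∑ i, ENNReal.ofReal (l i) ^ r) / ((n + 1 : ℕ) : ENNReal)
        ∂(laguerreEnsemble (n + 1) M β) =
      ∫⁻ t, ENNReal.ofReal
          (1 / ((n + 1 : ℕ) : ℝ) * (jacobiFin (n + 1) (1 / (β * M)) (interleave t) ^ r).trace)
        ∂(Measure.pi fun k => chiLaw (dof (n + 1) M β k)) := by
  have hprob : ∀ k, IsProbabilityMeasure (chiLaw (dof (n + 1) M β k)) :=
    isProbabilityMeasure_chiLaw_dof hβ (by push_cast; linarith)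
  obtain ⟨K, hK⟩ := exists_lintegral_pi_chiLaw_eq hβ hM
  set κ := 1 / (β * M)
  set P := Measure.pi fun k => chiLaw (dof (n + 1) M β k) with hP
  set S : Set (Fin (n + 1) → ℝ) := {l | StrictMono l} with hS
  let lw : (Fin (n + 1) → ℝ) → ENNReal := fun l => ENNReal.ofReal (laguerreWeight (n + 1) M β l)
  have hlw : Measurable lw := (measurable_laguerreWeight _ M β).ennreal_ofReal
  let Wt : ENNReal := ∫⁻ w : Fin (n + 1) → ℝ, ENNReal.ofReal (∏ i, gammaWeight β (w i))
  let g : (Fin (n + 1) → ℝ) → ENNReal := fun l =>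
    (∑ i, ENNReal.ofReal (l i) ^ r) / ((n + 1 : ℕ) : ENNReal)
  have hg : Measurable g := by fun_prop
  have hgw : Measurable fun w : Fin (n + 1) → ℝ => ENNReal.ofReal (∏ i, gammaWeight β (w i)) :=
    (Finset.measurable_fun_prod _ fun i _ =>
      (measurable_gammaWeight β).comp (measurable_pi_apply i)).ennreal_ofReal
  -- For functions of the atoms alone the weights integrate out to a constant.
  have hatoms : ∀ (h : (Fin (n + 1) ⊕ Fin (n + 1) → ℝ) → ENNReal) (g : (Fin (n + 1) → ℝ) → ENNReal),
      Measurable g →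
      (∀ t y, (∀ k, 0 < t k) → IsSpectralData κ t y → h t = g fun i => y (Sum.inr i)) →
      ∫⁻ t, h t ∂P = K * Wt * ∫⁻ l in S, lw l * g l := by
    intro h g hg hh
    rw [hK h (fun y => g fun i => y (Sum.inr i)) hh,
      lintegral_chamber_eq (H := fun y => g fun i => y (Sum.inr i))
        (hg.comp (measurable_pi_iff.2 fun i => measurable_pi_apply _)), mul_assoc,
      ← lintegral_const_mul Wt (f := fun l => lw l * g l) (hlw.mul hg)]
    congr 1
    refine lintegral_congr fun l => ?_
    simp only [Sum.elim_inr]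
    rw [lintegral_mul_const _ hgw]
    simp only [lw, Wt]
    ring
  have htrace : ∫⁻ t, ENNReal.ofReal
      (1 / ((n + 1 : ℕ) : ℝ) * (jacobiFin (n + 1) κ (interleave t) ^ r).trace) ∂P =
      K * Wt * ∫⁻ l in S, lw l * g l := by
    refine hatoms _ g hg fun t y _ hy => ?_
    have hpos : ∀ i, 0 ≤ y (Sum.inr i) := fun i => (hy.mem_chamber.1 _).le
    simp only [g]
    rw [hy.trace, one_div, ← div_eq_inv_mul, ENNReal.ofReal_div_of_pos (by positivity),
      ENNReal.ofReal_sum_of_nonneg fun i _ => pow_nonneg (hpos i) r, ENNReal.ofReal_natCast]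
    simp only [ENNReal.ofReal_pow (hpos _)]
  -- The constant function 1 identifies the unknown constant as the inverse of the ordered partition
  -- function.
  have hone : K * Wt * ∫⁻ l in S, lw l = 1 := by
    have h1 := hatoms (fun _ => 1) (fun _ => 1) measurable_const fun _ _ _ _ => rfl
    simpa using h1.symm
  refine ⟨?_, ?_⟩
  -- The corner entry of the power is ∑ w_i λ_i^r / ∑ w_i, so averaging over the weights replaces it
  -- by the mean of the λ_i^r.
  · rw [htrace, hK _ (fun y => (∑ i, ENNReal.ofReal (y (Sum.inl i)) *
      ENNReal.ofReal (y (Sum.inr i)) ^ r) / ∑ i, ENNReal.ofReal (y (Sum.inl i))),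
      lintegral_chamber_eq (by fun_prop), mul_assoc,
      ← lintegral_const_mul Wt (f := fun l => lw l * g l) (hlw.mul hg)]
    · congr 1
      refine lintegral_congr fun l => ?_
      simp only [Sum.elim_inr, Sum.elim_inl]
      rw [lintegral_gammaWeight_mul_average β fun i => ENNReal.ofReal (l i) ^ r]
      simp only [lw, Wt, g]
      ring
    · intro t y ht hy
      have hpos : ∀ k, 0 ≤ y k := fun k => (hy.mem_chamber.1 _).le
      have h2 : ∀ i, ENNReal.ofReal (y (Sum.inl i)) * ENNReal.ofReal (y (Sum.inr i)) ^ r =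
          ENNReal.ofReal (y (Sum.inl i) * y (Sum.inr i) ^ r) := fun i => by
        rw [ENNReal.ofReal_mul (hpos _), ENNReal.ofReal_pow (hpos _)]
      simp only [h2]
      rw [← ENNReal.ofReal_sum_of_nonneg fun i _ => hpos _, ← ENNReal.ofReal_sum_of_nonneg
        fun i _ => mul_nonneg (hpos _) (pow_nonneg (hpos _) _), hy.sum_weights, ← hy.moment,
        ← ENNReal.ofReal_div_of_pos (pow_pos (ht _) 2),
        mul_div_cancel_left₀ _ (pow_pos (ht _) 2).ne']
  · have hfact : ∀ g : (Fin (n + 1) → ℝ) → ENNReal, Measurable g →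
        (∀ l (σ : Equiv.Perm (Fin (n + 1))), g (l ∘ σ) = g l) →
        ∫⁻ l, lw l * g l = ((n + 1).factorial : ENNReal) * ∫⁻ l in S, lw l * g l := by
      intro g hg hsymm
      refine lintegral_eq_factorial_mul (hlw.mul hg) (fun l σ => ?_) fun l hl => ?_
      · simp only [lw, laguerreWeight_comp_perm, hsymm]
      · simp [lw, laguerreWeight_eq_zero hβ hl]
    have hZ : laguerreZ (n + 1) M β = ((n + 1).factorial : ENNReal) * ∫⁻ l in S, lw l := by
      have h2 := hfact (fun _ => 1) measurable_const fun _ _ => rfl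
      simp only [mul_one] at h2
      exact h2
    have hf0 : ((n + 1).factorial : ENNReal) ≠ 0 := by exact_mod_cast (n + 1).factorial_ne_zero
    have hft : ((n + 1).factorial : ENNReal) ≠ ⊤ := ENNReal.natCast_ne_top _
    rw [htrace, laguerreEnsemble, lintegral_smul_measure, lintegral_withDensity_eq_lintegral_mul _
      hlw hg, smul_eq_mul]
    have h3 : ∫⁻ l, (lw * g) l = ((n + 1).factorial : ENNReal) * ∫⁻ l in S, lw l * g l := by
      refine hfact g hg fun l σ => ?_
      simp only [g, Function.comp_apply]
      rw [Equiv.sum_comp σ fun i => ENNReal.ofReal (l i) ^ r]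
    refine Eq.trans (congrArg _ h3) ?_
    rw [hZ, ENNReal.mul_inv (Or.inl hf0) (Or.inl hft), ENNReal.eq_inv_of_mul_eq_one_left hone]
    calc _ = (((n + 1).factorial : ENNReal)⁻¹ * ((n + 1).factorial : ENNReal)) *
          ((∫⁻ l in S, lw l)⁻¹ * ∫⁻ l in S, lw l * g l) := by ring
      _ = _ := by rw [ENNReal.inv_mul_cancel hf0 hft, one_mul]

end BetaLaguerre

/-! ### Transfer to the random bidiagonal model. -/

namespace BetaLaguerre

variable {n : ℕ}

/-- The variables of the bidiagonal model among all chi variables. -/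
def toVariables (t : Fin (n + 1) ⊕ Fin (n + 1) → ℝ) :
    (Fin (n + 1) → ℝ) × (Fin (n + 1 - 1) → ℝ) :=
  (fun i => t (Sum.inr i), fun i : Fin n => t (Sum.inl i.succ))

/-- The auxiliary χ_{βN} variable is projected away. The remaining ones have exactly the degrees of
freedom of the subdiagonal after the index shift. -/
lemma measurePreserving_toVariables {M β : ℝ} (hβ : 0 < β) (hM : (n : ℝ) < M) :
    MeasurePreserving toVariables (Measure.pi fun k => chiLaw (dof (n + 1) M β k))
      (chiVariables (n + 1) M β) := by
  have hprob : ∀ k, IsProbabilityMeasure (chiLaw (dof (n + 1) M β k)) :=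
    isProbabilityMeasure_chiLaw_dof hβ (by push_cast; linarith)
  have h1 := measurePreserving_sumPiEquivProdPi fun k => chiLaw (dof (n + 1) M β k)
  have h2 := measurePreserving_piFinSuccAbove
    (fun i : Fin (n + 1) => chiLaw (dof (n + 1) M β (Sum.inl i))) 0
  have h3 : MeasurePreserving Prod.snd _ _ := measurePreserving_snd
    (μ := chiLaw (dof (n + 1) M β (Sum.inl 0)))
    (ν := Measure.pi fun j : Fin n => chiLaw (dof (n + 1) M β (Sum.inl (Fin.succAbove 0 j))))
  have h4 := (((h3.comp h2).prod (MeasurePreserving.id (Measure.pi fun i : Fin (n + 1) =>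
    chiLaw (dof (n + 1) M β (Sum.inr i))))).comp h1)
  have h5 := Measure.measurePreserving_swap.comp h4
  have e : (Measure.pi fun j : Fin n => chiLaw (dof (n + 1) M β (Sum.inl (Fin.succAbove 0 j)))) =
      Measure.pi fun i : Fin n => chiLaw (β * (((n + 1 : ℕ) : ℝ) - 1 - (i : ℕ))) := by
    congr 1
    funext i
    congr 1
    simp [dof]
  rw [e] at h5
  exact h5

lemma J_toVariables {M β : ℝ} (h : 0 < β * M) (t : Fin (n + 1) ⊕ Fin (n + 1) → ℝ) :
    J (n + 1) M β (toVariables t) = jacobiFin (n + 1) (1 / (β * M)) (interleave t) := by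
  have hB : B (n + 1) M β (toVariables t) =
      (1 / Real.sqrt (β * M)) • bidiagFin (n + 1) (interleave t) := by
    rw [B]
    congr 1
    ext i j
    simp only [Matrix.of_apply, bidiagFin, bidiag, toVariables]
    by_cases hij : i = j
    · rw [if_pos hij, if_pos (by rw [hij])]
      exact (interleave_rank t (Sum.inr i)).symm
    · have hij' : (i : ℕ) ≠ j := fun h => hij (Fin.ext h)
      rw [if_neg hij, if_neg hij']
      split_ifs with h1
      · rw [← rank_inl i, interleave_rank]
        congr 2
        exact Fin.ext h1.symm
      · rfl
  rw [J, hB, jacobiFin, Matrix.transpose_smul, Matrix.smul_mul, Matrix.mul_smul, smul_smul]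
  congr 1
  rw [← sq, div_pow, one_pow, Real.sq_sqrt h.le]

lemma continuous_J (N : ℕ) (M β : ℝ) : Continuous (J N M β) := by
  have hB : Continuous (B N M β) := by
    refine continuous_matrix fun i j => ?_
    simp only [B, Matrix.smul_apply, Matrix.of_apply]
    split_ifs <;> fun_prop
  exact hB.matrix_mul hB.matrix_transpose

lemma integral_empirical {N : ℕ} (x : Fin N → ℝ) (r : ℕ) :
    ∫ t, t ^ r ∂(empirical x) = 1 / (N : ℝ) * ∑ i, x i ^ r := by
  rw [empirical, integral_smul_measure, integral_finsetSum_measure fun i _ =>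
    integrable_dirac (by simp)]
  simp

lemma ae_pos_laguerreEnsemble (N : ℕ) (M β : ℝ) :
    ∀ᵐ x ∂(laguerreEnsemble N M β), ∀ i, 0 < x i := by
  refine Measure.ae_smul_measure ?_ _
  rw [ae_withDensity_iff (measurable_laguerreWeight N M β).ennreal_ofReal]
  refine ae_of_all _ fun x hx => ?_
  by_contra h
  exact hx (by rw [laguerreWeight_of_not_pos h, ENNReal.ofReal_zero])

/-- The three expectations are finite, agree, and are given by moments of chi variables. -/
lemma expectations_eq {M β : ℝ} (hβ : 0 < β) (hM : (n : ℝ) < M) (r : ℕ) :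
    Integrable (fun x => ∫ t, t ^ r ∂(empirical x)) (laguerreEnsemble (n + 1) M β) ∧
    Integrable (fun ω => 1 / ((n + 1 : ℕ) : ℝ) * (J (n + 1) M β ω ^ r).trace)
      (chiVariables (n + 1) M β) ∧
    Integrable (fun ω => topLeft (J (n + 1) M β ω ^ r)) (chiVariables (n + 1) M β) ∧
    ∫ x, (∫ t, t ^ r ∂(empirical x)) ∂(laguerreEnsemble (n + 1) M β) =
      ∫ ω, 1 / ((n + 1 : ℕ) : ℝ) * (J (n + 1) M β ω ^ r).trace ∂(chiVariables (n + 1) M β) ∧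
    ∫ ω, 1 / ((n + 1 : ℕ) : ℝ) * (J (n + 1) M β ω ^ r).trace ∂(chiVariables (n + 1) M β) =
      ∫ ω, topLeft (J (n + 1) M β ω ^ r) ∂(chiVariables (n + 1) M β) ∧
    ∫ ω, topLeft (J (n + 1) M β ω ^ r) ∂(chiVariables (n + 1) M β) =
      (2 / (β * M)) ^ r * expect (chiSqMoment (n + 1) M β) (stieltjes r MvPolynomial.X) := by
  have hβM : 0 < β * M := mul_pos hβ (lt_of_le_of_lt (Nat.cast_nonneg n) hM)
  have hmp := measurePreserving_toVariables hβ hM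
  obtain ⟨hint, hval⟩ := integral_jacobiFin_pow_zero_zero hβ hM r
  obtain ⟨htr, hlag⟩ := lintegral_average_eq hβ hM r
  set P := Measure.pi fun k => chiLaw (dof (n + 1) M β k)
  have htop : ∀ A : Matrix (Fin (n + 1)) (Fin (n + 1)) ℝ, topLeft A = A 0 0 := fun A =>
    dif_pos n.succ_pos
  have hJr : Continuous fun ω => J (n + 1) M β ω ^ r := (continuous_J _ M β).pow r
  have hpsd : ∀ t : Fin (n + 1) ⊕ Fin (n + 1) → ℝ,
      (jacobiFin (n + 1) (1 / (β * M)) (interleave t) ^ r).PosSemidef := fun t =>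
    (posSemidef_jacobiFin _ (by positivity) _).pow r
  have hm1 : AEStronglyMeasurable (fun ω => topLeft (J (n + 1) M β ω ^ r))
      (chiVariables (n + 1) M β) := by
    simp only [htop]
    exact (hJr.matrix_elem 0 0).aestronglyMeasurable
  have hm2 : AEStronglyMeasurable (fun ω => 1 / ((n + 1 : ℕ) : ℝ) * (J (n + 1) M β ω ^ r).trace)
      (chiVariables (n + 1) M β) :=
    (continuous_const.mul hJr.matrix_trace).aestronglyMeasurable
  have e1 : (fun t => topLeft (J (n + 1) M β (toVariables t) ^ r)) =
      fun t => (jacobiFin (n + 1) (1 / (β * M)) (interleave t) ^ r) 0 0 := by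
    funext t; rw [htop, J_toVariables hβM]
  have e2 : (fun t => 1 / ((n + 1 : ℕ) : ℝ) * (J (n + 1) M β (toVariables t) ^ r).trace) =
      fun t => 1 / ((n + 1 : ℕ) : ℝ) *
        (jacobiFin (n + 1) (1 / (β * M)) (interleave t) ^ r).trace := by
    funext t; rw [J_toVariables hβM]
  have i1 : ∫ ω, topLeft (J (n + 1) M β ω ^ r) ∂(chiVariables (n + 1) M β) =
      ∫ t, (jacobiFin (n + 1) (1 / (β * M)) (interleave t) ^ r) 0 0 ∂P := by
    rw [← hmp.map_eq] at hm1 ⊢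
    rw [integral_map hmp.measurable.aemeasurable hm1, e1]
  have i2 : ∫ ω, 1 / ((n + 1 : ℕ) : ℝ) * (J (n + 1) M β ω ^ r).trace
      ∂(chiVariables (n + 1) M β) = ∫ t, 1 / ((n + 1 : ℕ) : ℝ) *
        (jacobiFin (n + 1) (1 / (β * M)) (interleave t) ^ r).trace ∂P := by
    rw [← hmp.map_eq] at hm2 ⊢
    rw [integral_map hmp.measurable.aemeasurable hm2, e2]
  have n1 : ∀ t : Fin (n + 1) ⊕ Fin (n + 1) → ℝ,
      0 ≤ (jacobiFin (n + 1) (1 / (β * M)) (interleave t) ^ r) 0 0 := fun t =>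
    (hpsd t).diag_nonneg
  have n2 : ∀ t : Fin (n + 1) ⊕ Fin (n + 1) → ℝ, 0 ≤ 1 / ((n + 1 : ℕ) : ℝ) *
      (jacobiFin (n + 1) (1 / (β * M)) (interleave t) ^ r).trace := fun t =>
    mul_nonneg (by positivity) (hpsd t).trace_nonneg
  have m2 : AEStronglyMeasurable (fun t => 1 / ((n + 1 : ℕ) : ℝ) *
      (jacobiFin (n + 1) (1 / (β * M)) (interleave t) ^ r).trace) P := by
    have := hm2.comp_measurePreserving hmp
    rwa [Function.comp_def, e2] at this
  -- Integrability is known directly only for the corner entry, a polynomial in chi variables. By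
  -- nonnegativity the equality of integrals carries it to the trace and to the ensemble.
  have fin1 := (lintegral_ofReal_ne_top_iff_integrable hint.1 (ae_of_all _ n1)).2 hint
  have hint2 := (lintegral_ofReal_ne_top_iff_integrable m2 (ae_of_all _ n2)).1
    (htr ▸ fin1)
  have hx : (fun x : Fin (n + 1) → ℝ => ∫ t, t ^ r ∂(empirical x)) =
      fun x => 1 / ((n + 1 : ℕ) : ℝ) * ∑ i, x i ^ r := by
    funext x; rw [integral_empirical]
  have m3 : AEStronglyMeasurable
      (fun x : Fin (n + 1) → ℝ => 1 / ((n + 1 : ℕ) : ℝ) * ∑ i, x i ^ r)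
      (laguerreEnsemble (n + 1) M β) :=
    Continuous.aestronglyMeasurable (by fun_prop)
  have n3 : 0 ≤ᵐ[laguerreEnsemble (n + 1) M β]
      fun x : Fin (n + 1) → ℝ => 1 / ((n + 1 : ℕ) : ℝ) * ∑ i, x i ^ r := by
    filter_upwards [ae_pos_laguerreEnsemble (n + 1) M β] with x hx
    exact mul_nonneg (by positivity) (Finset.sum_nonneg fun i _ => (pow_pos (hx i) r).le)
  have l3 : ∫⁻ x, ENNReal.ofReal (1 / ((n + 1 : ℕ) : ℝ) * ∑ i, x i ^ r)
      ∂(laguerreEnsemble (n + 1) M β) = ∫⁻ t, ENNReal.ofReal (1 / ((n + 1 : ℕ) : ℝ) *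
        (jacobiFin (n + 1) (1 / (β * M)) (interleave t) ^ r).trace) ∂P := by
    rw [← hlag]
    refine lintegral_congr_ae ?_
    filter_upwards [ae_pos_laguerreEnsemble (n + 1) M β] with x hx
    rw [one_div, ← div_eq_inv_mul, ENNReal.ofReal_div_of_pos (by positivity),
      ENNReal.ofReal_sum_of_nonneg fun i _ => (pow_pos (hx i) r).le, ENNReal.ofReal_natCast]
    simp only [ENNReal.ofReal_pow (hx _).le]
  have t2 : ∫ t, 1 / ((n + 1 : ℕ) : ℝ) *
      (jacobiFin (n + 1) (1 / (β * M)) (interleave t) ^ r).trace ∂P =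
      ∫ t, (jacobiFin (n + 1) (1 / (β * M)) (interleave t) ^ r) 0 0 ∂P := by
    rw [integral_eq_lintegral_of_nonneg_ae (ae_of_all _ n2) m2,
      integral_eq_lintegral_of_nonneg_ae (ae_of_all _ n1) hint.1, htr]
  rw [i1, i2, hx]
  refine ⟨?_, ?_, ?_, ?_, t2, hval⟩
  · refine (lintegral_ofReal_ne_top_iff_integrable m3 n3).1 ?_
    rw [l3, ← htr]
    exact fin1
  · refine (hmp.integrable_comp hm2).1 ?_
    rw [Function.comp_def, e2]
    exact hint2
  · refine (hmp.integrable_comp hm1).1 ?_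
    rw [Function.comp_def, e1]
    exact hint
  · rw [integral_eq_lintegral_of_nonneg_ae n3 m3, l3,
      integral_eq_lintegral_of_nonneg_ae (ae_of_all _ n2) m2]

end BetaLaguerre

namespace BetaLaguerre

/-! ### The spectral measure of the limiting Jacobi matrix -/

lemma W_eq_bidiag (γ c : ℝ) :
    W γ c = bidiag fun d =>
      if Even d then Real.sqrt (c + (d / 2 : ℕ)) else Real.sqrt (c / γ + (d / 2 : ℕ)) := by
  ext i j
  have h1 : (2 * i + 1) / 2 = i := by omega
  simp [W, bidiag, h1]

lemma gaussSeq_nonneg {a b : ℝ} (ha : 0 ≤ a) (hb : 0 ≤ b) (j : ℕ) : 0 ≤ gaussSeq a b j := by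
  rcases Nat.even_or_odd' j with ⟨i, rfl | rfl⟩
  · rw [gaussSeq_even]; positivity
  · rw [gaussSeq_odd]; positivity

/-- Both sequences grow with slope 1 along each parity, and C dominates the two starting values and
1. -/
lemma gaussSeq_le {a b C : ℝ} (ha : a ≤ C) (hb : b + 1 ≤ C) (hC : 1 ≤ C) (j : ℕ) :
    gaussSeq a b j ≤ C * gaussSeq 1 0 j := by
  rcases Nat.even_or_odd' j with ⟨i, rfl | rfl⟩
  · rw [gaussSeq_even, gaussSeq_even]
    have : (0 : ℝ) ≤ i := i.cast_nonneg
    nlinarith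
  · rw [gaussSeq_odd, gaussSeq_odd]
    have : (0 : ℝ) ≤ i := i.cast_nonneg
    nlinarith

/-- The squared entries of `W`, read along the path, are c/γ, c+1, c/γ+1, c+2, …: the coefficients
of Gauss's continued fraction. -/
lemma infPow_limitJacobi {γ c : ℝ} (hγ : 0 < γ) (hc : 0 < c) (r : ℕ) :
    infPow (limitJacobi γ c) r 0 0 = (γ / c) ^ r * stieltjes r (gaussSeq (c / γ) c) := by
  rw [limitJacobi, W_eq_bidiag, infPow_bidiag_zero_zero]
  congr 2
  funext j
  rcases Nat.even_or_odd' j with ⟨i, rfl | rfl⟩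
  · have h1 : (2 * i + 1) / 2 = i := by omega
    rw [gaussSeq_even, if_neg (by simp), h1, Real.sq_sqrt (by positivity)]
  · have h1 : (2 * i + 1 + 1) / 2 = i + 1 := by omega
    rw [gaussSeq_odd, if_pos (by simp [parity_simps]), h1, Real.sq_sqrt (by positivity)]
    push_cast; ring

lemma infPow_limitJacobi_le {γ c : ℝ} (hγ : 0 < γ) (hc : 0 < c) :
    ∃ C : ℝ, 0 < C ∧ ∀ r, infPow (limitJacobi γ c) r 0 0 ≤ C ^ r * r.factorial := by
  let D := max (c / γ) (c + 1)
  have hD : 1 ≤ D := le_trans (by linarith) (le_max_right _ _)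
  refine ⟨γ / c * D, by positivity, fun r => ?_⟩
  rw [infPow_limitJacobi hγ hc, mul_pow, mul_assoc]
  refine mul_le_mul_of_nonneg_left ?_ (by positivity)
  rw [← stieltjes_gaussSeq_one_zero, ← stieltjes_mul]
  exact (stieltjes_mono (gaussSeq_nonneg (by positivity) hc.le)
    (gaussSeq_le (le_max_left _ _) (le_max_right _ _) hD) r).2

/-- Existence needs only nonnegative continued fraction coefficients; uniqueness uses the factorial
growth bound. -/
lemma exists_isSpectralMeasure {γ c : ℝ} (hγ : 0 < γ) (hc : 0 < c) :
    ∃ ν : Measure ℝ, IsSpectralMeasure (limitJacobi γ c) ν := by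
  obtain ⟨C, hC, hbound⟩ := infPow_limitJacobi_le hγ hc
  obtain ⟨ν, hν, hmom⟩ := exists_of_truncated_moments
    (m := fun k => infPow (limitJacobi γ c) k 0 0) fun n => by
      obtain ⟨μ, hμ, h⟩ := exists_measure_stieltjes
        (z := fun j => γ / c * gaussSeq (c / γ) c j)
        (fun j => mul_nonneg (by positivity) (gaussSeq_nonneg (by positivity) hc.le j)) n
      refine ⟨μ, hμ, fun k hk => ⟨(h k hk).1, ?_⟩⟩
      rw [(h k hk).2, stieltjes_mul, infPow_limitJacobi hγ hc]
  refine ⟨ν, ⟨hν, hmom⟩, fun ν' hν' => ?_⟩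
  have := hν'.1
  exact eq_of_moments_eq hC (fun k => (hν'.2 k).1) (fun k => (hmom k).1)
    (fun k => by rw [(hν'.2 k).2, (hmom k).2]) fun k => by rw [(hν'.2 k).2]; exact hbound k

/-! ### The limit of the moments -/

variable {γ c : ℝ} {β M : ℕ → ℝ}

lemma tendsto_mul_of_tendsto_div (hγ : 0 < γ)
    (hM : Tendsto (fun N : ℕ => (N : ℝ) / M N) atTop (𝓝 γ))
    (hβ : Tendsto (fun N : ℕ => β N * N) atTop (𝓝 (2 * c))) :
    Tendsto (fun N => β N * M N) atTop (𝓝 (2 * c / γ)) := by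
  refine (hβ.div hM hγ.ne').congr' ?_
  filter_upwards [eventually_ge_atTop 1] with N hN
  have hN0 : (N : ℝ) ≠ 0 := by exact_mod_cast (by omega : N ≠ 0)
  -- If M N vanishes, division by zero gives 0 on both sides.
  rcases eq_or_ne (M N) 0 with h | h
  · simp [h]
  · simp only [Pi.div_apply]; field_simp

/-- Since β → 0, the offset of a fixed position in the matrix disappears, and the degrees of freedom
depend in the limit only on its parity: 2c/γ on the diagonal and 2c below it. -/
lemma tendsto_chiSqMoment (hγ : 0 < γ)
    (hM : Tendsto (fun N : ℕ => (N : ℝ) / M N) atTop (𝓝 γ))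
    (hβ : Tendsto (fun N : ℕ => β N * N) atTop (𝓝 (2 * c))) (j m : ℕ) :
    Tendsto (fun N => chiSqMoment N (M N) (β N) j m) atTop (𝓝 (alternating (c / γ) c j m)) := by
  have hβ0 : Tendsto β atTop (𝓝 0) := by
    refine (hβ.div_atTop tendsto_natCast_atTop_atTop).congr' ?_
    filter_upwards [eventually_ge_atTop 1] with N hN
    have hN0 : (N : ℝ) ≠ 0 := by exact_mod_cast (by omega : N ≠ 0)
    field_simp
  have hβM := tendsto_mul_of_tendsto_div hγ hM hβ
  have hdof : Tendsto (fun N => seqDof N (M N) (β N) (j + 1) / 2) atTop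
      (𝓝 (if Even j then c / γ else c)) := by
    by_cases hj : Even j
    · have hj' : ¬ Even (j + 1) := by simpa [Nat.even_add_one] using hj
      simp only [seqDof, if_pos hj, if_neg hj', mul_sub]
      have h := (hβM.sub (hβ0.mul_const ((((j + 1) / 2 : ℕ)) : ℝ))).div_const 2
      convert h using 2
      ring
    · have hj' : Even (j + 1) := Nat.even_add_one.2 hj
      simp only [seqDof, if_neg hj, if_pos hj', mul_sub]
      have h := (hβ.sub (hβ0.mul_const ((((j + 1) / 2 : ℕ)) : ℝ))).div_const 2
      convert h using 2
      ring
  refine Tendsto.congr' ?_ (tendsto_finsetProd (Finset.range m) fun i _ =>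
    hdof.add_const (i : ℝ))
  -- For N > j the position j + 1 lies inside the matrix, so the continuation by zeros is not seen.
  filter_upwards [eventually_gt_atTop j] with N hN
  rw [chiSqMoment, if_pos (by omega), rising]

/-- The polynomial is fixed while the moments of its variables converge. The limit is the expected
continued fraction with alternating gamma coefficients, which is Gauss's. -/
lemma tendsto_expect_chiSqMoment (hγ : 0 < γ) (hc : 0 < c)
    (hM : Tendsto (fun N : ℕ => (N : ℝ) / M N) atTop (𝓝 γ))
    (hβ : Tendsto (fun N : ℕ => β N * N) atTop (𝓝 (2 * c))) (r : ℕ) :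
    Tendsto (fun N => (2 / (β N * M N)) ^ r *
        expect (chiSqMoment N (M N) (β N)) (stieltjes r MvPolynomial.X))
      atTop (𝓝 (infPow (limitJacobi γ c) r 0 0)) := by
  rw [infPow_limitJacobi hγ hc, ← expect_stieltjes_alternating]
  refine Tendsto.mul (Tendsto.pow ?_ r) (tendsto_expect (tendsto_chiSqMoment hγ hM hβ) _)
  have h := (tendsto_const_nhds (x := (2 : ℝ))).div (tendsto_mul_of_tendsto_div hγ hM hβ)
    (by positivity)
  have e : 2 / (2 * c / γ) = γ / c := by field_simp
  rwa [e] at h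

end BetaLaguerre

/-! ### The theorem. -/

theorem theorem3p2 (γ c : ℝ) (hγ0 : 0 < γ) (hγ1 : γ < 1) (hc : 0 < c) :
    ∃ ν : Measure ℝ, BetaLaguerre.IsSpectralMeasure (BetaLaguerre.limitJacobi γ c) ν ∧
      ∀ β M : ℕ → ℝ,
        (∀ N : ℕ, 1 ≤ N → 0 < β N) →
        (∀ N : ℕ, 1 ≤ N → (N : ℝ) - 1 < M N) →
        Tendsto (fun N : ℕ => (N : ℝ) / M N) atTop (𝓝 γ) →
        Tendsto (fun N : ℕ => β N * N) atTop (𝓝 (2 * c)) →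
        ∀ r : ℕ,
          (∀ N : ℕ, 1 ≤ N →
            Integrable (fun x => ∫ t, t ^ r ∂(BetaLaguerre.empirical x))
              (BetaLaguerre.laguerreEnsemble N (M N) (β N)) ∧
            Integrable
              (fun ω => 1 / (N : ℝ) * (BetaLaguerre.J N (M N) (β N) ω ^ r).trace)
              (BetaLaguerre.chiVariables N (M N) (β N)) ∧
            Integrable
              (fun ω => BetaLaguerre.topLeft (BetaLaguerre.J N (M N) (β N) ω ^ r))
              (BetaLaguerre.chiVariables N (M N) (β N)) ∧
            ∫ x, (∫ t, t ^ r ∂(BetaLaguerre.empirical x))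
                ∂(BetaLaguerre.laguerreEnsemble N (M N) (β N)) =
              ∫ ω, 1 / (N : ℝ) * (BetaLaguerre.J N (M N) (β N) ω ^ r).trace
                ∂(BetaLaguerre.chiVariables N (M N) (β N)) ∧
            ∫ ω, 1 / (N : ℝ) * (BetaLaguerre.J N (M N) (β N) ω ^ r).trace
                ∂(BetaLaguerre.chiVariables N (M N) (β N)) =
              ∫ ω, BetaLaguerre.topLeft (BetaLaguerre.J N (M N) (β N) ω ^ r)
                ∂(BetaLaguerre.chiVariables N (M N) (β N))) ∧
          Tendsto
            (fun N : ℕ =>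
              ∫ x, (∫ t, t ^ r ∂(BetaLaguerre.empirical x))
                ∂(BetaLaguerre.laguerreEnsemble N (M N) (β N)))
            atTop (𝓝 (∫ t, t ^ r ∂ν)) := by
  obtain ⟨ν, hν⟩ := BetaLaguerre.exists_isSpectralMeasure hγ0 hc
  refine ⟨ν, hν, fun β M hβ hM hγ hβc r => ?_⟩
  have hN : ∀ n : ℕ, 0 < β (n + 1) ∧ (n : ℝ) < M (n + 1) := fun n => by
    refine ⟨hβ _ n.succ_pos, ?_⟩
    have := hM (n + 1) n.succ_pos
    push_cast at this
    linarith
  refine ⟨fun N h1 => ?_, ?_⟩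
  · obtain ⟨n, rfl⟩ := Nat.exists_eq_succ_of_ne_zero (Nat.one_le_iff_ne_zero.1 h1)
    obtain ⟨i1, i2, i3, e1, e2, -⟩ := BetaLaguerre.expectations_eq (hN n).1 (hN n).2 r
    exact ⟨i1, i2, i3, e1, e2⟩
  · rw [(hν.1.2 r).2]
    refine (BetaLaguerre.tendsto_expect_chiSqMoment hγ0 hc hγ hβc r).congr' ?_
    filter_upwards [eventually_ge_atTop 1] with N h1
    obtain ⟨n, rfl⟩ := Nat.exists_eq_succ_of_ne_zero (Nat.one_le_iff_ne_zero.1 h1)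
    obtain ⟨-, -, -, e1, e2, e3⟩ := BetaLaguerre.expectations_eq (hN n).1 (hN n).2 r
    rw [e1, e2, e3]
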